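/- Let $\mathcal D$ be a division ring, $\tau$ an automorphism of $\mathcal D$ of finite inner order (that is, for some $m\ge 1$ and some non-zero $a\in\mathcal D$ one has $\tau^m(d)=a^{-1}da$ for all $d\in\mathcal D$), and let $R=\mathcal D[t^{\pm1};\tau]$ be the skew Laurent polynomial ring, in which $td=\tau(d)t$ for $d\in\mathcal D$. Let $Z(R)$ be its centre. For a ring $A$, a \emph{Sylvester (matrix) rank function} on $A$ is a map $\mathrm{rk}$ assigning to each matrix over $A$ a non-negative real number such that: $\mathrm{rk}$ of any zero matrix is $0$ and $\mathrm{rk}(1)=1$; $\mathrm{rk}(MN)\le\min\{\mathrm{rk}(M),\mathrm{rk}(N)\}$ whenever $MN$ is defined; $\mathrm{rk}\begin{pmatrix}M&0\\0&N\end{pmatrix}=\mathrm{rk}(M)+\mathrm{rk}(N)$; and $\mathrm{rk}\begin{pmatrix}M&P\\0&N\end{pmatrix}\ge\mathrm{rk}(M)+\mathrm{rk}(N)$. Let $\mathbb P(A)$ be the convex set of all of them, inside the space of real-valued functions on matrices over $A$; the associated Sylvester module rank function is given by $\dim(A^n/A^mM)=n-\mathrm{rk}(M)$ for an $m\times n$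 matrix $M$. For a ring homomorphism $\varphi:A\to B$ put $\varphi^\sharp(\mathrm{rk})(M)=\mathrm{rk}(\varphi(M))$. A rank function on $A$ is \emph{regular} if it equals $\varphi^\sharp(\mathrm{rk}')$ for some ring homomorphism $\varphi$ from $A$ to a von Neumann regular ring $U$ and some $\mathrm{rk}'\in\mathbb P(U)$; $\mathbb P_{\mathrm{reg}}(A)$ is the set of regular rank functions. Let $\mathrm{rk}_0$ be the pull-back to $R$ of the usual rank of matrices over the Ore quotient ring of $R$, which is a division ring. For a maximal two-sided ideal $\mathfrak m$ of $R$ and $k\ge1$ let $\mathrm{rk}_{\mathfrak m,k}$ be the pull-back to $R$ of the normalized rank over $\mathcal D$ under the action of $R$ by right multiplication on the finite-dimensional left $\mathcal D$-space $R/\mathfrak m^k$, i.e. for an $m\times n$ matrix $M$ over $R$, $$\mathrm{rk}_{\mathfrak m,k}(M)=\frac{\dim_{\mathcal D}\big((R/\mathfrak m^k)^m M\big)}{\dim_{\mathcal D}(R/\mathfrak m^k)}.$$ Let $\dim_0$ and $\dim_{\mathfrak m,k}$ be the associated module rank functions. Then: 1. Every maximal two-sided ideal $\mathfrak m$ of $R$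 is of the form $Rp$ with $p\in Z(R)$, and for every such $p$ and every $k\ge1$, $\mathrm{rk}_{\mathfrak m,k}$ is the unique element of $\mathbb P(R)$ with $\mathrm{rk}_{\mathfrak m,k}(p^i)=\frac{k-i}{k}$ for $0\le i\le k$. 2. The extreme points of $\mathbb P(R)$ are precisely $\mathrm{rk}_0$ and the functions $\mathrm{rk}_{\mathfrak m,k}$ (equivalently $\dim_0$ and $\dim_{\mathfrak m,k}$). 3. Every $\mathrm{rk}\in\mathbb P(R)$ can be uniquely expressed as a possibly infinite convex combination of them: there are unique coefficients $c_0\ge 0$, $c_{\mathfrak m,k}\ge0$ with $$c_0+\sum_{\mathfrak m,k}c_{\mathfrak m,k}=1\quad\text{and}\quad \mathrm{rk}(M)=c_0\,\mathrm{rk}_0(M)+\sum_{\mathfrak m,k}c_{\mathfrak m,k}\,\mathrm{rk}_{\mathfrak m,k}(M)\ \text{ for every matrix } M \text{ over } R .$$ 4. $\mathbb P(R)=\mathbb P_{\mathrm{reg}}(R)$. 5. For the inclusion $\iota:Z(R)\to R$, the map $\iota^\sharp:\mathbb P(R)\to\mathbb P(Z(R))$ is a bijection. -/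

import Mathlib

universe u

open scoped nonZeroDivisors

/-! ### Sylvester matrix rank functions -/

/-- Real-valued functions on all finite matrices over `R` (a real vector space under the pointwise
operations). -/
abbrev MatFun (R : Type u) : Type u :=
  (m n : ℕ) → Matrix (Fin m) (Fin n) R → ℝ

/-- The block matrix with block rows `(A, C)` and `(0, B)`. -/
def blockUpper {R : Type u} [Zero R] {m n p q : ℕ} (A : Matrix (Fin m) (Fin n) R)
    (C : Matrix (Fin m) (Fin q) R) (B : Matrix (Fin p) (Fin q) R) :
    Matrix (Fin (m + p)) (Fin (n + q)) R :=
  Matrix.reindex finSumFinEquiv finSumFinEquiv (Matrix.fromBlocks A C 0 B)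

/-- `rk` is a Sylvester matrix rank function on the ring `R`. -/
structure IsSylvesterRank {R : Type u} [Ring R] (rk : MatFun R) : Prop where
  nonneg : ∀ (m n : ℕ) (A : Matrix (Fin m) (Fin n) R), 0 ≤ rk m n A
  map_zero : ∀ m n : ℕ, rk m n 0 = 0
  map_one : rk 1 1 1 = 1
  mul_le : ∀ (m n p : ℕ) (A : Matrix (Fin m) (Fin n) R) (B : Matrix (Fin n) (Fin p) R),
    rk m p (A * B) ≤ min (rk m n A) (rk n p B)
  map_diag : ∀ (m n p q : ℕ) (A : Matrix (Fin m) (Fin n) R) (B : Matrix (Fin p) (Fin q) R),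
    rk (m + p) (n + q) (blockUpper A 0 B) = rk m n A + rk p q B
  le_map_upper : ∀ (m n p q : ℕ) (A : Matrix (Fin m) (Fin n) R) (C : Matrix (Fin m) (Fin q) R)
    (B : Matrix (Fin p) (Fin q) R),
    rk m n A + rk p q B ≤ rk (m + p) (n + q) (blockUpper A C B)

/-- The space `ℙ(R)` of Sylvester matrix rank functions on `R`. -/
def sylvesterSpace (R : Type u) [Ring R] : Set (MatFun R) :=
  {rk | IsSylvesterRank rk}

/-- The pull-back of a function on matrices along a ring homomorphism. -/
def pullbackRank {R S : Type u} [Ring R] [Ring S] (φ : R →+* S) (rk : MatFun S) : MatFun R :=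
  fun m n A => rk m n (A.map φ)

/-- Every `x` has some `y` with `x y x = x`. -/
def IsVonNeumannRegularRing (U : Type u) [Ring U] : Prop :=
  ∀ x : U, ∃ y : U, x * y * x = x

/-- The set `ℙ_reg(R)` of regular rank functions: those induced by a ring homomorphism to a
von Neumann regular ring carrying a Sylvester matrix rank function. -/
def regularSylvesterSpace (R : Type u) [Ring R] : Set (MatFun R) :=
  {rk | ∃ (U : Type u) (_ : Ring U) (φ : R →+* U) (rk' : MatFun U),
    IsVonNeumannRegularRing U ∧ rk' ∈ sylvesterSpace U ∧ rk = pullbackRank φ rk'}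

/-- The usual rank of matrices over a division ring `E`: the left dimension of the row space. -/
noncomputable def divisionRank (E : Type u) [DivisionRing E] : MatFun E :=
  fun _ _ A => (Module.finrank E (LinearMap.range A.vecMulLinear) : ℝ)

section dimRank

variable {K S : Type u} [DivisionRing K] [Ring S] (f : K →+* S)

/-- Right multiplication by a matrix over `S` on row vectors, as a `K`-linear map, where `K` acts
on `S` by left multiplication through `f`. -/
def rowMul {m n : ℕ} (A : Matrix (Fin m) (Fin n) S) :
    letI := Module.compHom S f
    (Fin m → S) →ₗ[K] (Fin n → S) :=
  letI := Module.compHom S f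
  { toFun := fun v => Matrix.vecMul v A
    map_add' := fun v w => Matrix.add_vecMul A v w
    map_smul' := fun c v => Matrix.smul_vecMul (f c) v A }

/-- For a ring `S` of finite left dimension `d` over `K` (through `f`), right multiplication gives
a ring homomorphism `S → End_K(S) ≅ Mat_d(K)` (endomorphisms acting on the right), and this is the
pull-back of the normalized rank `(1/d) rk_K`: the matrix `A` is sent to `1/d` times the
`K`-dimension of the image of `S^m → S^n, v ↦ vA`. -/
noncomputable def dimRank : MatFun S := fun _ _ A =>
  letI := Module.compHom S f
  (Module.finrank K (LinearMap.range (rowMul f A)) : ℝ) / (Module.finrank K S : ℝ)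

end dimRank

/-! ### Maximal two-sided ideals -/

/-- `I` is a maximal two-sided ideal: a proper two-sided ideal which is maximal among proper
two-sided ideals (`Ideal R` is the type of left ideals). -/
structure IsMaximalTwoSided {R : Type u} [Ring R] (I : Ideal R) : Prop where
  isTwoSided : I.IsTwoSided
  ne_top : I ≠ ⊤
  eq_top_of_lt : ∀ J : Ideal R, J.IsTwoSided → I < J → J = ⊤

/-- The type of maximal two-sided ideals of `R`. -/
abbrev MaxTwoSided (R : Type u) [Ring R] : Type u :=
  {I : Ideal R // IsMaximalTwoSided I}

instance {R : Type u} [Ring R] (𝔪 : MaxTwoSided R) : 𝔪.1.IsTwoSided := 𝔪.2.isTwoSided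

/-! ### Skew Laurent polynomial rings -/

/-- `τ` has finite inner order: some positive power of `τ` is an inner automorphism. -/
def HasFiniteInnerOrder {D : Type u} [DivisionRing D] (τ : D ≃+* D) : Prop :=
  ∃ m : ℕ, 0 < m ∧ ∃ a : D, a ≠ 0 ∧ ∀ d : D, (τ ^ m) d = a⁻¹ * d * a

/-- The skew Laurent polynomial ring `D[t^{±1}; τ]`: finite sums `∑ aᵢ tⁱ`, `i ∈ ℤ`, multiplied
according to `t d = τ(d) t`. It is the skew monoid algebra of the infinite cyclic group whose
generator acts on `D` as `τ`. -/
@[nolint unusedArguments]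
def SkewLaurent (D : Type u) [DivisionRing D] (_τ : D ≃+* D) : Type u :=
  SkewMonoidAlgebra D (Multiplicative ℤ)

namespace SkewLaurent

variable {D : Type u} [DivisionRing D] (τ : D ≃+* D)

/-- The action of the infinite cyclic group on `D` in which `n` acts as `τ ^ n`. -/
@[reducible]
def zpowAction : MulSemiringAction (Multiplicative ℤ) D :=
  MulSemiringAction.compHom D (zpowersHom (D ≃+* D) τ)

noncomputable instance : Ring (SkewLaurent D τ) :=
  letI := zpowAction τ
  inferInstanceAs (Ring (SkewMonoidAlgebra D (Multiplicative ℤ)))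

/-- The embedding of `D` as the constant Laurent polynomials. -/
noncomputable def C : D →+* SkewLaurent D τ :=
  letI := zpowAction τ
  (SkewMonoidAlgebra.singleOneRingHom : D →+* SkewMonoidAlgebra D (Multiplicative ℤ))

/-- The variable `t`. -/
noncomputable def t : SkewLaurent D τ :=
  (SkewMonoidAlgebra.single (Multiplicative.ofAdd (1 : ℤ)) (1 : D) :
    SkewMonoidAlgebra D (Multiplicative ℤ))

theorem t_mul_C (d : D) : t τ * C τ d = C τ (τ d) * t τ := by
  let _ := zpowAction τ
  have h : (Multiplicative.ofAdd (1 : ℤ)) • d = τ d := by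
    change (zpowersHom (D ≃+* D) τ (Multiplicative.ofAdd (1 : ℤ))) d = τ d
    simp
  have key : (SkewMonoidAlgebra.single (Multiplicative.ofAdd (1 : ℤ)) (1 : D) *
      SkewMonoidAlgebra.single 1 d : SkewMonoidAlgebra D (Multiplicative ℤ)) =
      SkewMonoidAlgebra.single 1 (τ d) * SkewMonoidAlgebra.single (Multiplicative.ofAdd 1) 1 := by
    simp [SkewMonoidAlgebra.single_mul_single, h]
  exact key

instance : Nontrivial (SkewLaurent D τ) :=
  inferInstanceAs (Nontrivial (SkewMonoidAlgebra D (Multiplicative ℤ)))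

section aux

variable [MulSemiringAction (Multiplicative ℤ) D]

theorem skew_noZeroDivisors : NoZeroDivisors (SkewMonoidAlgebra D (Multiplicative ℤ)) where
  eq_zero_or_eq_zero_of_mul_eq_zero {f g} hfg := by
    by_contra! h
    obtain ⟨hf, hg⟩ := h
    obtain ⟨a, ha, b, hb, hu⟩ := UniqueProds.uniqueMul_of_nonempty
      (Finset.nonempty_iff_ne_empty.2 (mt SkewMonoidAlgebra.support_eq_empty.1 hf))
      (Finset.nonempty_iff_ne_empty.2 (mt SkewMonoidAlgebra.support_eq_empty.1 hg))
    have h0 : (f * g).coeff (a * b) = 0 := by rw [hfg]; rfl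
    rw [SkewMonoidAlgebra.coeff_mul, SkewMonoidAlgebra.sum_def', Finset.sum_eq_single a,
      SkewMonoidAlgebra.sum_def', Finset.sum_eq_single b, if_pos rfl] at h0
    · rw [SkewMonoidAlgebra.mem_support_iff] at ha hb
      rcases mul_eq_zero.1 h0 with h | h
      · exact ha h
      · exact hb ((smul_eq_zero_iff_eq a).1 h)
    · intro y hy hyb
      exact if_neg fun e => hyb (hu ha hy e).2
    · exact fun h => absurd hb h
    · intro x hx hxa
      refine Finset.sum_eq_zero fun y hy => if_neg fun e => hxa (hu hx hy e).1
    · exact fun h => absurd ha h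

/-- The left Ore condition, by counting dimensions over `D`. -/
theorem skew_ore (a b : SkewMonoidAlgebra D (Multiplicative ℤ)) (hb : b ≠ 0) :
    ∃ x y : SkewMonoidAlgebra D (Multiplicative ℤ), y ≠ 0 ∧ y * a = x * b := by
  classical
  have := skew_noZeroDivisors (D := D)
  obtain ⟨N, hN⟩ : ∃ N : ℕ, ∀ g ∈ a.support ∪ b.support,
      g ∈ Finset.Icc (Multiplicative.ofAdd (-(N : ℤ))) (Multiplicative.ofAdd (N : ℤ)) := by
    refine ⟨(a.support ∪ b.support).sup fun g => g.toAdd.natAbs, fun g hg => ?_⟩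
    have h := Finset.le_sup (f := fun g : Multiplicative ℤ => g.toAdd.natAbs) hg
    refine Finset.mem_Icc.2 ⟨?_, ?_⟩
    · change -(((a.support ∪ b.support).sup fun g => g.toAdd.natAbs : ℕ) : ℤ) ≤ g.toAdd
      omega
    · change g.toAdd ≤ (((a.support ∪ b.support).sup fun g => g.toAdd.natAbs : ℕ) : ℤ)
      omega
  set n : ℕ := 2 * N + 1 with hn
  let T : Finset (Multiplicative ℤ) :=
    (Finset.Icc (-(N : ℤ)) (n + N : ℤ)).map Multiplicative.ofAdd.toEmbedding
  let v : Fin (n + 1) → SkewMonoidAlgebra D (Multiplicative ℤ) := fun i =>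
    SkewMonoidAlgebra.single (Multiplicative.ofAdd (i : ℤ)) 1
  have hv : LinearIndependent D v := by
    have h := (SkewMonoidAlgebra.basisSingleOne (k := D)
      (G := Multiplicative ℤ)).linearIndependent.comp
      (fun i : Fin (n + 1) => Multiplicative.ofAdd (i : ℤ))
      (fun i j hij => Fin.ext (Int.ofNat.inj (Multiplicative.ofAdd.injective hij)))
    exact h
  let P : (Fin (n + 1) → D) →ₗ[D] SkewMonoidAlgebra D (Multiplicative ℤ) :=
    Fintype.linearCombination D v
  have hP : Function.Injective P :=
    linearIndependent_iff_injective_fintypeLinearCombination.1 hv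
  have hsupp : ∀ (u : Fin (n + 1) → D) (c : SkewMonoidAlgebra D (Multiplicative ℤ)),
      c.support ⊆ a.support ∪ b.support → (P u * c).support ⊆ T := by
    intro u c hc g hg
    obtain ⟨x, hx, y, hy, rfl⟩ := Finset.mem_mul.1 (SkewMonoidAlgebra.support_mul _ _ hg)
    have hx' : ∃ i : Fin (n + 1), x = Multiplicative.ofAdd (i : ℤ) := by
      by_contra! hne
      rw [SkewMonoidAlgebra.mem_support_iff] at hx
      refine hx ?_
      simp only [P, v, Fintype.linearCombination_apply]
      have hsum : ∀ s : Finset (Fin (n + 1)),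
          (∑ i ∈ s, u i • (SkewMonoidAlgebra.single (Multiplicative.ofAdd (i : ℤ)) (1 : D) :
            SkewMonoidAlgebra D (Multiplicative ℤ))).coeff x = 0 := by
        intro s
        induction s using Finset.induction_on with
        | empty => simp
        | insert i s hi ih =>
          rw [Finset.sum_insert hi, SkewMonoidAlgebra.coeff_add, Finsupp.add_apply, ih,
            SkewMonoidAlgebra.coeff_smul, Finsupp.smul_apply, SkewMonoidAlgebra.coeff_single,
            Finsupp.single_eq_of_ne (hne i)]
          simp
      exact hsum _
    obtain ⟨i, rfl⟩ := hx'
    have h1 := Finset.mem_Icc.1 (hN y (hc hy))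
    have h2 : -(N : ℤ) ≤ y.toAdd := h1.1
    have h3 : y.toAdd ≤ (N : ℤ) := h1.2
    have h4 := i.2
    exact Finset.mem_map.2 ⟨(i : ℤ) + y.toAdd, Finset.mem_Icc.2 ⟨by omega, by omega⟩, rfl⟩
  let Ψ : ((Fin (n + 1) → D) × (Fin (n + 1) → D)) →ₗ[D] (T → D) :=
    { toFun := fun w g => (P w.1 * a - P w.2 * b).coeff g
      map_add' := fun w w' => by
        funext g
        simp [add_mul, sub_eq_add_neg]
        abel
      map_smul' := fun d w => by
        funext g
        simp [smul_mul_assoc, mul_sub] }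
  have hlt : Module.finrank D (T → D) <
      Module.finrank D ((Fin (n + 1) → D) × (Fin (n + 1) → D)) := by
    rw [Module.finrank_prod, Module.finrank_fintype_fun_eq_card,
      Module.finrank_fintype_fun_eq_card, Fintype.card_coe, Fintype.card_fin]
    rw [Finset.card_map, Int.card_Icc]
    omega
  obtain ⟨w, hw, hw0⟩ := Submodule.exists_mem_ne_zero_of_ne_bot
    (LinearMap.ker_ne_bot_of_finrank_lt (f := Ψ) hlt)
  have heq : P w.1 * a = P w.2 * b := by
    rw [← sub_eq_zero]
    ext g
    by_cases hg : g ∈ T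
    · exact congrFun (LinearMap.mem_ker.1 hw) ⟨g, hg⟩
    · have h1 : (P w.1 * a).coeff g = 0 := SkewMonoidAlgebra.notMem_support_iff.1
        fun h => hg (hsupp _ _ Finset.subset_union_left h)
      have h2 : (P w.2 * b).coeff g = 0 := SkewMonoidAlgebra.notMem_support_iff.1
        fun h => hg (hsupp _ _ Finset.subset_union_right h)
      simp [h1, h2]
  refine ⟨P w.2, P w.1, fun h1 => hw0 ?_, heq⟩
  have h2 : P w.2 = 0 := by
    rw [h1, zero_mul] at heq
    exact (mul_eq_zero.1 heq.symm).resolve_right hb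
  exact Prod.ext (hP (h1.trans (map_zero P).symm)) (hP (h2.trans (map_zero P).symm))

end aux

instance : NoZeroDivisors (SkewLaurent D τ) :=
  let _ := zpowAction τ
  (skew_noZeroDivisors : NoZeroDivisors (SkewMonoidAlgebra D (Multiplicative ℤ)))

theorem ore_condition (r : SkewLaurent D τ) (s : (SkewLaurent D τ)⁰) :
    ∃ (x : SkewLaurent D τ) (y : (SkewLaurent D τ)⁰), y * r = x * s := by
  let _ := zpowAction τ
  obtain ⟨x, y, hy, h⟩ := skew_ore (D := D) r s.1 (nonZeroDivisors.coe_ne_zero s)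
  exact ⟨x, ⟨y, mem_nonZeroDivisors_of_ne_zero hy⟩, h⟩

noncomputable instance : OreLocalization.OreSet (SkewLaurent D τ)⁰ :=
  OreLocalization.oreSetOfNoZeroDivisors (fun r s => (ore_condition τ r s).choose)
    (fun r s => (ore_condition τ r s).choose_spec.choose)
    (fun r s => (ore_condition τ r s).choose_spec.choose_spec)

/-- The rank function `rk₀` coming from the Ore quotient ring (a division ring). -/
noncomputable def rankZero : MatFun (SkewLaurent D τ) :=
  pullbackRank OreLocalization.numeratorRingHom
    (divisionRank (OreLocalization (SkewLaurent D τ)⁰ (SkewLaurent D τ)))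

/-- The rank function `rk_{𝔪,k}`: the pull-back along `R → R/𝔪^k` of the normalized `D`-rank of
right multiplication on `R/𝔪^k`. -/
noncomputable def rankMax (𝔪 : MaxTwoSided (SkewLaurent D τ)) (k : ℕ+) :
    MatFun (SkewLaurent D τ) :=
  pullbackRank (Ideal.Quotient.mk (𝔪.1 ^ (k : ℕ)))
    (dimRank ((Ideal.Quotient.mk (𝔪.1 ^ (k : ℕ))).comp (C τ)))

/-- The family consisting of `rk₀` and all the `rk_{𝔪,k}`. -/
noncomputable def rankFamily : Option (MaxTwoSided (SkewLaurent D τ) × ℕ+) →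
    MatFun (SkewLaurent D τ)
  | none => rankZero τ
  | some (𝔪, k) => rankMax τ 𝔪 k

end SkewLaurent

/-! Write `R` for the skew Laurent ring and `Z` for its centre. The proof shows that a rank function
on `R` is determined by its values at powers of the irreducible elements of `Z`, and then that all
admissible systems of such values come from the listed functions.

Determination. `R` is Euclidean on both sides for the length of the support, so diagonal reduction
leaves only the values at single elements `e ≠ 0`. The left module `R / R e` has finite length. A
submodule on which all non-zero central elements act surjectively has only faithful composition
factors; every power of a faithful simple factor is cyclic, so `n` times its dimension is at most
`1` for all `n`, and the dimension is zero. What is left is killed by a central `c ≠ 0`, that is,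
`rk e` is the rank of the column `(c, e)` (`exists_elemRank_eq_stack`). Read as a function of `c`
and normalized, this is a rank function on the commutative ring `Z` (`isSylvesterRank_relRank`), and
additivity over coprime factors reduces to `c = p ^ N` with `p` irreducible. Read as a function of
`e`, it is a rank function on `R / R p ^ N`. There `p` is nilpotent and the quotient by `p` is a
matrix ring over a division ring, so `s` copies of any matrix become `diag(1, p B)`, and induction
along `rk ↦ rk(p ·) / rk p` finishes (`eq_of_elemRank_pow_eq`).

Existence and uniqueness of coefficients. For a rank function on `Z` and irreducible `p`, the defect
`f(i) = 1 - rk(p ^ i)` vanishes at `0`, is monotone, bounded and concave. It is therefore a unique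
non-negative combination of the functions `min(i, k) / k`, with coefficient `k` times the negative
second difference at `k - 1`. These functions are the defects of `rk_{𝔪,k}` at `p`, where `𝔪 = R p`;
at the other primes `rk_{𝔪,k}` has no defect, and `rk₀` has none anywhere. Coprime additivity bounds
the total mass over all `p` by `1`, and `rk₀` receives the rest. So every rank function on `Z` is
the restriction of a combination of the family, and with the first half this gives the bijection
with `ℙ(Z)` and the unique expansion.

The extreme points follow formally from unique expansions, and regularity by taking a product of
regular rings. Finite inner order is needed only to make maximal two-sided ideals non-zero, and
hence the quotients by their powers finite over `D`. -/

/-! ### Rank functions on matrices with arbitrary finite index types -/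

section genRank

open Matrix

variable {R : Type u}

/-- The extension of a function on matrices to arbitrary finite index types. -/
noncomputable def genRank (rk : MatFun R) {ι κ : Type} [Fintype ι] [Fintype κ]
    (M : Matrix ι κ R) : ℝ :=
  rk (Fintype.card ι) (Fintype.card κ)
    (M.submatrix (Fintype.equivFin ι).symm (Fintype.equivFin κ).symm)

/-- The value of a function on matrices at a single element. -/
def elemRank (rk : MatFun R) (a : R) : ℝ :=
  rk 1 1 (Matrix.of fun _ _ => a)

namespace IsSylvesterRank

variable [Ring R] {rk : MatFun R} (h : IsSylvesterRank rk)
  {ι κ μ ν ι' κ' : Type} [Fintype ι] [Fintype κ] [Fintype μ] [Fintype ν] [Fintype ι'] [Fintype κ']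

include h in
-- Selecting rows and columns, repetitions allowed, is multiplication on both sides by submatrices
-- of identity matrices.
theorem submatrix_fin_le {m n m' n' : ℕ} (M : Matrix (Fin m) (Fin n) R) (f : Fin m' → Fin m)
    (g : Fin n' → Fin n) : rk m' n' (M.submatrix f g) ≤ rk m n M := by
  have : M.submatrix f g = ((1 : Matrix (Fin m) (Fin m) R).submatrix f id * M) *
      (1 : Matrix (Fin n) (Fin n) R).submatrix id g := by
    ext i j
    simp [Matrix.mul_apply, Matrix.one_apply]
  rw [this]
  exact ((h.mul_le _ _ _ _ _).trans (min_le_left _ _)).trans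
    ((h.mul_le _ _ _ _ _).trans (min_le_right _ _))

include h in
-- The enumerations chosen in `genRank` are immaterial: matrices obtained from two enumerations are
-- submatrices of each other.
theorem gen_eq {m n : ℕ} (M : Matrix ι κ R) (e : Fin m ≃ ι) (e' : Fin n ≃ κ) :
    genRank rk M = rk m n (M.submatrix e e') := by
  obtain rfl : m = Fintype.card ι := by simpa using Fintype.card_congr e
  obtain rfl : n = Fintype.card κ := by simpa using Fintype.card_congr e'
  unfold genRank
  apply le_antisymm
  · refine le_of_eq_of_le (congrArg (rk _ _) (Matrix.ext fun i j => ?_))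
      (h.submatrix_fin_le (M.submatrix e e') ((Fintype.equivFin ι).symm.trans e.symm)
        ((Fintype.equivFin κ).symm.trans e'.symm))
    simp
  · refine le_of_eq_of_le (congrArg (rk _ _) (Matrix.ext fun i j => ?_))
      (h.submatrix_fin_le
        (M.submatrix (Fintype.equivFin ι).symm (Fintype.equivFin κ).symm)
        (e.trans (Fintype.equivFin ι)) (e'.trans (Fintype.equivFin κ)))
    simp

include h in
theorem gen_fin {m n : ℕ} (M : Matrix (Fin m) (Fin n) R) : genRank rk M = rk m n M := by
  simpa using h.gen_eq M (Equiv.refl _) (Equiv.refl _)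

include h in
theorem gen_submatrix (M : Matrix ι κ R) (e : ι' ≃ ι) (e' : κ' ≃ κ) :
    genRank rk (M.submatrix e e') = genRank rk M := by
  rw [h.gen_eq (M.submatrix e e') (Fintype.equivFin ι').symm (Fintype.equivFin κ').symm,
    h.gen_eq M ((Fintype.equivFin ι').symm.trans e) ((Fintype.equivFin κ').symm.trans e')]
  rfl

include h in
theorem gen_nonneg (M : Matrix ι κ R) : 0 ≤ genRank rk M := h.nonneg _ _ _

include h in
theorem gen_zero : genRank rk (0 : Matrix ι κ R) = 0 := by
  unfold genRank; rw [Matrix.submatrix_zero]; exact h.map_zero _ _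

include h in
theorem gen_mul_le_left (A : Matrix ι κ R) (B : Matrix κ μ R) :
    genRank rk (A * B) ≤ genRank rk A := by
  unfold genRank
  rw [← Matrix.submatrix_mul_equiv A B _ (Fintype.equivFin κ).symm]
  exact (h.mul_le _ _ _ _ _).trans (min_le_left _ _)

include h in
theorem gen_mul_le_right (A : Matrix ι κ R) (B : Matrix κ μ R) :
    genRank rk (A * B) ≤ genRank rk B := by
  unfold genRank
  rw [← Matrix.submatrix_mul_equiv A B _ (Fintype.equivFin κ).symm]
  exact (h.mul_le _ _ _ _ _).trans (min_le_right _ _)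

include h in
theorem gen_fromBlocks_diag (A : Matrix ι κ R) (B : Matrix μ ν R) :
    genRank rk (fromBlocks A 0 0 B) = genRank rk A + genRank rk B := by
  have := h.map_diag _ _ _ _ (A.submatrix (Fintype.equivFin ι).symm (Fintype.equivFin κ).symm)
    (B.submatrix (Fintype.equivFin μ).symm (Fintype.equivFin ν).symm)
  rw [genRank.eq_def rk A, genRank.eq_def rk B, ← this,
    h.gen_eq _ (finSumFinEquiv.symm.trans
      (Equiv.sumCongr (Fintype.equivFin ι).symm (Fintype.equivFin μ).symm))
      (finSumFinEquiv.symm.trans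
      (Equiv.sumCongr (Fintype.equivFin κ).symm (Fintype.equivFin ν).symm))]
  congr 1
  rw [blockUpper, Matrix.reindex_apply]
  ext i j
  simp only [Matrix.submatrix_apply, Equiv.trans_apply]
  rcases finSumFinEquiv.symm i with i | i <;> rcases finSumFinEquiv.symm j with j | j <;> simp

include h in
theorem le_gen_fromBlocks (A : Matrix ι κ R) (C : Matrix ι ν R) (B : Matrix μ ν R) :
    genRank rk A + genRank rk B ≤ genRank rk (fromBlocks A C 0 B) := by
  have := h.le_map_upper _ _ _ _
    (A.submatrix (Fintype.equivFin ι).symm (Fintype.equivFin κ).symm)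
    (C.submatrix (Fintype.equivFin ι).symm (Fintype.equivFin ν).symm)
    (B.submatrix (Fintype.equivFin μ).symm (Fintype.equivFin ν).symm)
  rw [genRank.eq_def rk A, genRank.eq_def rk B]
  refine this.trans_eq ?_
  rw [h.gen_eq (fromBlocks A C 0 B) (finSumFinEquiv.symm.trans
      (Equiv.sumCongr (Fintype.equivFin ι).symm (Fintype.equivFin μ).symm))
      (finSumFinEquiv.symm.trans
      (Equiv.sumCongr (Fintype.equivFin κ).symm (Fintype.equivFin ν).symm))]
  congr 1
  rw [blockUpper, Matrix.reindex_apply]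
  ext i j
  simp only [Matrix.submatrix_apply, Equiv.trans_apply]
  rcases finSumFinEquiv.symm i with i | i <;> rcases finSumFinEquiv.symm j with j | j <;> simp

include h in
theorem gen_isUnit_mul [DecidableEq ι] {U : Matrix ι ι R} (hU : IsUnit U) (M : Matrix ι κ R) :
    genRank rk (U * M) = genRank rk M := by
  obtain ⟨U, rfl⟩ := hU
  refine le_antisymm (h.gen_mul_le_right _ _) ?_
  conv_lhs => rw [← Matrix.one_mul M, ← U.inv_mul, Matrix.mul_assoc]
  exact h.gen_mul_le_right _ _

include h in
theorem gen_mul_isUnit [DecidableEq κ] {V : Matrix κ κ R} (hV : IsUnit V) (M : Matrix ι κ R) :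
    genRank rk (M * V) = genRank rk M := by
  obtain ⟨V, rfl⟩ := hV
  refine le_antisymm (h.gen_mul_le_left _ _) ?_
  conv_lhs => rw [← Matrix.mul_one M, ← V.mul_inv, ← Matrix.mul_assoc]
  exact h.gen_mul_le_left _ _

include h in
theorem gen_unique {α β : Type} [Unique α] [Fintype α] [Unique β] [Fintype β] (M : Matrix α β R) :
    genRank rk M = elemRank rk (M default default) := by
  rw [h.gen_eq M (Equiv.ofUnique (Fin 1) α) (Equiv.ofUnique (Fin 1) β)]
  congr 1

include h in
theorem map_one_fin (n : ℕ) : rk n n 1 = n := by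
  induction n with
  | zero => rw [show (1 : Matrix (Fin 0) (Fin 0) R) = 0 from Subsingleton.elim _ _]
            simpa using h.map_zero 0 0
  | succ n ih =>
    have := h.map_diag _ _ _ _ (1 : Matrix (Fin n) (Fin n) R) (1 : Matrix (Fin 1) (Fin 1) R)
    rw [ih, h.map_one, blockUpper, Matrix.fromBlocks_one, Matrix.reindex_apply,
      Matrix.submatrix_one_equiv] at this
    rw [this]; push_cast; rfl

include h in
theorem gen_one [DecidableEq ι] : genRank rk (1 : Matrix ι ι R) = Fintype.card ι := by
  unfold genRank
  rw [Matrix.submatrix_one_equiv]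
  exact h.map_one_fin _

include h in
theorem gen_le_card_left (M : Matrix ι κ R) : genRank rk M ≤ Fintype.card ι := by
  classical
  rw [← h.gen_one (ι := ι)]
  conv_lhs => rw [← Matrix.one_mul M]
  exact h.gen_mul_le_left _ _

include h in
theorem gen_le_card_right (M : Matrix ι κ R) : genRank rk M ≤ Fintype.card κ := by
  classical
  rw [← h.gen_one (ι := κ)]
  conv_lhs => rw [← Matrix.mul_one M]
  exact h.gen_mul_le_right _ _

include h in
theorem elem_one : elemRank rk 1 = 1 := by
  have := h.map_one
  rwa [show (1 : Matrix (Fin 1) (Fin 1) R) = Matrix.of fun _ _ => 1 by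
    ext i j; simp [Matrix.one_apply, Subsingleton.elim i j]] at this

include h in
theorem elem_nonneg (a : R) : 0 ≤ elemRank rk a := h.nonneg _ _ _

include h in
theorem elem_eq_gen (a : R) : elemRank rk a = genRank rk (Matrix.of fun _ _ : Unit => a) :=
  (h.gen_unique (Matrix.of fun _ _ : Unit => a)).symm

theorem of_mul_of (a b : R) : (Matrix.of fun _ _ : Unit => a * b) =
    (Matrix.of fun _ _ : Unit => a) * (Matrix.of fun _ _ : Unit => b) := by
  ext i j; simp [Matrix.mul_apply]

include h in
theorem elem_mul_le_left (a b : R) : elemRank rk (a * b) ≤ elemRank rk a := by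
  rw [h.elem_eq_gen, h.elem_eq_gen, of_mul_of]; exact h.gen_mul_le_left _ _

include h in
theorem elem_mul_le_right (a b : R) : elemRank rk (a * b) ≤ elemRank rk b := by
  rw [h.elem_eq_gen, h.elem_eq_gen, of_mul_of]; exact h.gen_mul_le_right _ _

include h in
theorem elem_le_one (a : R) : elemRank rk a ≤ 1 := by
  rw [h.elem_eq_gen]; simpa using h.gen_le_card_left (Matrix.of fun _ _ : Unit => a)

include h in
theorem elem_zero : elemRank rk 0 = 0 := h.map_zero 1 1

include h in
theorem elem_isUnit {a : R} (ha : IsUnit a) : elemRank rk a = 1 := by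
  obtain ⟨a, rfl⟩ := ha
  refine le_antisymm (h.elem_le_one _) ?_
  rw [← h.elem_one, ← a.mul_inv]
  exact h.elem_mul_le_left _ _

include h in
theorem gen_fromRows_le (A : Matrix ι κ R) (B : Matrix μ κ R) :
    genRank rk (fromRows A B) ≤ genRank rk A + genRank rk B := by
  classical
  rw [← h.gen_fromBlocks_diag]
  have : fromRows A B =
      (fromBlocks A 0 0 B : Matrix (ι ⊕ μ) (κ ⊕ κ) R) *
        (fromRows 1 1 : Matrix (κ ⊕ κ) κ R) := by
    rw [Matrix.fromBlocks_mul_fromRows]; simp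
  rw [this]; exact h.gen_mul_le_left _ _

include h in
theorem le_gen_fromRows_left (A : Matrix ι κ R) (B : Matrix μ κ R) :
    genRank rk A ≤ genRank rk (fromRows A B) := by
  classical
  have : A = fromCols (1 : Matrix ι ι R) (0 : Matrix ι μ R) * fromRows A B := by
    rw [Matrix.fromCols_mul_fromRows]; simp
  conv_lhs => rw [this]
  exact h.gen_mul_le_right _ _

include h in
theorem le_gen_fromRows_right (A : Matrix ι κ R) (B : Matrix μ κ R) :
    genRank rk B ≤ genRank rk (fromRows A B) := by
  classical
  have : B = fromCols (0 : Matrix μ ι R) (1 : Matrix μ μ R) * fromRows A B := by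
    rw [Matrix.fromCols_mul_fromRows]; simp
  conv_lhs => rw [this]
  exact h.gen_mul_le_right _ _

include h in
theorem gen_add_le (A B : Matrix ι κ R) :
    genRank rk (A + B) ≤ genRank rk A + genRank rk B := by
  classical
  have : A + B = fromCols (1 : Matrix ι ι R) (1 : Matrix ι ι R) * fromRows A B := by
    rw [Matrix.fromCols_mul_fromRows]; simp
  rw [this]
  exact (h.gen_mul_le_right _ _).trans (h.gen_fromRows_le _ _)

include h in
/-- Sylvester's inequality. -/
theorem gen_add_le_mul (A : Matrix ι κ R) (B : Matrix κ μ R) :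
    genRank rk A + genRank rk B ≤ genRank rk (A * B) + Fintype.card κ := by
  classical
  rw [← h.gen_one (ι := κ), ← h.gen_fromBlocks_diag (A * B), add_comm (genRank rk A)]
  refine (h.le_gen_fromBlocks B (1 : Matrix κ κ R) A).trans ?_
  -- The identity corner is a pivot. Clearing the other blocks with it leaves `diag(A B, 1)` up to
  -- row and column operations.
  have : (fromBlocks B (1 : Matrix κ κ R) 0 A : Matrix (κ ⊕ ι) (μ ⊕ κ) R) =
      (fromBlocks 0 1 (-1) A : Matrix (κ ⊕ ι) (ι ⊕ κ) R) *
        (fromBlocks (A * B) 0 0 1 : Matrix (ι ⊕ κ) (μ ⊕ κ) R) *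
        (fromBlocks 1 0 B 1 : Matrix (μ ⊕ κ) (μ ⊕ κ) R) := by
    rw [Matrix.fromBlocks_multiply, Matrix.fromBlocks_multiply]
    simp
  rw [this]
  exact (h.gen_mul_le_left _ _).trans (h.gen_mul_le_right _ _)

include h in
theorem elem_add_le_mul (a b : R) : elemRank rk a + elemRank rk b ≤ elemRank rk (a * b) + 1 := by
  simpa [h.elem_eq_gen, of_mul_of] using
    h.gen_add_le_mul (Matrix.of fun _ _ : Unit => a) (Matrix.of fun _ _ : Unit => b)

include h in
theorem gen_blockDiagonal_const (M : Matrix ι κ R) (s : ℕ) :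
    genRank rk (blockDiagonal fun _ : Fin s => M) = s * genRank rk M := by
  induction s with
  | zero => simpa using h.gen_zero (ι := ι × Fin 0) (κ := κ × Fin 0) ▸
      congrArg (genRank rk) (Subsingleton.elim _ _)
  | succ s ih =>
    let e (α : Type) : (α × Fin s) ⊕ α ≃ α × Fin (s + 1) :=
      (Equiv.sumCongr (Equiv.refl _) (Equiv.prodUnique α (Fin 1)).symm).trans
        ((Equiv.prodSumDistrib α (Fin s) (Fin 1)).symm.trans
          (Equiv.prodCongr (Equiv.refl _) finSumFinEquiv))
    rw [← h.gen_submatrix _ (e ι) (e κ)]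
    have : (blockDiagonal fun _ : Fin (s + 1) => M).submatrix (e ι) (e κ) =
        fromBlocks (blockDiagonal fun _ : Fin s => M) 0 0 M := by
      ext (⟨i, a⟩ | i) (⟨j, b⟩ | j)
      · simp [e, Matrix.blockDiagonal_apply]
      · simp [e, Matrix.blockDiagonal_apply, Fin.ext_iff, a.2.ne]
      · simp [e, Matrix.blockDiagonal_apply, Fin.ext_iff, b.2.ne']
      · simp [e, Matrix.blockDiagonal_apply]
    rw [this, h.gen_fromBlocks_diag, ih]
    push_cast; ring

include h in
theorem gen_smul_one [DecidableEq ι] (c : R) :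
    genRank rk (Matrix.diagonal fun _ : ι => c) = Fintype.card ι * elemRank rk c := by
  have := h.gen_blockDiagonal_const (Matrix.of fun _ _ : Unit => c) (Fintype.card ι)
  rw [← h.elem_eq_gen] at this
  rw [← this, ← h.gen_submatrix (Matrix.diagonal fun _ : ι => c)
    ((Equiv.uniqueProd (Fin (Fintype.card ι)) Unit).trans (Fintype.equivFin ι).symm)
    ((Equiv.uniqueProd (Fin (Fintype.card ι)) Unit).trans (Fintype.equivFin ι).symm)]
  congr 1
  ext ⟨_, i⟩ ⟨_, j⟩
  simp [Matrix.blockDiagonal_apply, Matrix.diagonal_apply]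

end IsSylvesterRank

end genRank

/-! ### Constructions of rank functions -/

section constructions

open Matrix

variable {R S : Type u} [Ring R] [Ring S]

theorem blockUpper_map {m n p q : ℕ} (φ : R →+* S) (A : Matrix (Fin m) (Fin n) R)
    (C : Matrix (Fin m) (Fin q) R) (B : Matrix (Fin p) (Fin q) R) :
    (blockUpper A C B).map φ = blockUpper (A.map φ) (C.map φ) (B.map φ) := by
  unfold blockUpper
  rw [Matrix.reindex_apply, Matrix.reindex_apply, ← Matrix.submatrix_map, Matrix.fromBlocks_map]
  simp

namespace IsSylvesterRank

theorem pullback (φ : R →+* S) {rk : MatFun S} (h : IsSylvesterRank rk) :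
    IsSylvesterRank (pullbackRank φ rk) where
  nonneg _ _ _ := h.nonneg _ _ _
  map_zero m n := by simpa [pullbackRank] using h.map_zero m n
  map_one := by simpa [pullbackRank] using h.map_one
  mul_le _ _ _ A B := by
    simpa only [pullbackRank, Matrix.map_mul] using h.mul_le _ _ _ (A.map φ) (B.map φ)
  map_diag _ _ _ _ A B := by
    simpa [pullbackRank, blockUpper_map] using h.map_diag _ _ _ _ (A.map φ) (B.map φ)
  le_map_upper _ _ _ _ A C B := by
    simpa [pullbackRank, blockUpper_map] using
      h.le_map_upper _ _ _ _ (A.map φ) (C.map φ) (B.map φ)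

theorem le_nat {rk : MatFun R} (h : IsSylvesterRank rk) {m n : ℕ}
    (A : Matrix (Fin m) (Fin n) R) : rk m n A ≤ m := by
  simpa [h.gen_fin] using h.gen_le_card_left A

theorem summable_mul {J : Type*} {rk : J → MatFun R} (h : ∀ j, IsSylvesterRank (rk j))
    {c : J → ℝ} (hc : ∀ j, 0 ≤ c j) (hs : Summable c) {m n : ℕ} (A : Matrix (Fin m) (Fin n) R) :
    Summable fun j => c j * rk j m n A :=
  Summable.of_nonneg_of_le (fun j => mul_nonneg (hc j) ((h j).nonneg _ _ _))
    (fun j => mul_le_mul_of_nonneg_left ((h j).le_nat A) (hc j)) (hs.mul_right (m : ℝ))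

/-- A possibly infinite convex combination of rank functions is a rank function. -/
theorem tsum {J : Type*} {rk : J → MatFun R} (h : ∀ j, IsSylvesterRank (rk j))
    {c : J → ℝ} (hc : ∀ j, 0 ≤ c j) (hs : HasSum c 1) :
    IsSylvesterRank fun m n A => ∑' j, c j * rk j m n A where
  nonneg _ _ _ := tsum_nonneg fun j => mul_nonneg (hc j) ((h j).nonneg _ _ _)
  map_zero m n := by simp [(h _).map_zero]
  map_one := by simpa [(h _).map_one] using hs.tsum_eq
  mul_le _ _ _ A B := le_min
    (Summable.tsum_le_tsum (fun j => mul_le_mul_of_nonneg_left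
      (((h j).mul_le _ _ _ A B).trans (min_le_left _ _)) (hc j))
      (summable_mul h hc hs.summable _) (summable_mul h hc hs.summable _))
    (Summable.tsum_le_tsum (fun j => mul_le_mul_of_nonneg_left
      (((h j).mul_le _ _ _ A B).trans (min_le_right _ _)) (hc j))
      (summable_mul h hc hs.summable _) (summable_mul h hc hs.summable _))
  map_diag _ _ _ _ A B := by
    rw [← Summable.tsum_add (summable_mul h hc hs.summable _) (summable_mul h hc hs.summable _)]
    simp [(h _).map_diag, mul_add]
  le_map_upper _ _ _ _ A C B := by
    rw [← Summable.tsum_add (summable_mul h hc hs.summable _) (summable_mul h hc hs.summable _)]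
    refine Summable.tsum_le_tsum (fun j => ?_) ((summable_mul h hc hs.summable _).add
      (summable_mul h hc hs.summable _)) (summable_mul h hc hs.summable _)
    rw [← mul_add]
    exact mul_le_mul_of_nonneg_left ((h j).le_map_upper _ _ _ _ A C B) (hc j)

/-- By subadditivity, adding a matrix of rank zero does not change the rank. -/
theorem eq_of_map_eq {rk : MatFun R} (h : IsSylvesterRank rk) {φ : R →+* S}
    (h0 : ∀ (m n : ℕ) (M : Matrix (Fin m) (Fin n) R), M.map φ = 0 → rk m n M = 0) {m n : ℕ}
    {M N : Matrix (Fin m) (Fin n) R} (hMN : M.map φ = N.map φ) : rk m n M = rk m n N := by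
  have key : ∀ M N : Matrix (Fin m) (Fin n) R, M.map φ = N.map φ → rk m n M ≤ rk m n N := by
    intro M N hMN
    have h1 := h.gen_add_le (M - N) N
    rw [sub_add_cancel, h.gen_fin, h.gen_fin, h.gen_fin, h0 m n (M - N), zero_add] at h1
    · exact h1
    · rw [Matrix.map_sub _ (map_sub φ), hMN, sub_self]
  exact le_antisymm (key _ _ hMN) (key _ _ hMN.symm)

/-- A rank function vanishing on the kernel of a surjective homomorphism is a pull-back. -/
theorem exists_eq_pullback {rk : MatFun R} (h : IsSylvesterRank rk) {φ : R →+* S}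
    (hφ : Function.Surjective φ)
    (h0 : ∀ (m n : ℕ) (M : Matrix (Fin m) (Fin n) R), M.map φ = 0 → rk m n M = 0) :
    ∃ rk' : MatFun S, IsSylvesterRank rk' ∧ rk = pullbackRank φ rk' := by
  have hl : ∀ {m n : ℕ} (M : Matrix (Fin m) (Fin n) S),
      (M.map (Function.surjInv hφ)).map φ = M := fun M => by
    ext i j; exact Function.surjInv_eq hφ _
  -- The rank is read off a set-theoretic lift. The lift respects neither sums nor products, but the
  -- errors vanish under `φ` and so do not affect the rank.
  refine ⟨fun m n M => rk m n (M.map (Function.surjInv hφ)), ⟨fun _ _ _ => h.nonneg _ _ _,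
    fun m n => ?_, ?_, fun m n p A B => ?_, fun m n p q A B => ?_, fun m n p q A C B => ?_⟩, ?_⟩
  · exact h0 _ _ _ (hl _)
  · rw [← h.map_one]
    exact h.eq_of_map_eq h0 (by rw [hl]; simp)
  · refine le_of_eq_of_le ?_ (h.mul_le _ _ _ _ _)
    exact h.eq_of_map_eq h0 (by rw [Matrix.map_mul, hl, hl, hl])
  · rw [← h.map_diag]
    exact h.eq_of_map_eq h0 (by rw [blockUpper_map, hl, hl, hl]; simp)
  · refine (h.le_map_upper _ _ _ _ _ (C.map (Function.surjInv hφ)) _).trans_eq ?_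
    exact h.eq_of_map_eq h0 (by rw [blockUpper_map, hl, hl, hl, hl])
  · funext m n M
    exact h.eq_of_map_eq h0 (hl _).symm

theorem smul_mul_eq_mul_smul {p : R} (hp : p ∈ Subring.center R) {ι κ μ : Type} [Fintype κ]
    (A : Matrix ι κ R) (B : Matrix κ μ R) : p • (A * B) = A * p • B := by
  ext i j
  simp only [Matrix.smul_apply, Matrix.mul_apply, smul_eq_mul, Finset.mul_sum]
  refine Finset.sum_congr rfl fun k _ => ?_
  rw [← mul_assoc, ← mul_assoc, Subring.mem_center_iff.1 hp]

theorem smul_blockUpper {m n k q : ℕ} (p : R) (A : Matrix (Fin m) (Fin n) R)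
    (C : Matrix (Fin m) (Fin q) R) (B : Matrix (Fin k) (Fin q) R) :
    p • blockUpper A C B = blockUpper (p • A) (p • C) (p • B) := by
  unfold blockUpper
  have := Matrix.fromBlocks_smul p A C 0 B
  rw [smul_zero] at this
  rw [Matrix.reindex_apply, Matrix.reindex_apply, ← this]
  rfl

/-- The rank function `B ↦ rk (p B) / rk p` for a central element `p`. -/
theorem shift {rk : MatFun R} (h : IsSylvesterRank rk) {p : R} (hp : p ∈ Subring.center R)
    (h0 : 0 < elemRank rk p) :
    IsSylvesterRank fun m n (B : Matrix (Fin m) (Fin n) R) => rk m n (p • B) / elemRank rk p where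
  nonneg _ _ _ := div_nonneg (h.nonneg _ _ _) h0.le
  map_zero m n := by simp [h.map_zero]
  map_one := by
    rw [div_eq_one_iff_eq h0.ne']
    unfold elemRank
    congr 1
    ext i j; simp [Subsingleton.elim i j]
  mul_le _ _ _ A B := by
    refine le_min ?_ ?_ <;> gcongr
    · rw [← Matrix.smul_mul]; exact (h.mul_le _ _ _ _ _).trans (min_le_left _ _)
    · rw [smul_mul_eq_mul_smul hp]; exact (h.mul_le _ _ _ _ _).trans (min_le_right _ _)
  map_diag _ _ _ _ A B := by
    rw [smul_blockUpper, smul_zero, h.map_diag, add_div]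
  le_map_upper _ _ _ _ A C B := by
    rw [smul_blockUpper, ← add_div]
    gcongr
    exact h.le_map_upper _ _ _ _ _ _ _

theorem gen_smul_le {rk : MatFun R} (h : IsSylvesterRank rk) {ι κ : Type} [Fintype ι] [Fintype κ]
    (p : R) (B : Matrix ι κ R) : genRank rk (p • B) ≤ Fintype.card ι * elemRank rk p := by
  classical
  rw [← h.gen_smul_one]
  have : p • B = Matrix.diagonal (fun _ : ι => p) * B := by
    ext i j; simp
  rw [this]
  exact h.gen_mul_le_left _ _

end IsSylvesterRank

/-! ### Ranks relative to a commuting element -/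

/-- Stacking the matrix `B` on top of the scalar matrix `c`. -/
def stackScalar (φ : S →+* R) (c : R) {ι κ : Type} [DecidableEq κ] (B : Matrix ι κ S) :
    Matrix (ι ⊕ κ) κ R :=
  fromRows (B.map φ) (Matrix.diagonal fun _ => c)

/-- The rank function on `S` attached to the `R`-`S`-bimodule `R / R c`, where `c` commutes with the
image of `S` in `R`. -/
noncomputable def relRank (rk : MatFun R) (φ : S →+* R) (c : R) : MatFun S := fun _ n B =>
  (genRank rk (stackScalar φ c B) - n * elemRank rk c) / (1 - elemRank rk c)

namespace IsSylvesterRank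

variable {rk : MatFun R} (h : IsSylvesterRank rk) (φ : S →+* R) {c : R}

include h in
theorem stackScalar_mul_le_right {ι κ μ : Type} [Fintype ι] [Fintype κ] [Fintype μ]
    [DecidableEq μ] (A : Matrix ι κ S) (B : Matrix κ μ S) :
    genRank rk (stackScalar φ c (A * B)) ≤ genRank rk (stackScalar φ c B) := by
  have : stackScalar φ c (A * B) =
      (fromBlocks (A.map φ) 0 0 1 : Matrix (ι ⊕ μ) (κ ⊕ μ) R) * stackScalar φ c B := by
    unfold stackScalar
    rw [Matrix.fromBlocks_mul_fromRows, Matrix.map_mul]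
    simp
  rw [this]
  exact h.gen_mul_le_right _ _

include h in
-- This is what makes `relRank` decrease under right multiplication; the two scalar terms account
-- for the different numbers of columns. The triangular matrix with diagonal blocks `stackScalar (A
-- * B)` and `c`, and corner `A`, has `diag(c, stackScalar A)` as a factor, because `c` commutes
-- with the entries of `B`.
theorem stackScalar_mul_le_left {ι κ μ : Type} [Fintype ι] [Fintype κ] [Fintype μ]
    [DecidableEq ι] [DecidableEq κ] [DecidableEq μ] (hc : ∀ s, c * φ s = φ s * c) (A : Matrix ι κ S)
    (B : Matrix κ μ S) :
    genRank rk (stackScalar φ c (A * B)) + Fintype.card κ * elemRank rk c ≤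
      genRank rk (stackScalar φ c A) + Fintype.card μ * elemRank rk c := by
  rw [← h.gen_smul_one (ι := κ), ← h.gen_smul_one (ι := μ), add_comm (genRank rk (stackScalar φ c A)),
    ← h.gen_fromBlocks_diag (Matrix.diagonal fun _ : μ => c)]
  refine (h.le_gen_fromBlocks (stackScalar φ c (A * B)) (fromRows (A.map φ) (0 : Matrix μ κ R))
    (Matrix.diagonal fun _ : κ => c)).trans ?_
  let L : Matrix ((ι ⊕ μ) ⊕ κ) (μ ⊕ (ι ⊕ κ)) R :=
    fromBlocks (fromRows 0 1) (fromRows (fromCols 1 0) 0) (-B.map φ) (fromCols 0 1)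
  let V : Matrix (μ ⊕ κ) (μ ⊕ κ) R := fromBlocks 1 0 (B.map φ) 1
  have hcB : (B.map φ) * Matrix.diagonal (fun _ : μ => c) =
      Matrix.diagonal (fun _ : κ => c) * B.map φ := by
    ext i j; simp [hc]
  have : fromBlocks (stackScalar φ c (A * B)) (fromRows (A.map φ) (0 : Matrix μ κ R)) 0
      (Matrix.diagonal fun _ : κ => c) =
      L * (fromBlocks (Matrix.diagonal fun _ : μ => c) 0 0 (stackScalar φ c A) * V) := by
    simp only [L, V, stackScalar]
    rw [Matrix.fromBlocks_multiply, Matrix.fromBlocks_multiply, Matrix.map_mul]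
    simp only [Matrix.mul_one, Matrix.mul_zero, Matrix.zero_mul, add_zero, zero_add,
      Matrix.fromRows_mul, Matrix.fromCols_mul_fromRows, Matrix.one_mul, Matrix.neg_mul, hcB,
      neg_add_cancel]
    congr 1; ext (i | i) j <;> simp
  rw [this]
  exact (h.gen_mul_le_right L _).trans (h.gen_mul_le_left _ V)

include h in
theorem stackScalar_reindex {ι κ ι' κ' : Type} [Fintype ι] [Fintype κ] [Fintype ι'] [Fintype κ']
    [DecidableEq κ] [DecidableEq κ']
    (e : ι' ≃ ι) (e' : κ' ≃ κ) (A : Matrix ι κ S) :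
    genRank rk (stackScalar φ c (A.submatrix e e')) = genRank rk (stackScalar φ c A) := by
  rw [← h.gen_submatrix (stackScalar φ c A) (Equiv.sumCongr e e') e']
  congr 1
  ext (i | i) j <;> simp [stackScalar, Matrix.diagonal_apply]

theorem stackScalar_fromBlocks {ι κ μ ν : Type} [DecidableEq κ] [DecidableEq ν]
    (A : Matrix ι κ S) (C : Matrix ι ν S) (B : Matrix μ ν S) :
    (stackScalar φ c (fromBlocks A C 0 B)).submatrix (Equiv.sumSumSumComm ι κ μ ν)
      (Equiv.refl _) = fromBlocks (stackScalar φ c A) (fromRows (C.map φ) 0) 0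
        (stackScalar φ c B) := by
  ext ((i | i) | (i | i)) (j | j) <;> simp [stackScalar, Matrix.diagonal_apply]

include h in
-- In terms of module ranks, the cokernel of `B` is tensored with the bimodule `R / R c` and its
-- dimension is divided by that of `R / R c`, which is `1 - rk c`; hence the condition `hc1`.
-- Commutation of `c` with the image of `φ` enters only in `mul_le`.
theorem isSylvesterRank_relRank (hc : ∀ s, c * φ s = φ s * c) (hc1 : elemRank rk c < 1) :
    IsSylvesterRank (relRank rk φ c) where
  nonneg m n B := by
    refine div_nonneg (sub_nonneg.2 ?_) (sub_nonneg.2 hc1.le)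
    have := h.le_gen_fromRows_right (B.map φ) (Matrix.diagonal fun _ : Fin n => c)
    rwa [h.gen_smul_one, Fintype.card_fin] at this
  map_zero m n := by
    have h1 : genRank rk (stackScalar φ c (0 : Matrix (Fin m) (Fin n) S)) ≤ _ :=
      h.gen_fromRows_le _ _
    have h2 := h.le_gen_fromRows_right ((0 : Matrix (Fin m) (Fin n) S).map φ)
      (Matrix.diagonal fun _ : Fin n => c)
    rw [h.gen_smul_one, Matrix.map_zero _ (_root_.map_zero φ), h.gen_zero, Fintype.card_fin] at h1
    rw [h.gen_smul_one, Fintype.card_fin] at h2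
    have : genRank rk (stackScalar φ c (0 : Matrix (Fin m) (Fin n) S)) = n * elemRank rk c :=
      le_antisymm (by linarith) h2
    simp [relRank, this]
  map_one := by
    have h1 := h.gen_le_card_right (stackScalar φ c (1 : Matrix (Fin 1) (Fin 1) S))
    have h2 := h.le_gen_fromRows_left ((1 : Matrix (Fin 1) (Fin 1) S).map φ)
      (Matrix.diagonal fun _ : Fin 1 => c)
    rw [Matrix.map_one _ (_root_.map_zero φ) (_root_.map_one φ), h.gen_one] at h2
    have : genRank rk (stackScalar φ c (1 : Matrix (Fin 1) (Fin 1) S)) = 1 := by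
      refine le_antisymm (by simpa using h1) ?_
      rw [stackScalar, Matrix.map_one _ (_root_.map_zero φ) (_root_.map_one φ)]
      simpa using h2
    rw [relRank, this]
    simpa using div_self (sub_pos.2 hc1).ne'
  mul_le m n p A B := by
    have h1 := h.stackScalar_mul_le_left φ hc A B
    have h2 := h.stackScalar_mul_le_right φ (c := c) A B
    simp only [Fintype.card_fin] at h1
    refine le_min ?_ ?_ <;> unfold relRank <;>
      refine div_le_div_of_nonneg_right ?_ (sub_nonneg.2 hc1.le) <;> linarith
  map_diag m n p q A B := by
    unfold relRank
    rw [blockUpper, Matrix.reindex_apply, h.stackScalar_reindex,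
      ← h.gen_submatrix _ (Equiv.sumSumSumComm _ _ _ _) (Equiv.refl _), stackScalar_fromBlocks,
      Matrix.map_zero _ (_root_.map_zero φ), Matrix.fromRows_zero, h.gen_fromBlocks_diag, ← add_div]
    push_cast
    ring
  le_map_upper m n p q A C B := by
    unfold relRank
    rw [blockUpper, Matrix.reindex_apply, h.stackScalar_reindex,
      ← h.gen_submatrix _ (Equiv.sumSumSumComm _ _ _ _) (Equiv.refl _), stackScalar_fromBlocks,
      ← add_div]
    refine div_le_div_of_nonneg_right ?_ (sub_nonneg.2 hc1.le)
    have := h.le_gen_fromBlocks (stackScalar φ c A) (fromRows (C.map φ) 0) (stackScalar φ c B)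
    push_cast
    linarith

end IsSylvesterRank

/-! ### Rank functions on commutative rings -/

namespace IsSylvesterRank

variable {A : Type u} [CommRing A] {rk : MatFun A} (h : IsSylvesterRank rk)

include h in
-- Frobenius's refinement of Sylvester's inequality. For `a = b = p` and `c = p ^ n` it says that
-- the defects `1 - rk(p ^ n)` form a concave sequence.
theorem elem_mul_add_le (a b c : A) : elemRank rk (a * c) + elemRank rk (b * c) ≤
    elemRank rk (a * b * c) + elemRank rk c := by
  let o : A → Matrix Unit Unit A := fun a => Matrix.of fun _ _ => a
  have : fromBlocks (o (b * c)) (o c) 0 (o (a * c)) =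
      fromBlocks 0 1 (-1) (o a) * fromBlocks (o (a * b * c)) 0 0 (o c) *
        fromBlocks 1 0 (o b) (1 : Matrix Unit Unit A) := by
    rw [Matrix.fromBlocks_multiply, Matrix.fromBlocks_multiply]
    congr 1 <;> ext i j <;> simp [o, Matrix.mul_apply] <;> ring
  simp only [h.elem_eq_gen]
  rw [← h.gen_fromBlocks_diag (Matrix.of fun _ _ => a * b * c), add_comm]
  refine (h.le_gen_fromBlocks (o (b * c)) (o c) (o (a * c))).trans ?_
  rw [this]
  exact (h.gen_mul_le_left _ (fromBlocks 1 0 (o b) (1 : Matrix Unit Unit A))).trans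
    (h.gen_mul_le_right (fromBlocks 0 (1 : Matrix Unit Unit A) (-1) (o a)) _)

include h in
-- A Bézout relation exhibits `diag(a b, 1)` as a product with `diag(a, b)` as a factor, which
-- reverses Sylvester's inequality. Equivalently, the defect `1 - rk` is additive on coprime
-- products, as the Chinese remainder theorem suggests.
theorem elem_add_of_isCoprime {a b : A} (hab : IsCoprime a b) :
    elemRank rk a + elemRank rk b = elemRank rk (a * b) + 1 := by
  refine le_antisymm (h.elem_add_le_mul a b) ?_
  obtain ⟨x, y, hxy⟩ := hab
  let o : A → Matrix Unit Unit A := fun a => Matrix.of fun _ _ => a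
  have : fromBlocks (o (a * b)) 0 0 (o 1) =
      fromBlocks (o (-b)) (o a) (o x) (o y) * fromBlocks (o a) 0 0 (o b) *
        fromBlocks (o (-(b * y))) (o 1) (o (a * x)) (o 1) := by
    rw [Matrix.fromBlocks_multiply, Matrix.fromBlocks_multiply]
    congr 1 <;> ext i j <;> simp [o, Matrix.mul_apply] <;>
      first | ring1 | linear_combination (-a * b) * hxy | linear_combination (-1 : A) * hxy
  rw [← h.elem_one]
  simp only [h.elem_eq_gen]
  rw [← h.gen_fromBlocks_diag, ← h.gen_fromBlocks_diag]
  change genRank rk (fromBlocks (o (a * b)) 0 0 (o 1)) ≤ _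
  rw [this]
  exact (h.gen_mul_le_left _ _).trans (h.gen_mul_le_right _ _)

end IsSylvesterRank

end constructions

/-! ### Matrices over two-sided Euclidean rings -/

section euclid

open Matrix

variable {R : Type u} [Ring R]

theorem isUnit_of_mul_eq_one_both {A : Type*} [Monoid A] {a b : A} (h : a * b = 1)
    (h' : b * a = 1) : IsUnit a :=
  ⟨⟨a, b, h, h'⟩, rfl⟩

theorem isUnit_submatrix_equiv' {ι κ : Type} [Fintype ι] [Fintype κ] [DecidableEq ι]
    [DecidableEq κ] (e : ι ≃ κ) {A : Matrix κ κ R} (hA : IsUnit A) : IsUnit (A.submatrix e e) := by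
  obtain ⟨A, rfl⟩ := hA
  refine isUnit_of_mul_eq_one_both (b := (A⁻¹).1.submatrix e e) ?_ ?_
  · rw [Matrix.submatrix_mul_equiv, A.mul_inv, Matrix.submatrix_one_equiv]
  · rw [Matrix.submatrix_mul_equiv, A.inv_mul, Matrix.submatrix_one_equiv]

theorem isUnit_one_submatrix {ι : Type} [Fintype ι] [DecidableEq ι] (e e' : ι ≃ ι) :
    IsUnit ((1 : Matrix ι ι R).submatrix e e') := by
  refine isUnit_of_mul_eq_one_both (b := (1 : Matrix ι ι R).submatrix e' e) ?_ ?_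
  · rw [Matrix.submatrix_mul_equiv, Matrix.one_mul, Matrix.submatrix_one_equiv]
  · rw [Matrix.submatrix_mul_equiv, Matrix.one_mul, Matrix.submatrix_one_equiv]

theorem isUnit_fromBlocks_upper {ι κ : Type} [Fintype ι] [Fintype κ] [DecidableEq ι]
    [DecidableEq κ] (Q : Matrix ι κ R) :
    IsUnit (fromBlocks 1 Q 0 1 : Matrix (ι ⊕ κ) (ι ⊕ κ) R) := by
  refine isUnit_of_mul_eq_one_both (b := fromBlocks 1 (-Q) 0 1) ?_ ?_ <;>
    simp [Matrix.fromBlocks_multiply]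

theorem isUnit_fromBlocks_lower {ι κ : Type} [Fintype ι] [Fintype κ] [DecidableEq ι]
    [DecidableEq κ] (Q : Matrix κ ι R) :
    IsUnit (fromBlocks 1 0 Q 1 : Matrix (ι ⊕ κ) (ι ⊕ κ) R) := by
  refine isUnit_of_mul_eq_one_both (b := fromBlocks 1 0 (-Q) 1) ?_ ?_ <;>
    simp [Matrix.fromBlocks_multiply]

theorem submatrix_equiv_eq_mul {ι κ : Type} [Fintype ι] [DecidableEq ι] [Fintype κ]
    [DecidableEq κ] (M : Matrix ι κ R) (e : ι ≃ ι) (e' : κ ≃ κ) :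
    M.submatrix e e' = (1 : Matrix ι ι R).submatrix e (Equiv.refl _) * M *
      (1 : Matrix κ κ R).submatrix (Equiv.refl _) e' := by
  ext i j
  simp [Matrix.mul_apply, Matrix.one_apply]

/-- Diagonal reduction over a two-sided Euclidean ring, as an induction principle. -/
theorem euclid_matrix_induction {N : R → ℕ}
    (hl : ∀ a b : R, b ≠ 0 → ∃ q, N (a - q * b) < N b)
    (hr : ∀ a b : R, b ≠ 0 → ∃ q, N (a - b * q) < N b)
    {P : ∀ m n : ℕ, Matrix (Fin m) (Fin n) R → Prop}
    (zero : ∀ m n, P m n 0)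
    (block : ∀ (m n : ℕ) (a : R) (M : Matrix (Fin m) (Fin n) R), P m n M →
      P (1 + m) (1 + n) (blockUpper (Matrix.of fun _ _ => a) 0 M))
    (equiv : ∀ (m n : ℕ) (U : Matrix (Fin m) (Fin m) R) (M : Matrix (Fin m) (Fin n) R)
      (V : Matrix (Fin n) (Fin n) R), IsUnit U → IsUnit V → P m n (U * M * V) → P m n M)
    (m n : ℕ) (M : Matrix (Fin m) (Fin n) R) : P m n M := by
  have step : ∀ m n : ℕ, (∀ M : Matrix (Fin m) (Fin n) R, P m n M) →
      ∀ M : Matrix (Fin (1 + m)) (Fin (1 + n)) R, P (1 + m) (1 + n) M := by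
    classical
    intro m n ih M
    by_cases hM : M = 0
    · rw [hM]; exact zero _ _
    -- The pivot is a non-zero entry of least norm among the entries of all matrices equivalent to
    -- `M`.
    let T : ℕ → Prop := fun k => ∃ (U : Matrix (Fin (1 + m)) (Fin (1 + m)) R)
      (V : Matrix (Fin (1 + n)) (Fin (1 + n)) R) (i : Fin (1 + m)) (j : Fin (1 + n)),
      IsUnit U ∧ IsUnit V ∧ (U * M * V) i j ≠ 0 ∧ N ((U * M * V) i j) = k
    have hT : ∃ k, T k := by
      obtain ⟨i, j, hij⟩ : ∃ i j, M i j ≠ 0 := by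
        by_contra! h; exact hM (Matrix.ext h)
      exact ⟨_, 1, 1, i, j, isUnit_one, isUnit_one, by simpa using hij, rfl⟩
    obtain ⟨U, V, i, j, hU, hV, hx, hk⟩ := Nat.find_spec hT
    have hmin := fun k => @Nat.find_min' _ _ hT k
    rw [← hk] at hmin
    let e : Fin 1 ⊕ Fin m ≃ Fin (1 + m) :=
      finSumFinEquiv.trans (Equiv.swap (finSumFinEquiv (Sum.inl 0)) i)
    let e' : Fin 1 ⊕ Fin n ≃ Fin (1 + n) :=
      finSumFinEquiv.trans (Equiv.swap (finSumFinEquiv (Sum.inl 0)) j)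
    set X := (U * M * V).submatrix e e' with hX
    set x := (U * M * V) i j with hxdef
    have hX00 : X (Sum.inl 0) (Sum.inl 0) = x := by
      simp only [hX, e, e', Matrix.submatrix_apply, Equiv.trans_apply, Equiv.swap_apply_left]
      rfl
    have key : ∀ (A : Matrix (Fin 1 ⊕ Fin m) (Fin 1 ⊕ Fin m) R)
        (B : Matrix (Fin 1 ⊕ Fin n) (Fin 1 ⊕ Fin n) R), IsUnit A → IsUnit B → A * X * B =
        ((A.submatrix e.symm e.symm * U) * M * (V * B.submatrix e'.symm e'.symm)).submatrix e e' := by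
      intro A B _ _
      have h1 : A * X * B = ((A.submatrix e.symm e.symm).submatrix e e *
          (U * M * V).submatrix e e') * (B.submatrix e'.symm e'.symm).submatrix e' e' := by
        simp only [Matrix.submatrix_submatrix, Equiv.symm_comp_self, Matrix.submatrix_id_id]
        rfl
      rw [h1, Matrix.submatrix_mul_equiv, Matrix.submatrix_mul_equiv]
      simp only [Matrix.mul_assoc]
    have hXmin : ∀ (A : Matrix (Fin 1 ⊕ Fin m) (Fin 1 ⊕ Fin m) R)
        (B : Matrix (Fin 1 ⊕ Fin n) (Fin 1 ⊕ Fin n) R), IsUnit A → IsUnit B → ∀ i j, (A * X * B) i j ≠ 0 →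
        N x ≤ N ((A * X * B) i j) := by
      intro A B hA hB i j hij
      rw [key A B hA hB, Matrix.submatrix_apply] at hij ⊢
      exact hmin _ ⟨_, _, _, _, (isUnit_submatrix_equiv' e.symm hA).mul hU,
        hV.mul (isUnit_submatrix_equiv' e'.symm hB), hij, rfl⟩
    have hXP : ∀ (A : Matrix (Fin 1 ⊕ Fin m) (Fin 1 ⊕ Fin m) R)
        (B : Matrix (Fin 1 ⊕ Fin n) (Fin 1 ⊕ Fin n) R), IsUnit A → IsUnit B → ∀ M' : Matrix (Fin m) (Fin n) R,
        A * X * B = fromBlocks (Matrix.of fun _ _ => x) 0 0 M' → P _ _ M := by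
      intro A B hA hB M' h
      refine equiv _ _ _ M _ ((isUnit_submatrix_equiv' e.symm hA).mul hU)
        (hV.mul (isUnit_submatrix_equiv' e'.symm hB)) ?_
      refine equiv _ _ ((1 : Matrix _ _ R).submatrix (finSumFinEquiv.symm.trans e) (Equiv.refl _)) _
        ((1 : Matrix _ _ R).submatrix (Equiv.refl _) (finSumFinEquiv.symm.trans e'))
        (isUnit_one_submatrix _ _) (isUnit_one_submatrix _ _) ?_
      rw [← submatrix_equiv_eq_mul]
      have h2 := block m n x M' (ih M')
      rw [blockUpper, ← h, key A B hA hB, Matrix.reindex_apply, Matrix.submatrix_submatrix] at h2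
      exact h2
    -- The remainder of an entry of the pivot's row is itself an entry of an equivalent matrix, so
    -- minimality forces it to be zero and the pivot divides its row. The column is treated in the
    -- same way below.
    obtain ⟨Q, hQ⟩ : ∃ Q : Matrix (Fin 1) (Fin n) R,
        X.toBlocks₁₂ = (Matrix.of fun _ _ => x : Matrix (Fin 1) (Fin 1) R) * Q := by
      choose q hq using fun b : Fin n => hr (X (Sum.inl 0) (Sum.inr b)) x hx
      refine ⟨Matrix.of fun _ b => q b, ?_⟩
      ext a b
      obtain rfl : a = 0 := Subsingleton.elim _ _
      have h1 := hXmin 1 _ isUnit_one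
        (isUnit_fromBlocks_upper (Matrix.of fun (_ : Fin 1) b => -q b)) (Sum.inl 0) (Sum.inr b)
      rw [Matrix.one_mul] at h1
      have h2 : (X * (fromBlocks 1 (Matrix.of fun (_ : Fin 1) b => -q b) 0 1 :
          Matrix (Fin 1 ⊕ Fin n) (Fin 1 ⊕ Fin n) R))
          (Sum.inl 0) (Sum.inr b) = X (Sum.inl 0) (Sum.inr b) - x * q b := by
        rw [← Matrix.fromBlocks_toBlocks X, Matrix.fromBlocks_multiply]
        simp [Matrix.mul_apply, Matrix.toBlocks₁₁, Matrix.toBlocks₁₂, hX00]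
        abel
      rw [h2] at h1
      have h3 : X (Sum.inl 0) (Sum.inr b) - x * q b = 0 := by
        by_contra h; exact absurd (hq b) (not_lt.2 (h1 h))
      simpa [Matrix.toBlocks₁₂, Matrix.mul_apply] using sub_eq_zero.1 h3
    obtain ⟨Q', hQ'⟩ : ∃ Q : Matrix (Fin m) (Fin 1) R,
        X.toBlocks₂₁ = Q * (Matrix.of fun _ _ => x : Matrix (Fin 1) (Fin 1) R) := by
      choose q hq using fun b : Fin m => hl (X (Sum.inr b) (Sum.inl 0)) x hx
      refine ⟨Matrix.of fun b _ => q b, ?_⟩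
      ext b a
      obtain rfl : a = 0 := Subsingleton.elim _ _
      have h1 := hXmin _ 1 (isUnit_fromBlocks_lower (Matrix.of fun b (_ : Fin 1) => -q b))
        isUnit_one (Sum.inr b) (Sum.inl 0)
      rw [Matrix.mul_one] at h1
      have h2 : ((fromBlocks 1 0 (Matrix.of fun b (_ : Fin 1) => -q b) 1 :
          Matrix (Fin 1 ⊕ Fin m) (Fin 1 ⊕ Fin m) R) * X)
          (Sum.inr b) (Sum.inl 0) = X (Sum.inr b) (Sum.inl 0) - q b * x := by
        rw [← Matrix.fromBlocks_toBlocks X, Matrix.fromBlocks_multiply]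
        simp [Matrix.mul_apply, Matrix.toBlocks₁₁, Matrix.toBlocks₂₁, hX00]
        abel
      rw [h2] at h1
      have h3 : X (Sum.inr b) (Sum.inl 0) - q b * x = 0 := by
        by_contra h; exact absurd (hq b) (not_lt.2 (h1 h))
      simpa [Matrix.toBlocks₂₁, Matrix.mul_apply] using sub_eq_zero.1 h3
    have hX11 : X.toBlocks₁₁ = Matrix.of fun _ _ => x := by
      ext a b
      obtain rfl : a = 0 := Subsingleton.elim _ _
      obtain rfl : b = 0 := Subsingleton.elim _ _
      exact hX00
    refine hXP _ _ (isUnit_fromBlocks_lower (-Q')) (isUnit_fromBlocks_upper (-Q))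
      (X.toBlocks₂₂ - Q' * (Matrix.of fun _ _ => x : Matrix (Fin 1) (Fin 1) R) * Q) ?_
    conv_lhs => rw [← Matrix.fromBlocks_toBlocks X, hQ, hQ', hX11]
    rw [Matrix.fromBlocks_multiply, Matrix.fromBlocks_multiply]
    simp only [Matrix.mul_one, Matrix.mul_zero, Matrix.zero_mul, add_zero,
      Matrix.one_mul, Matrix.neg_mul, neg_add_cancel, Matrix.mul_neg, Matrix.mul_assoc]
    congr 1
    abel
  have sub0 : ∀ n (M : Matrix (Fin 0) (Fin n) R), P 0 n M := fun n M => by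
    rw [show M = 0 from Subsingleton.elim _ _]; exact zero _ _
  have sub1 : ∀ m (M : Matrix (Fin m) (Fin 0) R), P m 0 M := fun n M => by
    rw [show M = 0 from Subsingleton.elim _ _]; exact zero _ _
  induction m generalizing n with
  | zero => exact sub0 _ _
  | succ m ih =>
    cases n with
    | zero => exact sub1 _ _
    | succ n =>
      have := step m n (ih n)
      rw [Nat.add_comm 1 m, Nat.add_comm 1 n] at this
      exact this M

end euclid

/-! ### Rank functions over a nilpotent thickening of a simple artinian ring -/

section thickening

open Matrix

theorem fromBlocks_diag_isUnit {R : Type u} [Ring R] {ι κ : Type} [Fintype ι] [Fintype κ]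
    [DecidableEq ι] [DecidableEq κ] {U : Matrix ι ι R} {V : Matrix κ κ R} (hU : IsUnit U)
    (hV : IsUnit V) : IsUnit (fromBlocks U 0 0 V : Matrix (ι ⊕ κ) (ι ⊕ κ) R) := by
  obtain ⟨U, rfl⟩ := hU
  obtain ⟨V, rfl⟩ := hV
  refine isUnit_of_mul_eq_one_both (b := fromBlocks (U⁻¹).1 0 0 (V⁻¹).1) ?_ ?_ <;>
    simp [Matrix.fromBlocks_multiply]

/-- The matrix is equivalent to `diag(1, …, 1, 0, …, 0)`. -/
def HasRankForm {R : Type u} [Ring R] {ι κ : Type} [Fintype ι] [Fintype κ] [DecidableEq ι]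
    [DecidableEq κ] (M : Matrix ι κ R) : Prop :=
  ∃ (ρ α β : Type) (_ : Fintype ρ) (_ : DecidableEq ρ) (_ : Fintype α) (_ : DecidableEq α)
    (_ : Fintype β) (_ : DecidableEq β) (e : ι ≃ ρ ⊕ α) (e' : κ ≃ ρ ⊕ β)
    (U : Matrix ι ι R) (V : Matrix κ κ R), IsUnit U ∧ IsUnit V ∧
    U * M * V = (fromBlocks 1 0 0 0 : Matrix (ρ ⊕ α) (ρ ⊕ β) R).submatrix e e'

section

variable {R S : Type u} [Ring R] [Ring S] {ι κ ι' κ' : Type} [Fintype ι] [Fintype κ]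
  [DecidableEq ι] [DecidableEq κ] [Fintype ι'] [Fintype κ'] [DecidableEq ι'] [DecidableEq κ']

theorem HasRankForm.submatrix {M : Matrix ι κ R} (h : HasRankForm M) (f : ι' ≃ ι) (f' : κ' ≃ κ) :
    HasRankForm (M.submatrix f f') := by
  obtain ⟨ρ, α, β, _, _, _, _, _, _, e, e', U, V, hU, hV, h⟩ := h
  refine ⟨ρ, α, β, ‹_›, ‹_›, ‹_›, ‹_›, ‹_›, ‹_›, f.trans e, f'.trans e', U.submatrix f f,
    V.submatrix f' f', isUnit_submatrix_equiv' f hU, isUnit_submatrix_equiv' f' hV, ?_⟩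
  rw [Matrix.submatrix_mul_equiv, Matrix.submatrix_mul_equiv, h]
  rfl

theorem HasRankForm.of_mul {U : Matrix ι ι R} {V : Matrix κ κ R} {M : Matrix ι κ R}
    (hU : IsUnit U) (hV : IsUnit V) (h : HasRankForm (U * M * V)) : HasRankForm M := by
  obtain ⟨ρ, α, β, _, _, _, _, _, _, e, e', U', V', hU', hV', h⟩ := h
  refine ⟨ρ, α, β, ‹_›, ‹_›, ‹_›, ‹_›, ‹_›, ‹_›, e, e', U' * U, V * V', hU'.mul hU, hV.mul hV', ?_⟩
  rw [← h]
  simp only [Matrix.mul_assoc]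

theorem HasRankForm.map {M : Matrix ι κ R} (h : HasRankForm M) (φ : R →+* S) :
    HasRankForm (M.map φ) := by
  obtain ⟨ρ, α, β, _, _, _, _, _, _, e, e', U, V, hU, hV, h⟩ := h
  refine ⟨ρ, α, β, ‹_›, ‹_›, ‹_›, ‹_›, ‹_›, ‹_›, e, e', U.map φ, V.map φ,
    hU.map φ.mapMatrix, hV.map φ.mapMatrix, ?_⟩
  rw [← Matrix.map_mul, ← Matrix.map_mul, h, ← Matrix.submatrix_map, Matrix.fromBlocks_map]
  simp

end

/-- A division ring is Euclidean with norms `0` and `1`, so diagonal reduction applies. Non-zero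
diagonal entries are then rescaled to `1`, and zero ones are moved into the zero block. -/
theorem hasRankForm_of_divisionRing {Δ : Type u} [DivisionRing Δ] {ι κ : Type} [Fintype ι]
    [Fintype κ] [DecidableEq ι] [DecidableEq κ] (M : Matrix ι κ Δ) : HasRankForm M := by
  classical
  have key : ∀ (m n : ℕ) (M : Matrix (Fin m) (Fin n) Δ), HasRankForm M := by
    refine euclid_matrix_induction (N := fun x : Δ => if x = 0 then 0 else 1) (fun a b hb => ?_)
      (fun a b hb => ?_) (fun m n => ?_) (fun m n a M h => ?_) (fun m n U M V hU hV h => ?_)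
    · exact ⟨a * b⁻¹, by simp [hb]⟩
    · exact ⟨b⁻¹ * a, by simp [hb]⟩
    · refine ⟨Empty, Fin m, Fin n, inferInstance, inferInstance, inferInstance, inferInstance,
        inferInstance, inferInstance, (Equiv.emptySum _ _).symm, (Equiv.emptySum _ _).symm, 1, 1,
        isUnit_one, isUnit_one, ?_⟩
      ext i j
      simp
    · rw [blockUpper, Matrix.reindex_apply]
      refine HasRankForm.submatrix ?_ _ _
      obtain ⟨ρ, α, β, _, _, _, _, _, _, e, e', U, V, hU, hV, h⟩ := h
      by_cases ha : a = 0
      · let g (ν : Type) : Fin 1 ⊕ (ρ ⊕ ν) ≃ ρ ⊕ (Fin 1 ⊕ ν) :=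
          (Equiv.sumAssoc _ _ _).symm.trans
            (((Equiv.sumComm _ _).sumCongr (Equiv.refl _)).trans (Equiv.sumAssoc _ _ _))
        refine ⟨ρ, Fin 1 ⊕ α, Fin 1 ⊕ β, inferInstance, inferInstance, inferInstance, inferInstance,
          inferInstance, inferInstance, ((Equiv.refl _).sumCongr e).trans (g α),
          ((Equiv.refl _).sumCongr e').trans (g β), fromBlocks 1 0 0 U, fromBlocks 1 0 0 V,
          fromBlocks_diag_isUnit isUnit_one hU, fromBlocks_diag_isUnit isUnit_one hV, ?_⟩
        rw [Matrix.fromBlocks_multiply, Matrix.fromBlocks_multiply]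
        simp only [Matrix.mul_zero, Matrix.zero_mul, add_zero, zero_add, h, ha]
        ext (i | i) (j | j)
        · simp [g]
        · simp [g]; rcases e' j with k | k <;> simp
        · simp [g]; rcases e i with k | k <;> simp
        · simp [g]; rcases e i with k | k <;> rcases e' j with k' | k' <;> simp
      · let g (ν : Type) : Fin 1 ⊕ (ρ ⊕ ν) ≃ (Fin 1 ⊕ ρ) ⊕ ν := (Equiv.sumAssoc _ _ _).symm
        have hu : IsUnit (Matrix.of fun _ _ => a : Matrix (Fin 1) (Fin 1) Δ) := by
          refine isUnit_of_mul_eq_one_both (b := (Matrix.of fun _ _ => a⁻¹)) ?_ ?_ <;>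
            ext i j <;> obtain rfl := Subsingleton.elim i j <;> simp [Matrix.mul_apply, ha]
        refine ⟨Fin 1 ⊕ ρ, α, β, inferInstance, inferInstance, inferInstance, inferInstance,
          inferInstance, inferInstance, ((Equiv.refl _).sumCongr e).trans (g α),
          ((Equiv.refl _).sumCongr e').trans (g β), fromBlocks (hu.unit⁻¹).1 0 0 U,
          fromBlocks 1 0 0 V,
          fromBlocks_diag_isUnit (Units.isUnit _) hU, fromBlocks_diag_isUnit isUnit_one hV, ?_⟩
        rw [Matrix.fromBlocks_multiply, Matrix.fromBlocks_multiply]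
        simp only [Matrix.mul_zero, Matrix.zero_mul, add_zero, zero_add, h, Matrix.mul_one,
          IsUnit.val_inv_mul]
        ext (i | i) (j | j)
        · simp [g, Matrix.one_apply]
        · simp [g]; rcases e' j with k | k <;> simp
        · simp [g]; rcases e i with k | k <;> simp
        · simp [g]; rcases e i with k | k <;> rcases e' j with k' | k' <;> simp [Matrix.one_apply]
    · exact HasRankForm.of_mul hU hV h
  have := (key _ _ (M.submatrix (Fintype.equivFin ι).symm (Fintype.equivFin κ).symm)).submatrix
    (Fintype.equivFin ι) (Fintype.equivFin κ)
  simpa using this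

/-- Over `Mat_s(Δ)`, the sum of `s` copies of any matrix has a rank form. -/
theorem hasRankForm_blockDiagonal {Δ : Type u} [DivisionRing Δ] {s : ℕ} {ι κ : Type} [Fintype ι]
    [Fintype κ] [DecidableEq ι] [DecidableEq κ] (M : Matrix ι κ (Matrix (Fin s) (Fin s) Δ)) :
    HasRankForm (blockDiagonal fun _ : Fin s => M) := by
  -- The flip that exchanges the copy index with the row index inside `Mat_s(Δ)`. Conjugating `s`
  -- copies of `M` by it gives `N`, the matrix `M` written out over `Δ`, with each entry embedded as
  -- a scalar matrix; over `Δ` a rank form exists.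
  let T (ν : Type) [DecidableEq ν] : Matrix (ν × Fin s) (ν × Fin s) (Matrix (Fin s) (Fin s) Δ) :=
    Matrix.of fun x y => if x.1 = y.1 then Matrix.single y.2 x.2 1 else 0
  have hT : ∀ (ν : Type) [DecidableEq ν] [Fintype ν], T ν * T ν = 1 := by
    intro ν _ _
    have h1 : ∑ c : Fin s, Matrix.single c c (1 : Δ) = 1 := by
      ext i j
      simp [Matrix.sum_apply, Matrix.single_apply, Matrix.one_apply, ite_and]
    refine Matrix.ext fun ⟨i, a⟩ ⟨j, b⟩ => ?_
    rw [Matrix.mul_apply, Fintype.sum_prod_type, Finset.sum_eq_single i]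
    · by_cases hij : i = j
      · subst hij
        by_cases hab : a = b
        · subst hab
          simpa [T] using h1
        · simp [T, hab, Matrix.single_mul_single_of_ne]
      · simp [T, hij]
    · intro k _ hk
      simp [T, hk.symm]
    · simp
  let N : Matrix (ι × Fin s) (κ × Fin s) Δ := Matrix.of fun x y => M x.1 y.1 x.2 y.2
  refine HasRankForm.of_mul (isUnit_of_mul_eq_one_both (hT ι) (hT ι))
    (isUnit_of_mul_eq_one_both (hT κ) (hT κ)) ?_
  have : T ι * (blockDiagonal fun _ : Fin s => M) * T κ = N.map (Matrix.scalar (Fin s)) := by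
    have h1 : ∀ (X : Matrix (Fin s) (Fin s) Δ) (b b' : Fin s),
        ∑ a : Fin s, Matrix.single a b 1 * X * Matrix.single b' a 1 =
          Matrix.scalar (Fin s) (X b b') := by
      intro X b b'
      ext i j
      simp [Matrix.sum_apply, Matrix.single_mul_mul_single, Matrix.diagonal_apply,
        Matrix.single_apply, ite_and]
    refine Matrix.ext fun ⟨i, b⟩ ⟨j, b'⟩ => ?_
    have h2 : ∀ y : κ × Fin s, (T ι * (blockDiagonal fun _ : Fin s => M)) (i, b) y =
        Matrix.single y.2 b 1 * M i y.1 := by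
      intro y
      rw [Matrix.mul_apply, Finset.sum_eq_single (i, y.2)]
      · simp [T, Matrix.blockDiagonal_apply]
      · rintro ⟨k, c⟩ _ hk
        simp only [T, Matrix.blockDiagonal_apply, Matrix.of_apply]
        split_ifs with h3 h4 <;> simp_all
      · simp
    rw [Matrix.mul_apply, Fintype.sum_prod_type, Finset.sum_eq_single j]
    · simp only [h2, N, Matrix.map_apply, Matrix.of_apply, ← h1]
      simp [T]
    · intro k _ hk
      simp [T, hk]
    · simp
  rw [this]
  exact (hasRankForm_of_divisionRing N).map _

section

variable {A E : Type u} [Ring A] [Ring E] {p : A} (hp : p ∈ Subring.center A) (hn : IsNilpotent p)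
  {φ : A →+* E} (hφ : Function.Surjective φ) (hker : ∀ a, φ a = 0 → ∃ b, a = p * b)
  {ι κ : Type} [Fintype ι] [Fintype κ] [DecidableEq ι] [DecidableEq κ]

omit [Fintype ι] [Fintype κ] [DecidableEq ι] [DecidableEq κ] in
include hker in
theorem exists_eq_smul_of_map_eq_zero {M : Matrix ι κ A} (h : M.map φ = 0) :
    ∃ Y : Matrix ι κ A, M = p • Y := by
  choose b hb using fun i j => hker (M i j) (congrFun (congrFun h i) j)
  exact ⟨Matrix.of b, Matrix.ext hb⟩

include hp hn hker in
-- `M - 1` is a multiple of `p`, hence nilpotent because `p` is central and nilpotent.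
theorem isUnit_of_map_eq_one {M : Matrix ι ι A} (h : M.map φ = 1) : IsUnit M := by
  obtain ⟨Y, hY⟩ := exists_eq_smul_of_map_eq_zero hker (M := M - 1)
    (by rw [Matrix.map_sub _ (map_sub φ), h]; simp)
  have hsm : p • Y = Matrix.scalar ι p * Y := by
    ext i j; simp
  have hcomm : Commute (Matrix.scalar ι p) Y := by
    ext i j; simp [Subring.mem_center_iff.1 hp]
  rw [sub_eq_iff_eq_add.1 hY, hsm]
  exact (hcomm.isNilpotent_mul_right (hn.map (Matrix.scalar ι))).isUnit_add_one

include hp hn hφ hker in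
-- Lifts of a matrix and of its inverse have products that reduce to `1`, so both products are
-- invertible.
theorem exists_isUnit_map_eq {U : Matrix ι ι E} (hU : IsUnit U) :
    ∃ U' : Matrix ι ι A, IsUnit U' ∧ U'.map φ = U := by
  obtain ⟨U, rfl⟩ := hU
  have hl : ∀ M : Matrix ι ι E, (M.map (Function.surjInv hφ)).map φ = M := fun M => by
    ext i j; exact Function.surjInv_eq hφ _
  obtain ⟨x, hx⟩ := isUnit_of_map_eq_one hp hn hker (M := U.1.map (Function.surjInv hφ) *
    (U⁻¹).1.map (Function.surjInv hφ)) (by rw [Matrix.map_mul, hl, hl, U.mul_inv])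
  obtain ⟨y, hy⟩ := isUnit_of_map_eq_one hp hn hker (M := (U⁻¹).1.map (Function.surjInv hφ) *
    U.1.map (Function.surjInv hφ)) (by rw [Matrix.map_mul, hl, hl, U.inv_mul])
  refine ⟨_, isUnit_iff_exists_and_exists.2 ⟨⟨(U⁻¹).1.map (Function.surjInv hφ) * (x⁻¹).1, ?_⟩,
    ⟨(y⁻¹).1 * (U⁻¹).1.map (Function.surjInv hφ), ?_⟩⟩, hl U.1⟩
  · rw [← mul_assoc, ← hx, x.mul_inv]
  · rw [mul_assoc, ← hy, y.inv_mul]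

include hp hn hφ hker in
/-- A matrix with a rank form modulo `p` is `diag(1, p B)` up to equivalence. -/
theorem exists_gen_eq_add_smul {M : Matrix ι κ A} (h : HasRankForm (M.map φ)) :
    ∃ (r : ℕ) (α β : Type) (_ : Fintype α) (_ : Fintype β) (B : Matrix α β A),
      ∀ rk : MatFun A, IsSylvesterRank rk → genRank rk M = r + genRank rk (p • B) := by
  obtain ⟨ρ, α, β, _, _, _, _, _, _, e, e', U, V, hU, hV, h⟩ := h
  obtain ⟨U, hU', rfl⟩ := exists_isUnit_map_eq hp hn hφ hker hU
  obtain ⟨V, hV', rfl⟩ := exists_isUnit_map_eq hp hn hφ hker hV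
  let Z : Matrix (ρ ⊕ α) (ρ ⊕ β) A := (U * M * V).submatrix e.symm e'.symm
  have hZ : Z.map φ = fromBlocks 1 0 0 0 := by
    rw [← Matrix.map_mul, ← Matrix.map_mul] at h
    simp only [Z]
    rw [← Matrix.submatrix_map, h]
    simp
  rw [← Matrix.fromBlocks_toBlocks Z, Matrix.fromBlocks_map, Matrix.fromBlocks_inj] at hZ
  obtain ⟨h11, h12, h21, h22⟩ := hZ
  obtain ⟨Y21, hY21⟩ := exists_eq_smul_of_map_eq_zero hker h21
  obtain ⟨Y22, hY22⟩ := exists_eq_smul_of_map_eq_zero hker h22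
  obtain ⟨G, hG⟩ := isUnit_of_map_eq_one hp hn hker h11
  refine ⟨Fintype.card ρ, α, β, ‹_›, ‹_›, Y22 - Y21 * ((G⁻¹).1 * Z.toBlocks₁₂), fun rk hrk => ?_⟩
  have hM : genRank rk M = genRank rk Z := by
    rw [hrk.gen_submatrix, hrk.gen_mul_isUnit hV', hrk.gen_isUnit_mul hU']
  -- Elimination with the invertible corner `G`. The lower blocks are divisible by `p`, so the Schur
  -- complement is as well.
  have hfac : (fromBlocks (G⁻¹).1 0 0 1 : Matrix (ρ ⊕ α) (ρ ⊕ α) A) *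
      ((fromBlocks 1 0 (-(Z.toBlocks₂₁ * (G⁻¹).1)) 1 : Matrix (ρ ⊕ α) (ρ ⊕ α) A) * Z) *
      (fromBlocks 1 (-((G⁻¹).1 * Z.toBlocks₁₂)) 0 1 : Matrix (ρ ⊕ β) (ρ ⊕ β) A) =
      fromBlocks 1 0 0 (p • (Y22 - Y21 * ((G⁻¹).1 * Z.toBlocks₁₂))) := by
    conv_lhs => rw [← Matrix.fromBlocks_toBlocks Z, ← hG]
    rw [Matrix.fromBlocks_multiply, Matrix.fromBlocks_multiply, Matrix.fromBlocks_multiply]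
    simp only [Matrix.mul_one, Matrix.mul_zero, Matrix.zero_mul, add_zero, zero_add,
      Matrix.one_mul, Matrix.neg_mul, Matrix.mul_neg, Matrix.mul_assoc, G.inv_mul, hY21, hY22,
      smul_sub, Matrix.smul_mul, Matrix.toBlocks_fromBlocks₁₂, Matrix.toBlocks_fromBlocks₂₁,
      neg_add_cancel, neg_zero]
    congr 1; abel
  rw [hM, ← hrk.gen_one (ι := ρ), ← hrk.gen_fromBlocks_diag, ← hfac,
    hrk.gen_mul_isUnit (isUnit_fromBlocks_upper _),
    hrk.gen_isUnit_mul (fromBlocks_diag_isUnit (Units.isUnit _) isUnit_one),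
    hrk.gen_isUnit_mul (isUnit_fromBlocks_lower _)]

end

theorem IsSylvesterRank.gen_shift {A : Type u} [Ring A] {rk : MatFun A} (p : A) {ι κ : Type}
    [Fintype ι] [Fintype κ] (B : Matrix ι κ A) :
    genRank (fun m n (B : Matrix (Fin m) (Fin n) A) => rk m n (p • B) / elemRank rk p) B =
      genRank rk (p • B) / elemRank rk p := rfl

/-- If `p` is central and nilpotent and `A / pA` is a matrix ring over a division ring, then rank
functions on `A` are determined by their values at the powers of `p`. -/
theorem eq_of_elemRank_pow_eq {A Δ : Type u} [Ring A] [DivisionRing Δ] {s : ℕ} [NeZero s] {p : A}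
    (hp : p ∈ Subring.center A) (hn : IsNilpotent p) {φ : A →+* Matrix (Fin s) (Fin s) Δ}
    (hφ : Function.Surjective φ) (hker : ∀ a, φ a = 0 → ∃ b, a = p * b) {rk rk' : MatFun A}
    (h : IsSylvesterRank rk) (h' : IsSylvesterRank rk')
    (heq : ∀ i : ℕ, elemRank rk (p ^ i) = elemRank rk' (p ^ i)) : rk = rk' := by
  obtain ⟨k, hk⟩ := hn
  -- The induction lowers the exponent at which the rank vanishes and leaves the ring alone: if `rk`
  -- vanishes at `p ^ (k + 1)`, then `B ↦ rk(p B) / rk p` vanishes at `p ^ k`. When `rk p = 0` there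
  -- is nothing to shift, and both functions vanish on multiples of `p`.
  have key : ∀ (k : ℕ) (rk rk' : MatFun A), IsSylvesterRank rk → IsSylvesterRank rk' →
      (∀ i : ℕ, elemRank rk (p ^ i) = elemRank rk' (p ^ i)) → elemRank rk (p ^ k) = 0 →
      rk = rk' := by
    intro k
    induction k with
    | zero =>
      intro rk rk' h h' heq h0
      rw [pow_zero, h.elem_one] at h0
      exact absurd h0 one_ne_zero
    | succ k ih =>
      intro rk rk' h h' heq h0
      have hp1 := heq 1
      rw [pow_one] at hp1
      have hsm : ∀ (α β : Type) [Fintype α] [Fintype β] (B : Matrix α β A),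
          genRank rk (p • B) = genRank rk' (p • B) := by
        intro α β _ _ B
        rcases (h.elem_nonneg p).eq_or_lt with hz | hz
        · have h1 := h.gen_smul_le p B
          have h2 := h'.gen_smul_le p B
          rw [← hp1, ← hz, mul_zero] at h2
          rw [← hz, mul_zero] at h1
          exact (le_antisymm h1 (h.gen_nonneg _)).trans (le_antisymm h2 (h'.gen_nonneg _)).symm
        · have hz' := hz
          rw [hp1] at hz'
          have hpow : ∀ (rk : MatFun A) (i : ℕ), elemRank (fun m n (B : Matrix (Fin m) (Fin n) A) =>
              rk m n (p • B) / elemRank rk p) (p ^ i) = elemRank rk (p ^ (i + 1)) / elemRank rk p := by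
            intro rk i
            rw [pow_succ']; rfl
          have := ih _ _ (h.shift hp hz) (h'.shift hp hz') (fun i => by
            rw [hpow, hpow, heq, hp1]) (by rw [hpow, h0, zero_div])
          have h3 := congrArg (fun r => genRank r B) this
          simp only [IsSylvesterRank.gen_shift] at h3
          rw [hp1] at h3
          exact (div_left_inj' hz'.ne').1 h3
      funext m n M
      -- Over `Mat_s(Δ)` a single `M` need not have a rank form, but `s` copies do, and their rank
      -- is `s` times that of `M`.
      have hM := hasRankForm_blockDiagonal (M.map φ)
      rw [← Matrix.blockDiagonal_map (fun _ : Fin s => M) φ (map_zero φ)] at hM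
      obtain ⟨r, α, β, _, _, B, hB⟩ := exists_gen_eq_add_smul hp ⟨_, hk⟩ hφ hker hM
      have e1 := hB rk h
      have e2 := hB rk' h'
      rw [h.gen_blockDiagonal_const, h.gen_fin] at e1
      rw [h'.gen_blockDiagonal_const, h'.gen_fin, ← hsm, ← e1] at e2
      exact (mul_left_cancel₀ (Nat.cast_ne_zero.2 (NeZero.ne s)) e2).symm
  exact key k rk rk' h h' heq (by rw [hk, h.elem_zero])

end thickening

/-! ### Arithmetic in skew Laurent polynomial rings -/

namespace SkewLaurent

variable {D : Type u} [DivisionRing D] {τ : D ≃+* D}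

/-- The coefficient of `tⁿ`. -/
noncomputable def coeff (f : SkewLaurent D τ) (n : ℤ) : D :=
  SkewMonoidAlgebra.coeff (k := D) (G := Multiplicative ℤ) f (Multiplicative.ofAdd n)

variable (τ) in
/-- The monomial `d tⁿ`. -/
noncomputable def mon (n : ℤ) (d : D) : SkewLaurent D τ :=
  (SkewMonoidAlgebra.single (Multiplicative.ofAdd n) d : SkewMonoidAlgebra D (Multiplicative ℤ))

theorem ext_coeff {f g : SkewLaurent D τ} (h : ∀ n, coeff f n = coeff g n) : f = g :=
  SkewMonoidAlgebra.ext fun n => h n.toAdd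

theorem zpowAction_smul (n : ℤ) (d : D) :
    (letI := zpowAction τ; (Multiplicative.ofAdd n) • d) = (τ ^ n) d := by
  change (zpowersHom (D ≃+* D) τ (Multiplicative.ofAdd n)) d = (τ ^ n) d
  simp

@[simp] theorem coeff_zero (n : ℤ) : coeff (0 : SkewLaurent D τ) n = 0 := rfl

@[simp] theorem coeff_add (f g : SkewLaurent D τ) (n : ℤ) :
    coeff (f + g) n = coeff f n + coeff g n := by
  let _ := zpowAction τ
  exact DFunLike.congr_fun (SkewMonoidAlgebra.coeff_add (k := D) (G := Multiplicative ℤ) f g)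
    (Multiplicative.ofAdd n)

@[simp] theorem coeff_neg (f : SkewLaurent D τ) (n : ℤ) : coeff (-f) n = -coeff f n := by
  rw [eq_neg_iff_add_eq_zero, ← coeff_add, neg_add_cancel, coeff_zero]

@[simp] theorem coeff_sub (f g : SkewLaurent D τ) (n : ℤ) :
    coeff (f - g) n = coeff f n - coeff g n := by
  rw [sub_eq_add_neg, coeff_add, coeff_neg, sub_eq_add_neg]

theorem coeff_mon (i : ℤ) (d : D) (n : ℤ) : coeff (mon τ i d) n = if n = i then d else 0 := by
  classical
  unfold coeff mon
  rw [SkewMonoidAlgebra.coeff_single_apply]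
  simp [eq_comm]

theorem coeff_mon_mul (i : ℤ) (d : D) (f : SkewLaurent D τ) (n : ℤ) :
    coeff (mon τ i d * f) n = d * (τ ^ i) (coeff f (n - i)) := by
  let _ := zpowAction τ
  have h := SkewMonoidAlgebra.coeff_single_mul (k := D) (G := Multiplicative ℤ) d
    (Multiplicative.ofAdd i) f (Multiplicative.ofAdd n)
  rw [zpowAction_smul] at h
  refine h.trans ?_
  rw [sub_eq_neg_add]
  rfl

theorem coeff_mul_mon (i : ℤ) (d : D) (f : SkewLaurent D τ) (n : ℤ) :
    coeff (f * mon τ i d) n = coeff f (n - i) * (τ ^ (n - i)) d := by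
  let _ := zpowAction τ
  have h := SkewMonoidAlgebra.coeff_mul_single (k := D) (G := Multiplicative ℤ) f d
    (Multiplicative.ofAdd i) (Multiplicative.ofAdd n)
  have e : (Multiplicative.ofAdd n) * (Multiplicative.ofAdd i)⁻¹ =
      Multiplicative.ofAdd (n - i) := by rw [← ofAdd_neg, ← ofAdd_add, sub_eq_add_neg]
  rw [e, zpowAction_smul] at h
  exact h

theorem one_eq_mon : (1 : SkewLaurent D τ) = mon τ 0 1 := rfl

theorem mon_mul_mon (i j : ℤ) (a b : D) :
    mon τ i a * mon τ j b = mon τ (i + j) (a * (τ ^ i) b) := by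
  refine ext_coeff fun n => ?_
  rw [coeff_mon_mul, coeff_mon, coeff_mon]
  by_cases h : n = i + j
  · rw [if_pos h, if_pos (by omega)]
  · rw [if_neg h, if_neg (by omega), map_zero, mul_zero]

theorem C_eq_mon (d : D) : C τ d = mon τ 0 d := rfl

theorem t_eq_mon : t τ = mon τ 1 1 := rfl

theorem C_mul_mon (d : D) (n : ℤ) (a : D) : C τ d * mon τ n a = mon τ n (d * a) := by
  rw [C_eq_mon, mon_mul_mon]; simp

theorem isUnit_mon (n : ℤ) {d : D} (hd : d ≠ 0) : IsUnit (mon τ n d) := by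
  refine isUnit_of_mul_eq_one_both (b := mon τ (-n) ((τ ^ (-n)) d⁻¹)) ?_ ?_
  · rw [mon_mul_mon, one_eq_mon]
    simp [hd]
  · rw [mon_mul_mon, one_eq_mon, ← map_mul]
    simp [hd]

theorem eq_sum_mon (f : SkewLaurent D τ) {P : SkewLaurent D τ → Prop} (h0 : P 0)
    (hm : ∀ n d, P (mon τ n d)) (ha : ∀ f g, P f → P g → P (f + g)) : P f :=
  SkewMonoidAlgebra.induction_on (p := P) f h0 (fun g a => hm g.toAdd a) ha

/-! #### Windows and widths -/

/-- All exponents occurring in `f` are in `[x, x + w)`. -/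
def InWindow (f : SkewLaurent D τ) (x : ℤ) (w : ℕ) : Prop :=
  ∀ k, coeff f k ≠ 0 → x ≤ k ∧ k < x + w

theorem exists_inWindow (f : SkewLaurent D τ) : ∃ x w, InWindow f x w := by
  refine eq_sum_mon f (P := fun f => ∃ x w, InWindow f x w)
    ⟨0, 0, fun k h => absurd (coeff_zero k) h⟩ (fun n d => ⟨n, 1, fun k h => ?_⟩) ?_
  · rw [coeff_mon] at h
    have : k = n := by by_contra h'; exact h (if_neg h')
    omega
  · rintro f g ⟨x, w, h⟩ ⟨x', w', h'⟩
    refine ⟨min x x', (max (x + w) (x' + w') - min x x').toNat, fun k hk => ?_⟩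
    have : coeff f k ≠ 0 ∨ coeff g k ≠ 0 := by
      by_contra! h''
      exact hk (by rw [coeff_add, h''.1, h''.2, add_zero])
    rcases this with h1 | h1
    · have := h k h1; omega
    · have := h' k h1; omega

theorem exists_width (f : SkewLaurent D τ) : ∃ w x, InWindow f x w :=
  let ⟨x, w, h⟩ := exists_inWindow f; ⟨w, x, h⟩

open Classical in
/-- The length of the shortest interval containing all exponents occurring in `f`. -/
noncomputable def width (f : SkewLaurent D τ) : ℕ := Nat.find (exists_width f)

theorem width_spec (f : SkewLaurent D τ) : ∃ x, InWindow f x (width f) := by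
  classical exact Nat.find_spec (exists_width f)

theorem width_le {f : SkewLaurent D τ} {x : ℤ} {w : ℕ} (h : InWindow f x w) : width f ≤ w := by
  classical exact Nat.find_min' (exists_width f) ⟨x, h⟩

theorem InWindow.eq_zero {f : SkewLaurent D τ} {x : ℤ} (h : InWindow f x 0) : f = 0 := by
  refine ext_coeff fun n => ?_
  by_contra h'
  have := h n h'
  omega

/-- A non-zero element has a lowest and a highest term, which determine its width. -/
theorem exists_ends {f : SkewLaurent D τ} (hf : f ≠ 0) : ∃ (x : ℤ) (w : ℕ), width f = w + 1 ∧
    InWindow f x (w + 1) ∧ coeff f x ≠ 0 ∧ coeff f (x + w) ≠ 0 := by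
  obtain ⟨x, hx⟩ := width_spec f
  obtain ⟨w, hw⟩ : ∃ w, width f = w + 1 := by
    refine Nat.exists_eq_succ_of_ne_zero fun h => hf ?_
    rw [h] at hx
    exact hx.eq_zero
  rw [hw] at hx
  refine ⟨x, w, hw, hx, fun h => ?_, fun h => ?_⟩
  · have : InWindow f (x + 1) w := fun k hk => by
      have h1 := hx k hk
      have : k ≠ x := by rintro rfl; exact hk h
      push_cast at h1
      omega
    have := width_le this
    omega
  · have : InWindow f x w := fun k hk => by
      have h1 := hx k hk
      have : k ≠ x + w := by rintro rfl; exact hk h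
      push_cast at h1
      omega
    have := width_le this
    omega

/-- The division algorithm: if `H` contains elements with prescribed top term and width at most
`w + 1`, then everything can be reduced modulo `H` to a window of length `w`. -/
theorem reduce_to_window {K H : AddSubgroup (SkewLaurent D τ)} (hHK : H ≤ K) {w : ℕ}
    (hH : ∀ a ∈ K, ∀ n : ℤ, ∃ g ∈ H, coeff g n = coeff a n ∧ InWindow g (n - w) (w + 1))
    {a : SkewLaurent D τ} (ha : a ∈ K) {x : ℤ} {N : ℕ} (hx : InWindow a x N) :
    ∃ g ∈ H, InWindow (a - g) x w := by
  induction N generalizing a with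
  | zero =>
    exact ⟨0, H.zero_mem, by rw [hx.eq_zero, sub_zero]; exact fun k h => absurd (coeff_zero k) h⟩
  | succ N ih =>
    by_cases hN : N + 1 ≤ w
    · exact ⟨0, H.zero_mem, fun k hk => by
        rw [sub_zero] at hk
        have := hx k hk
        push_cast at this
        omega⟩
    -- The top term is cancelled. As `w ≤ N`, the corrector is supported in `[x + N - w, x + N]`, so
    -- the lower end `x` is preserved. The formulation with subgroups covers left multiples, right
    -- multiples and central multiples of a divisor alike.
    · obtain ⟨g, hg, hgn, hgw⟩ := hH a ha (x + N)
      obtain ⟨g', hg', h⟩ := ih (a := a - g) (K.sub_mem ha (hHK hg)) fun k hk => by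
        have hne : k ≠ x + N := by
          rintro rfl
          exact hk (by rw [coeff_sub, hgn, sub_self])
        have : coeff a k ≠ 0 ∨ coeff g k ≠ 0 := by
          by_contra! h''
          exact hk (by rw [coeff_sub, h''.1, h''.2, sub_zero])
        rcases this with h1 | h1
        · have := hx k h1
          push_cast at this
          omega
        · have := hgw k h1
          push_cast at this
          omega
      exact ⟨g + g', H.add_mem hg hg', by rwa [← sub_sub]⟩

theorem InWindow.mon_mul {f : SkewLaurent D τ} {x : ℤ} {w : ℕ} (h : InWindow f x w) (i : ℤ) (d : D) :
    InWindow (mon τ i d * f) (x + i) w := fun k hk => by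
  rw [coeff_mon_mul] at hk
  have := h (k - i) fun h' => hk (by rw [h', map_zero, mul_zero])
  omega

theorem InWindow.mul_mon {f : SkewLaurent D τ} {x : ℤ} {w : ℕ} (h : InWindow f x w) (i : ℤ) (d : D) :
    InWindow (f * mon τ i d) (x + i) w := fun k hk => by
  rw [coeff_mul_mon] at hk
  have := h (k - i) fun h' => hk (by rw [h', zero_mul])
  omega

/-- Left division with remainder in a prescribed window. -/
theorem exists_mul_sub_inWindow {b : SkewLaurent D τ} {w : ℕ} (hw : width b = w + 1)
    (a : SkewLaurent D τ) {x : ℤ} {N : ℕ} (hx : InWindow a x N) :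
    ∃ q, InWindow (a - q * b) x w := by
  have hb : b ≠ 0 := by
    rintro rfl
    have : width (0 : SkewLaurent D τ) ≤ 0 :=
      width_le (x := 0) fun k h => absurd (coeff_zero k) h
    omega
  obtain ⟨y, w', hw', hwin, -, htop⟩ := exists_ends hb
  obtain rfl : w = w' := by omega
  obtain ⟨g, ⟨q, rfl⟩, h⟩ := reduce_to_window (K := ⊤) (H := (AddMonoidHom.mulRight b).range) le_top
    (fun a _ n => ⟨_, ⟨mon τ (n - (y + w)) (coeff a n * ((τ ^ (n - (y + w))) (coeff b (y + w)))⁻¹),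
      rfl⟩, by
        simp only [AddMonoidHom.coe_mulRight, coeff_mon_mul]
        rw [show n - (n - (y + w)) = y + w by ring, inv_mul_cancel_right₀]
        simpa using htop, by
        have := hwin.mon_mul (n - (y + w))
          (coeff a n * ((τ ^ (n - (y + w))) (coeff b (y + w)))⁻¹)
        rwa [show y + (n - (y + w)) = n - w by ring] at this⟩) (AddSubgroup.mem_top a) hx
  exact ⟨q, h⟩

theorem exists_width_sub_mul_lt (a b : SkewLaurent D τ) (hb : b ≠ 0) :
    ∃ q, width (a - q * b) < width b := by
  obtain ⟨_, w, hw, -⟩ := exists_ends hb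
  obtain ⟨x, N, hx⟩ := exists_inWindow a
  obtain ⟨q, hq⟩ := exists_mul_sub_inWindow hw a hx
  exact ⟨q, (width_le hq).trans_lt (by omega)⟩

theorem exists_width_sub_mul_lt' (a b : SkewLaurent D τ) (hb : b ≠ 0) :
    ∃ q, width (a - b * q) < width b := by
  obtain ⟨y, w, hw, hwin, -, htop⟩ := exists_ends hb
  obtain ⟨x, N, hx⟩ := exists_inWindow a
  obtain ⟨g, ⟨q, rfl⟩, h⟩ := reduce_to_window (K := ⊤) (H := (AddMonoidHom.mulLeft b).range) le_top
    (fun a _ n => ⟨_, ⟨mon τ (n - (y + w)) ((τ ^ (y + w)).symm ((coeff b (y + w))⁻¹ * coeff a n)),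
      rfl⟩, by
        simp only [AddMonoidHom.coe_mulLeft, coeff_mul_mon]
        rw [show n - (n - (y + w)) = y + w by ring, RingEquiv.apply_symm_apply,
          mul_inv_cancel_left₀ htop], by
        have := hwin.mul_mon (n - (y + w))
          ((τ ^ (y + w)).symm ((coeff b (y + w))⁻¹ * coeff a n))
        rwa [show y + (n - (y + w)) = n - w by ring] at this⟩) (AddSubgroup.mem_top a) hx
  exact ⟨q, (width_le h).trans_lt (by omega)⟩

/-! #### Central elements -/

instance : IsDomain (SkewLaurent D τ) := NoZeroDivisors.to_isDomain _

theorem mem_center_of_commute {f : SkewLaurent D τ} (hC : ∀ d, C τ d * f = f * C τ d)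
    (ht : t τ * f = f * t τ) : f ∈ Subring.center (SkewLaurent D τ) := by
  rw [Subring.mem_center_iff]
  intro g
  have hn : ∀ n : ℤ, Commute (mon τ n 1) f := by
    intro n
    have hu : IsUnit (t τ) := isUnit_mon 1 one_ne_zero
    obtain ⟨u, hu⟩ := hu
    have h1 : ∀ n : ℤ, mon τ n 1 = ((u ^ n : (SkewLaurent D τ)ˣ) : SkewLaurent D τ) := by
      intro n
      induction n using Int.induction_on with
      | zero => simp [one_eq_mon]
      | succ i ih => rw [zpow_add_one, Units.val_mul, ← ih, hu, t_eq_mon, mon_mul_mon]; simp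
      | pred i ih =>
        rw [zpow_sub_one, Units.val_mul, ← ih, Units.eq_mul_inv_iff_mul_eq, hu, t_eq_mon,
          mon_mul_mon]
        simp
    rw [h1]
    have : Commute (u : SkewLaurent D τ) f := by rw [hu]; exact ht
    exact this.units_zpow_left n
  refine eq_sum_mon g (P := fun g => g * f = f * g) (by simp) (fun n d => ?_)
    fun g g' hg hg' => by rw [add_mul, mul_add, hg, hg']
  have := (show Commute (C τ d) f from hC d).mul_left (hn n)
  rw [C_mul_mon, mul_one] at this
  exact this

theorem mem_center_of_mul {q b : SkewLaurent D τ} (hb : b ∈ Subring.center (SkewLaurent D τ))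
    (hb0 : b ≠ 0) (hqb : q * b ∈ Subring.center (SkewLaurent D τ)) :
    q ∈ Subring.center (SkewLaurent D τ) := by
  rw [Subring.mem_center_iff] at *
  intro g
  refine mul_right_cancel₀ hb0 ?_
  rw [mul_assoc, hqb, mul_assoc, mul_assoc, hb]

/-- The homogeneous components of a central element are central. -/
theorem mon_coeff_mem_center {f : SkewLaurent D τ} (hf : f ∈ Subring.center (SkewLaurent D τ))
    (n : ℤ) : mon τ n (coeff f n) ∈ Subring.center (SkewLaurent D τ) := by
  rw [Subring.mem_center_iff] at hf
  refine mem_center_of_commute (fun d => ?_) ?_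
  · have h := congrArg (fun f => coeff f n) (hf (C τ d))
    simp only [C_eq_mon, coeff_mon_mul, coeff_mul_mon, sub_zero, zpow_zero] at h
    rw [C_eq_mon, mon_mul_mon, mon_mul_mon]
    simp only [zero_add, add_zero, zpow_zero]
    exact congrArg _ h
  · have h := congrArg (fun f => coeff f (n + 1)) (hf (t τ))
    simp only [t_eq_mon, coeff_mon_mul, coeff_mul_mon, add_sub_cancel_right] at h
    rw [t_eq_mon, mon_mul_mon, mon_mul_mon, add_comm n 1, h]

/-- Division does not leave the centre: the top terms of central elements are central monomials, and
so is their quotient. The centre is thus Euclidean for `width`. -/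
theorem exists_center_width_sub_mul_lt {a b : SkewLaurent D τ}
    (ha : a ∈ Subring.center (SkewLaurent D τ)) (hb : b ∈ Subring.center (SkewLaurent D τ))
    (hb0 : b ≠ 0) : ∃ q ∈ Subring.center (SkewLaurent D τ), width (a - q * b) < width b := by
  obtain ⟨y, w, hw, hwin, -, htop⟩ := exists_ends hb0
  obtain ⟨x, N, hx⟩ := exists_inWindow a
  let Z := (Subring.center (SkewLaurent D τ)).toAddSubgroup
  obtain ⟨g, ⟨q, hq, rfl⟩, h⟩ := reduce_to_window (K := Z) (H := Z.map (AddMonoidHom.mulRight b))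
    (fun _ ⟨q, hq, e⟩ => e ▸ (Subring.center _).mul_mem hq hb)
    (fun a ha n => ⟨_, ⟨mon τ (n - (y + w)) (coeff a n * ((τ ^ (n - (y + w))) (coeff b (y + w)))⁻¹),
      by
        refine mem_center_of_mul (b := mon τ (y + w) (coeff b (y + w))) (mon_coeff_mem_center hb _)
          (isUnit_mon _ htop).ne_zero ?_
        rw [mon_mul_mon, sub_add_cancel, inv_mul_cancel_right₀ (by simpa using htop)]
        exact mon_coeff_mem_center ha _, rfl⟩, by
        simp only [AddMonoidHom.coe_mulRight, coeff_mon_mul]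
        rw [show n - (n - (y + w)) = y + w by ring, inv_mul_cancel_right₀]
        simpa using htop, by
        have := hwin.mon_mul (n - (y + w))
          (coeff a n * ((τ ^ (n - (y + w))) (coeff b (y + w)))⁻¹)
        rwa [show y + (n - (y + w)) = n - w by ring] at this⟩) ha hx
  exact ⟨q, hq, (width_le h).trans_lt (by omega)⟩

/-- Every two-sided ideal is generated by a central element. -/
theorem exists_central_generator (I : Ideal (SkewLaurent D τ)) (hI : I.IsTwoSided) :
    ∃ p ∈ Subring.center (SkewLaurent D τ), I = Ideal.span {p} := by
  classical
  by_cases hbot : I = ⊥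
  · exact ⟨0, Subring.zero_mem _, by rw [hbot]; simp⟩
  have hex : ∃ w, ∃ f ∈ I, f ≠ 0 ∧ width f = w := by
    obtain ⟨f, hf, hf0⟩ := Submodule.exists_mem_ne_zero_of_ne_bot hbot
    exact ⟨_, f, hf, hf0, rfl⟩
  obtain ⟨g, hgI, hg0, hgw⟩ := Nat.find_spec hex
  have hmin : ∀ f ∈ I, width f < Nat.find hex → f = 0 := fun f hf hw => by
    by_contra hf0
    exact Nat.find_min hex hw ⟨f, hf, hf0, rfl⟩
  obtain ⟨x, w, hw, hwin, hlow, -⟩ := exists_ends hg0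
  rw [← hgw, hw] at hmin
  -- An element of least width, normalized to have lowest term `1`. Commutators with `C τ d` and
  -- with `t τ` stay in the ideal and lose the lowest term, so they are shorter and must vanish;
  -- hence `f` is central.
  let f := mon τ (-x) ((τ ^ (-x)) (coeff g x))⁻¹ * g
  have hlow' : (τ ^ (-x)) (coeff g x) ≠ 0 := by
    simpa using hlow
  have hfI : f ∈ I := I.mul_mem_left _ hgI
  have hf1 : coeff f 0 = 1 := by
    simp only [f, coeff_mon_mul]
    rw [zero_sub, neg_neg, inv_mul_cancel₀ hlow']
  have hfwin : InWindow f 0 (w + 1) := by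
    have := hwin.mon_mul (-x) ((τ ^ (-x)) (coeff g x))⁻¹
    rwa [add_neg_cancel] at this
  have hf0 : f ≠ 0 := fun h => by rw [h] at hf1; exact zero_ne_one hf1
  refine ⟨f, mem_center_of_commute (fun d => ?_) ?_, le_antisymm (fun a ha => ?_) ?_⟩
  · refine sub_eq_zero.1 (hmin _ (I.sub_mem (I.mul_mem_left _ hfI) (I.mul_mem_right _ hfI)) ?_)
    refine Nat.lt_succ_of_le (width_le (x := 1) fun k hk => ?_)
    have hk0 : coeff f k ≠ 0 := fun h => hk (by
      simp [C_eq_mon, coeff_mon_mul, coeff_mul_mon, h])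
    have hk1 : k ≠ 0 := by
      rintro rfl
      exact hk (by simp [C_eq_mon, coeff_mon_mul, coeff_mul_mon, hf1])
    have := hfwin k hk0
    push_cast at this
    omega
  · refine sub_eq_zero.1 (hmin _ (I.sub_mem (I.mul_mem_left _ hfI) (I.mul_mem_right _ hfI)) ?_)
    -- Both `t f` and `f t` have lowest term `t`, so their difference starts at exponent `2`.
    refine Nat.lt_succ_of_le (width_le (x := 2) fun k hk => ?_)
    have hk0 : coeff f (k - 1) ≠ 0 := fun h => hk (by
      simp [t_eq_mon, coeff_mon_mul, coeff_mul_mon, h])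
    have hk1 : k ≠ 1 := by
      rintro rfl
      exact hk (by simp [t_eq_mon, coeff_mon_mul, coeff_mul_mon, hf1])
    have := hfwin _ hk0
    push_cast at this
    omega
  · obtain ⟨q, hq⟩ := exists_width_sub_mul_lt a f hf0
    have hfw := width_le hfwin
    rw [Ideal.mem_span_singleton']
    exact ⟨q, (sub_eq_zero.1 (hmin _ (I.sub_mem ha (I.mul_mem_left _ hfI)) (by omega))).symm⟩
  · rw [Ideal.span_le]
    exact Set.singleton_subset_iff.2 hfI

/-- Every left ideal is principal. -/
theorem exists_left_generator (I : Ideal (SkewLaurent D τ)) : ∃ g, I = Ideal.span {g} := by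
  classical
  by_cases hbot : I = ⊥
  · exact ⟨0, by rw [hbot]; simp⟩
  have hex : ∃ w, ∃ f ∈ I, f ≠ 0 ∧ width f = w := by
    obtain ⟨f, hf, hf0⟩ := Submodule.exists_mem_ne_zero_of_ne_bot hbot
    exact ⟨_, f, hf, hf0, rfl⟩
  obtain ⟨g, hgI, hg0, hgw⟩ := Nat.find_spec hex
  refine ⟨g, le_antisymm (fun a ha => ?_) ?_⟩
  · obtain ⟨q, hq⟩ := exists_width_sub_mul_lt a g hg0
    rw [Ideal.mem_span_singleton']
    refine ⟨q, (sub_eq_zero.1 ?_).symm⟩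
    by_contra hf0
    rw [hgw] at hq
    exact Nat.find_min hex hq ⟨_, I.sub_mem ha (I.mul_mem_left _ hgI), hf0, rfl⟩
  · rw [Ideal.span_le]
    exact Set.singleton_subset_iff.2 hgI

end SkewLaurent

/-! ### Ideals of skew Laurent polynomial rings and of their centres -/

namespace SkewLaurent

variable {D : Type u} [DivisionRing D] {τ : D ≃+* D}

/-- If `τ` has finite inner order, some power of `τ` is inner by an element fixed by `τ`. -/
theorem exists_fixed_inner (hτ : HasFiniteInnerOrder τ) :
    ∃ M : ℕ, 0 < M ∧ ∃ b : D, b ≠ 0 ∧ τ b = b ∧ ∀ d : D, (τ ^ M) d = b⁻¹ * d * b := by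
  obtain ⟨m, hm, a, ha, h⟩ := hτ
  have hpow : ∀ (k : ℕ) (d : D), (τ ^ (k + 1)) d = (τ ^ k) (τ d) := fun k d => by
    rw [pow_succ]; rfl
  have hpow' : ∀ (k : ℕ) (d : D), (τ ^ (k + 1)) d = τ ((τ ^ k) d) := fun k d => by
    rw [pow_succ']; rfl
  -- `τ ^ i` commutes with `τ ^ m`, so `a` and `τ ^ i a` induce the same inner automorphism and
  -- differ by a central factor.
  have hcent : ∀ i : ℕ, ∃ c ∈ Subring.center D, (τ ^ i) a = c * a := by
    intro i
    induction i with
    | zero => exact ⟨1, Subring.one_mem _, by simp⟩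
    | succ i ih =>
      refine ⟨(τ ^ (i + 1)) a * a⁻¹, ?_, by rw [inv_mul_cancel_right₀ ha]⟩
      rw [Subring.mem_center_iff]
      intro d
      obtain ⟨d', rfl⟩ := (τ ^ (i + 1)).surjective d
      have h1 : (τ ^ (i + 1)) ((τ ^ m) d') = (τ ^ m) ((τ ^ (i + 1)) d') := by
        change (τ ^ (i + 1) * τ ^ m) d' = (τ ^ m * τ ^ (i + 1)) d'
        rw [← pow_add, ← pow_add, add_comm]
      rw [h, h, map_mul, map_mul, map_inv₀] at h1
      set x := (τ ^ (i + 1)) a with hx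
      set y := (τ ^ (i + 1)) d'
      have hx0 : x ≠ 0 := (map_ne_zero_iff _ (τ ^ (i + 1)).injective).2 ha
      calc y * (x * a⁻¹) = x * (x⁻¹ * y * x) * a⁻¹ := by
            simp only [mul_assoc]; rw [mul_inv_cancel_left₀ hx0]
        _ = x * a⁻¹ * y := by
            rw [h1]; simp only [mul_assoc]; rw [mul_inv_cancel₀ ha, mul_one]
  -- The twisted norm `b n = a · τ a ⋯ τ ^ (n - 1) a`, which satisfies `a · τ (b n) = b (n + 1)`.
  -- Each `b n` is a central multiple of `a ^ n`. Since `τ ^ m` fixes `a`, one gets `a · τ (b m) = b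
  -- m · a = a · b m`, so `b m` is fixed by `τ`; it induces `τ ^ (m * m)`, as `a ^ m` does.
  let b : ℕ → D := fun n => Nat.rec 1 (fun k x => x * (τ ^ k) a) n
  have hb : ∀ k, b (k + 1) = b k * (τ ^ k) a := fun k => rfl
  have hbc : ∀ n, ∃ c ∈ Subring.center D, b n = c * a ^ n := by
    intro n
    induction n with
    | zero => exact ⟨1, Subring.one_mem _, by simp [b]⟩
    | succ n ih =>
      obtain ⟨c, hc, hcn⟩ := ih
      obtain ⟨c', hc', hcn'⟩ := hcent n
      refine ⟨c * c', Subring.mul_mem _ hc hc', ?_⟩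
      rw [hb, hcn, hcn', pow_succ, mul_assoc, mul_assoc, ← mul_assoc (a ^ n),
        Subring.mem_center_iff.1 hc' (a ^ n), mul_assoc]
  have hb0 : ∀ n, b n ≠ 0 := by
    intro n
    induction n with
    | zero => exact one_ne_zero
    | succ n ih => rw [hb]; exact mul_ne_zero ih ((map_ne_zero_iff _ (τ ^ n).injective).2 ha)
  have hab : ∀ n, a * τ (b n) = b (n + 1) := by
    intro n
    induction n with
    | zero => simp [b]
    | succ n ih =>
      have h1 := hb (n + 1)
      rw [← ih] at h1
      rw [h1, hb n, map_mul, ← hpow', mul_assoc]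
  obtain ⟨c, hc, hcm⟩ := hbc m
  refine ⟨m * m, Nat.mul_pos hm hm, b m, hb0 m, mul_left_cancel₀ ha ?_, fun d => ?_⟩
  · rw [hab, hb, h, inv_mul_cancel₀ ha, one_mul, hcm, mul_assoc, ← pow_succ, pow_succ', ← mul_assoc,
      ← mul_assoc, Subring.mem_center_iff.1 hc a]
  · have h2 : ∀ k : ℕ, (τ ^ (m * k)) d = (a ^ k)⁻¹ * d * a ^ k := by
      intro k
      induction k with
      | zero => simp
      | succ k ih =>
        rw [mul_add, mul_one, add_comm, pow_add]
        change (τ ^ m) ((τ ^ (m * k)) d) = _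
        rw [ih, h, pow_succ, mul_inv_rev]
        simp only [mul_assoc]
    have hc0 : c ≠ 0 := by rintro rfl; exact hb0 m (by rw [hcm, zero_mul])
    have h3 : d * (c * a ^ m) = c * (d * a ^ m) := by
      rw [← mul_assoc, Subring.mem_center_iff.1 hc d, mul_assoc]
    rw [h2, hcm, mul_inv_rev]
    simp only [mul_assoc]
    rw [h3, inv_mul_cancel_left₀ hc0]

/-- If `τ` has finite inner order, there is a central element which is neither zero nor
invertible. -/
theorem exists_central_proper (hτ : HasFiniteInnerOrder τ) :
    ∃ c ∈ Subring.center (SkewLaurent D τ), c ≠ 0 ∧ ∀ x, x * c ≠ 1 := by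
  obtain ⟨M, hM, b, hb, hτb, h⟩ := exists_fixed_inner hτ
  have hz : mon τ M b ∈ Subring.center (SkewLaurent D τ) := by
    refine mem_center_of_commute (fun d => ?_) ?_
    · rw [C_eq_mon, mon_mul_mon, mon_mul_mon]
      simp only [zero_add, add_zero, zpow_zero, zpow_natCast]
      rw [h, ← mul_assoc, ← mul_assoc, mul_inv_cancel₀ hb, one_mul]
      rfl
    · rw [t_eq_mon, mon_mul_mon, mon_mul_mon]
      simp [hτb, add_comm]
  -- In `x (b t ^ M - 1)` the lowest term of `x` survives at exponent `l`, and its highest term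
  -- produces a term at `l + w + M`. These exponents differ because `M > 0`, so the product is not
  -- `1`.
  refine ⟨mon τ M b - 1, Subring.sub_mem _ hz (Subring.one_mem _), fun h0 => ?_, fun x hx => ?_⟩
  · have := congrArg (fun f => coeff f M) h0
    simp only [one_eq_mon, coeff_sub, coeff_mon, coeff_zero] at this
    rw [if_pos trivial, if_neg (by omega), sub_zero] at this
    exact hb this
  · have hx0 : x ≠ 0 := by rintro rfl; rw [zero_mul] at hx; exact zero_ne_one hx
    obtain ⟨l, w, -, hwin, hlow, htop⟩ := exists_ends hx0
    have hout : ∀ k, (k < l ∨ l + w < k) → coeff x k = 0 := fun k hk => by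
      by_contra h'
      have := hwin k h'
      push_cast at this
      omega
    have hk := fun k => congrArg (fun f => coeff f k) hx
    simp only [mul_sub, coeff_sub, coeff_mul_mon, one_eq_mon, coeff_mon, map_one, sub_zero,
      mul_one] at hk
    have h1 := hk l
    rw [hout (l - M) (by omega), zero_mul, zero_sub] at h1
    have hl : l = 0 := by
      by_contra hl
      rw [if_neg hl, neg_eq_zero] at h1
      exact hlow h1
    have h2 := hk (l + w + M)
    rw [add_sub_cancel_right, hout (l + w + M) (by omega), sub_zero, if_neg (by omega)] at h2
    rcases mul_eq_zero.1 h2 with h3 | h3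
    · exact htop h3
    · exact hb (by simpa using h3)

section ring

theorem span_singleton_eq_top_of_isUnit {R : Type u} [Ring R] {a : R} (ha : IsUnit a) :
    Ideal.span {a} = ⊤ :=
  Ideal.eq_top_of_isUnit_mem _ (Ideal.mem_span_singleton_self a) ha

variable {R : Type u} [Ring R]

theorem isTwoSided_span_of_mem_center {p : R} (hp : p ∈ Subring.center R) :
    (Ideal.span {p}).IsTwoSided := ⟨fun b ha => by
  obtain ⟨x, rfl⟩ := Ideal.mem_span_singleton'.1 ha
  exact Ideal.mem_span_singleton'.2 ⟨x * b, by
    rw [mul_assoc, mul_assoc, Subring.mem_center_iff.1 hp]⟩⟩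

end ring

/-- The place where finite inner order matters: it provides a non-zero proper ideal generated by a
central element, so the zero ideal is not maximal. -/
theorem MaxTwoSided.ne_bot (hτ : HasFiniteInnerOrder τ) (𝔪 : MaxTwoSided (SkewLaurent D τ)) :
    𝔪.1 ≠ ⊥ := by
  intro h
  obtain ⟨c, hc, hc0, hcx⟩ := exists_central_proper hτ
  have := 𝔪.2.eq_top_of_lt (Ideal.span {c}) (isTwoSided_span_of_mem_center hc) (by
    rw [h, bot_lt_iff_ne_bot, ne_eq, Ideal.span_singleton_eq_bot]
    exact hc0)
  obtain ⟨x, hx⟩ := Ideal.mem_span_singleton'.1 (this ▸ Submodule.mem_top (x := 1))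
  exact hcx x hx

theorem isUnit_center_of_mul_eq_one {z : Subring.center (SkewLaurent D τ)} {x : SkewLaurent D τ}
    (h : x * z = 1) : IsUnit z := by
  have hz0 : (z : SkewLaurent D τ) ≠ 0 := by
    intro h0; rw [h0, mul_zero] at h; exact zero_ne_one h
  have hx : x ∈ Subring.center (SkewLaurent D τ) :=
    mem_center_of_mul z.2 hz0 (h ▸ Subring.one_mem _)
  exact IsUnit.of_mul_eq_one_right ⟨x, hx⟩ (Subtype.ext h)

/-- The prime elements of the centre are the generators of the maximal two-sided ideals. -/
theorem isMaximalTwoSided_span_iff {p : Subring.center (SkewLaurent D τ)} (hp0 : p ≠ 0) :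
    IsMaximalTwoSided (Ideal.span {(p : SkewLaurent D τ)}) ↔ Irreducible p := by
  have hp0' : (p : SkewLaurent D τ) ≠ 0 := fun h => hp0 (Subtype.ext h)
  constructor
  · intro hmax
    refine ⟨fun hu => hmax.ne_top ?_, fun a b hab => ?_⟩
    · exact span_singleton_eq_top_of_isUnit (hu.map (Subring.center _).subtype)
    · have hab' : (p : SkewLaurent D τ) = a * b := by rw [hab]; rfl
      have hle : Ideal.span {(p : SkewLaurent D τ)} ≤ Ideal.span {(a : SkewLaurent D τ)} := by
        rw [Ideal.span_le, Set.singleton_subset_iff]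
        exact Ideal.mem_span_singleton'.2 ⟨b, by
          rw [hab', Subring.mem_center_iff.1 a.2]⟩
      rcases hle.eq_or_lt with h | h
      · right
        obtain ⟨y, hy⟩ := Ideal.mem_span_singleton'.1 (h ▸ Ideal.mem_span_singleton_self
          (a : SkewLaurent D τ))
        refine isUnit_center_of_mul_eq_one (x := y) ?_
        have ha0 : (a : SkewLaurent D τ) ≠ 0 := by
          intro h0; rw [h0, zero_mul] at hab'; exact hp0' hab'
        refine mul_right_cancel₀ ha0 ?_
        rw [one_mul, mul_assoc, ← Subring.mem_center_iff.1 b.2, ← hab', hy]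
      · left
        have := hmax.eq_top_of_lt _ (isTwoSided_span_of_mem_center a.2) h
        obtain ⟨x, hx⟩ := Ideal.mem_span_singleton'.1 (this ▸ Submodule.mem_top (x := 1))
        exact isUnit_center_of_mul_eq_one hx
  · intro hp
    refine ⟨isTwoSided_span_of_mem_center p.2, fun h => hp.not_isUnit ?_, fun J hJ hlt => ?_⟩
    · obtain ⟨x, hx⟩ := Ideal.mem_span_singleton'.1 (h ▸ Submodule.mem_top (x := 1))
      exact isUnit_center_of_mul_eq_one hx
    · obtain ⟨q, hq, rfl⟩ := exists_central_generator J hJ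
      obtain ⟨x, hx⟩ := Ideal.mem_span_singleton'.1 (hlt.le (Ideal.mem_span_singleton_self _))
      have hq0 : q ≠ 0 := by rintro rfl; rw [mul_zero] at hx; exact hp0' hx.symm
      have hxc := mem_center_of_mul hq hq0 (hx ▸ p.2)
      rcases hp.isUnit_or_isUnit (a := ⟨x, hxc⟩) (b := ⟨q, hq⟩) (Subtype.ext hx.symm) with h | h
      · refine absurd ?_ hlt.not_ge
        rw [Ideal.span_le, Set.singleton_subset_iff]
        obtain ⟨u, hu⟩ := h.map (Subring.center _).subtype
        refine Ideal.mem_span_singleton'.2 ⟨(u⁻¹).1, ?_⟩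
        rw [← hx]
        change (u⁻¹).1 * ((Subring.center (SkewLaurent D τ)).subtype ⟨x, hxc⟩ * q) = q
        rw [← hu, Units.inv_mul_cancel_left]
      · exact span_singleton_eq_top_of_isUnit (h.map (Subring.center _).subtype)

instance : IsPrincipalIdealRing (Subring.center (SkewLaurent D τ)) where
  principal I := by
    classical
    by_cases hbot : I = ⊥
    · exact ⟨0, by rw [hbot]; simp⟩
    have hex : ∃ w, ∃ f ∈ I, f ≠ 0 ∧ width f.1 = w := by
      obtain ⟨f, hf, hf0⟩ := Submodule.exists_mem_ne_zero_of_ne_bot hbot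
      exact ⟨_, f, hf, hf0, rfl⟩
    obtain ⟨g, hgI, hg0, hgw⟩ := Nat.find_spec hex
    refine ⟨g, le_antisymm (fun a ha => ?_) ?_⟩
    · obtain ⟨q, hqc, hq⟩ := exists_center_width_sub_mul_lt a.2 g.2 fun h => hg0 (Subtype.ext h)
      refine Ideal.mem_span_singleton'.2 ⟨⟨q, hqc⟩, (sub_eq_zero.1 ?_).symm⟩
      by_contra hf0
      rw [hgw] at hq
      exact Nat.find_min hex hq ⟨_, I.sub_mem ha (I.mul_mem_left ⟨q, hqc⟩ hgI), hf0, rfl⟩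
    · exact (Submodule.span_singleton_le_iff_mem g I).2 hgI

instance : IsPrincipalIdealRing (SkewLaurent D τ) where
  principal I := ⟨exists_left_generator I⟩

theorem exists_center_irreducible (hτ : HasFiniteInnerOrder τ)
    (𝔪 : MaxTwoSided (SkewLaurent D τ)) : ∃ p : Subring.center (SkewLaurent D τ),
      Irreducible p ∧ 𝔪.1 = Ideal.span {(p : SkewLaurent D τ)} := by
  obtain ⟨p, hp, h⟩ := exists_central_generator 𝔪.1 𝔪.2.isTwoSided
  refine ⟨⟨p, hp⟩, (isMaximalTwoSided_span_iff ?_).1 (h ▸ 𝔪.2), h⟩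
  intro h0
  have : p = 0 := congrArg Subtype.val h0
  exact MaxTwoSided.ne_bot hτ 𝔪 (by rw [h, this]; simp)

/-! #### Finiteness over the coefficient ring -/

theorem InWindow.eq_sum {f : SkewLaurent D τ} {w : ℕ} (h : InWindow f 0 w) :
    f = ∑ i : Fin w, C τ (coeff f i) * mon τ i 1 := by
  refine ext_coeff fun n => ?_
  have hsum : ∀ s : Finset (Fin w), coeff (∑ i ∈ s, C τ (coeff f i) * mon τ i 1) n =
      ∑ i ∈ s, coeff (C τ (coeff f i) * mon τ i 1) n := by
    intro s
    exact map_sum (⟨⟨fun f => coeff f n, coeff_zero n⟩, fun f g => coeff_add f g n⟩ :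
      SkewLaurent D τ →+ D) _ _
  rw [hsum]
  simp only [C_mul_mon, mul_one, coeff_mon]
  by_cases hn : coeff f n = 0
  · rw [hn]
    refine (Finset.sum_eq_zero fun i _ => ?_).symm
    split_ifs with h'
    · rw [← h', hn]
    · rfl
  · have := h n hn
    lift n to ℕ using this.1
    rw [Finset.sum_eq_single ⟨n, by omega⟩]
    · simp
    · intro i _ hi
      refine if_neg fun h' => hi (Fin.ext ?_)
      simpa using h'.symm
    · simp

/-- `exists_mul_sub_inWindow` shortens the support from above. Here the lowest coefficient of `b` is
used to raise the lower end to `0`, at the cost of the upper end; the two together bring every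
element into one fixed window modulo `R b`. -/
theorem exists_mul_sub_inWindow_zero {b : SkewLaurent D τ} (hb : b ≠ 0) (n : ℕ)
    (a : SkewLaurent D τ) {N : ℕ} (hx : InWindow a (-n) N) :
    ∃ q N', InWindow (a - q * b) 0 N' := by
  obtain ⟨y, w, -, hwin, hlow, -⟩ := exists_ends hb
  induction n generalizing a N with
  | zero => exact ⟨0, N, by simpa using hx⟩
  | succ n ih =>
    let i : ℤ := -((n + 1 : ℕ) : ℤ) - y
    let q := mon τ i (coeff a (-((n + 1 : ℕ) : ℤ)) * ((τ ^ i) (coeff b y))⁻¹)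
    have hq : coeff (q * b) (-((n + 1 : ℕ) : ℤ)) = coeff a (-((n + 1 : ℕ) : ℤ)) := by
      simp only [q, coeff_mon_mul]
      rw [show -((n + 1 : ℕ) : ℤ) - i = y by simp [i], inv_mul_cancel_right₀]
      exact (map_ne_zero_iff _ (τ ^ i).injective).2 hlow
    have hqw : InWindow (q * b) (y + i) (w + 1) := hwin.mon_mul _ _
    obtain ⟨q', N', h⟩ := ih (a - q * b) (N := N + w + 1) fun k hk => by
      have hne : k ≠ -((n + 1 : ℕ) : ℤ) := by
        rintro rfl
        exact hk (by rw [coeff_sub, hq, sub_self])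
      have : coeff a k ≠ 0 ∨ coeff (q * b) k ≠ 0 := by
        by_contra! h''
        exact hk (by rw [coeff_sub, h''.1, h''.2, sub_zero])
      rcases this with h1 | h1
      · have := hx k h1
        push_cast at this hne ⊢
        omega
      · have := hqw k h1
        simp only [i] at this
        push_cast at this hne ⊢
        omega
    exact ⟨q + q', N', by rwa [add_mul, ← sub_sub]⟩

/-- Modulo a left ideal containing a non-zero element, the ring is finite over `D`. -/
theorem exists_finite_spanning {e : SkewLaurent D τ} (he : e ≠ 0) :
    ∃ w : ℕ, ∀ a, ∃ (d : Fin w → D) (q : SkewLaurent D τ),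
      a = (∑ i : Fin w, C τ (d i) * mon τ i 1) + q * e := by
  obtain ⟨_, w, hw, -⟩ := exists_ends he
  refine ⟨w, fun a => ?_⟩
  obtain ⟨x, N, hx⟩ := exists_inWindow a
  have hy : InWindow a (-x.natAbs) (x.natAbs + (x.natAbs + N)) := fun k hk => by
    have := hx k hk
    omega
  obtain ⟨q, N', hq⟩ := exists_mul_sub_inWindow_zero he _ a hy
  obtain ⟨q', hq'⟩ := exists_mul_sub_inWindow hw _ hq
  refine ⟨fun i => coeff (a - q * e - q' * e) i, q + q', ?_⟩
  rw [← hq'.eq_sum, add_mul]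
  abel

end SkewLaurent

/-! ### Rank functions are determined by prime powers of the centre -/

theorem eq_of_elemRank_eq {R : Type u} [Ring R] {N : R → ℕ}
    (hl : ∀ a b : R, b ≠ 0 → ∃ q, N (a - q * b) < N b)
    (hr : ∀ a b : R, b ≠ 0 → ∃ q, N (a - b * q) < N b) {rk rk' : MatFun R}
    (h : IsSylvesterRank rk) (h' : IsSylvesterRank rk')
    (heq : ∀ a, elemRank rk a = elemRank rk' a) : rk = rk' := by
  funext m n M
  refine euclid_matrix_induction hl hr (P := fun m n M => rk m n M = rk' m n M) (fun m n => ?_)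
    (fun m n a M ih => ?_) (fun m n U M V hU hV ih => ?_) m n M
  · rw [h.map_zero, h'.map_zero]
  · rw [h.map_diag, h'.map_diag, ih]
    congr 1
    exact heq a
  · rwa [← h.gen_fin, ← h'.gen_fin, h.gen_mul_isUnit hV, h.gen_isUnit_mul hU,
      h'.gen_mul_isUnit hV, h'.gen_isUnit_mul hU, h.gen_fin, h'.gen_fin] at ih

/-- Stated for bare functions because it is applied both to values of rank functions and to the rank
of a column `(c, e)` as a function of `c`. -/
theorem elemRank_eq_of_prime_pow {A : Type u} [CommRing A] [IsDomain A] [IsPrincipalIdealRing A]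
    {f g : A → ℝ} (hu : ∀ u, IsUnit u → f u = g u)
    (hf : ∀ a b, IsCoprime a b → f a + f b = f (a * b) + 1)
    (hg : ∀ a b, IsCoprime a b → g a + g b = g (a * b) + 1)
    (heq : ∀ p, Irreducible p → ∀ i : ℕ, f (p ^ i) = g (p ^ i)) {a : A} (ha : a ≠ 0) :
    f a = g a := by
  refine UniqueFactorizationMonoid.induction_on_coprime (P := fun a => a ≠ 0 → f a = g a) a
    (fun h => absurd rfl h) (fun h _ => hu _ h) (fun i hp _ => heq _ hp.irreducible i)
    (fun {x y} hxy hx hy hne => ?_) ha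
  have hcop : IsCoprime x y := hxy.isCoprime
  have h1 := hf x y hcop
  rw [hx (left_ne_zero_of_mul hne), hy (right_ne_zero_of_mul hne), hg x y hcop] at h1
  linarith

namespace SkewLaurent

variable {D : Type u} [DivisionRing D] {τ : D ≃+* D}

theorem eq_of_elemRank_pow_eq_center {rk rk' : MatFun (Subring.center (SkewLaurent D τ))}
    (h : IsSylvesterRank rk) (h' : IsSylvesterRank rk')
    (heq : ∀ p, Irreducible p → ∀ i : ℕ, elemRank rk (p ^ i) = elemRank rk' (p ^ i)) :
    rk = rk' := by
  have hl : ∀ a b : Subring.center (SkewLaurent D τ), b ≠ 0 → ∃ q,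
      width (a - q * b : Subring.center (SkewLaurent D τ)).1 < width b.1 := fun a b hb => by
    obtain ⟨q, hq, h⟩ := exists_center_width_sub_mul_lt a.2 b.2 fun h => hb (Subtype.ext h)
    exact ⟨⟨q, hq⟩, h⟩
  refine eq_of_elemRank_eq (N := fun z => width z.1) hl (fun a b hb => ?_) h h' fun a => ?_
  · obtain ⟨q, hq⟩ := hl a b hb
    exact ⟨q, by rwa [mul_comm] at hq⟩
  · by_cases ha : a = 0
    · rw [ha, h.elem_zero, h'.elem_zero]
    · exact elemRank_eq_of_prime_pow (fun u hu => by rw [h.elem_isUnit hu, h'.elem_isUnit hu])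
        (fun a b => h.elem_add_of_isCoprime) (fun a b => h'.elem_add_of_isCoprime) heq ha

end SkewLaurent

/-! ### Finite length and simplicity of quotients. -/

theorem isArtinian_isNoetherian_of_spanning {D S M : Type*} [DivisionRing D] [Ring S]
    [AddCommGroup M] [Module S M] (f : D →+* S) {w : ℕ} (v : Fin w → M)
    (hv : ∀ x, ∃ d : Fin w → D, x = ∑ i, f (d i) • v i) : IsArtinian S M ∧ IsNoetherian S M := by
  let _ := Module.compHom M f
  let _ := Module.compHom S f
  have : IsScalarTower D S M := ⟨fun d s m => mul_smul (f d) s m⟩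
  have : Module.Finite D M := Module.Finite.of_surjective (Fintype.linearCombination D v)
    fun x => by
      obtain ⟨d, hd⟩ := hv x
      exact ⟨d, by rw [Fintype.linearCombination_apply, hd]; rfl⟩
  exact ⟨isArtinian_of_tower D inferInstance, isNoetherian_of_tower D inferInstance⟩

namespace SkewLaurent

variable {D : Type u} [DivisionRing D] {τ : D ≃+* D}

theorem isArtinian_isNoetherian_quotient {e : SkewLaurent D τ} (he : e ≠ 0) :
    IsArtinian (SkewLaurent D τ) (SkewLaurent D τ ⧸ Ideal.span {e}) ∧
      IsNoetherian (SkewLaurent D τ) (SkewLaurent D τ ⧸ Ideal.span {e}) := by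
  obtain ⟨w, hw⟩ := exists_finite_spanning he
  refine isArtinian_isNoetherian_of_spanning (C τ)
    (fun i : Fin w => Submodule.Quotient.mk (mon τ i 1)) fun x => ?_
  obtain ⟨a, rfl⟩ := Submodule.Quotient.mk_surjective _ x
  obtain ⟨d, q, h⟩ := hw a
  refine ⟨d, ?_⟩
  simp only [← Submodule.Quotient.mk_smul]
  rw [← Submodule.mkQ_apply]
  simp only [← Submodule.mkQ_apply]
  rw [← map_sum, ← sub_eq_zero, ← map_sub, Submodule.mkQ_apply, Submodule.Quotient.mk_eq_zero]
  exact Ideal.mem_span_singleton'.2 ⟨q, by conv_rhs => rw [h]; simp [smul_eq_mul]⟩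

theorem isArtinianRing_quotient {I : Ideal (SkewLaurent D τ)} [I.IsTwoSided]
    {e : SkewLaurent D τ} (he : e ≠ 0) (hI : e ∈ I) : IsArtinianRing (SkewLaurent D τ ⧸ I) := by
  obtain ⟨w, hw⟩ := exists_finite_spanning he
  refine (isArtinian_isNoetherian_of_spanning ((Ideal.Quotient.mk I).comp (C τ))
    (fun i : Fin w => Ideal.Quotient.mk I (mon τ i 1)) fun x => ?_).1
  obtain ⟨a, rfl⟩ := Ideal.Quotient.mk_surjective x
  obtain ⟨d, q, h⟩ := hw a
  refine ⟨d, ?_⟩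
  conv_lhs => rw [h]
  rw [map_add, map_sum, Ideal.Quotient.eq_zero_iff_mem.2 (I.mul_mem_left q hI), add_zero]
  simp

theorem isSimpleRing_quotient {R : Type u} [Ring R] {I : Ideal R} [I.IsTwoSided]
    (hI : IsMaximalTwoSided I) : IsSimpleRing (R ⧸ I) := by
  have : Nontrivial (R ⧸ I) := Ideal.Quotient.nontrivial_iff.2 hI.ne_top
  refine ⟨⟨fun J => ?_⟩⟩
  let K : Ideal R :=
    { carrier := {x | Ideal.Quotient.mk I x ∈ J}
      add_mem' := fun {a b} ha hb => by
        simp only [Set.mem_ofPred_eq, map_add] at *; exact J.add_mem ha hb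
      zero_mem' := by simp [J.zero_mem]
      smul_mem' := fun c x hx => by
        simp only [Set.mem_ofPred_eq, smul_eq_mul, map_mul] at *; exact J.mul_mem_left _ _ hx }
  have hK : K.IsTwoSided := ⟨fun {a} b ha => by
    change Ideal.Quotient.mk I (a * b) ∈ J
    rw [map_mul]
    exact J.mul_mem_right _ _ ha⟩
  have hIK : I ≤ K := fun x hx => by
    change Ideal.Quotient.mk I x ∈ J
    rw [Ideal.Quotient.eq_zero_iff_mem.2 hx]; exact J.zero_mem
  rcases hIK.eq_or_lt with h | h
  · left
    refine eq_bot_iff.2 fun x hx => ?_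
    obtain ⟨a, rfl⟩ := Ideal.Quotient.mk_surjective x
    have : a ∈ I := by rw [h]; exact hx
    rw [Ideal.Quotient.eq_zero_iff_mem.2 this]
    exact TwoSidedIdeal.zero_mem _
  · right
    have := hI.eq_top_of_lt K hK h
    refine eq_top_iff.2 fun x _ => ?_
    obtain ⟨a, rfl⟩ := Ideal.Quotient.mk_surjective x
    have : a ∈ K := by rw [this]; trivial
    exact this

/-- There is a central `c ≠ 0` for which the ideals `R e + R c c'`, with `c' ≠ 0` central, all
coincide. -/
theorem exists_stable_central {e : SkewLaurent D τ} (he : e ≠ 0) :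
    ∃ c ∈ Subring.center (SkewLaurent D τ), c ≠ 0 ∧
      ∀ c' ∈ Subring.center (SkewLaurent D τ), c' ≠ 0 → ∃ x y, c = x * e + y * (c * c') := by
  have := (isArtinian_isNoetherian_quotient he).1
  -- The images of the ideals `R c` in the artinian module `R / R e`, for central `c ≠ 0`. A minimal
  -- one is not shrunk by a further central factor.
  let T : Set (Submodule (SkewLaurent D τ) (SkewLaurent D τ ⧸ Ideal.span {e})) :=
    (fun c => Submodule.map (Ideal.span {e}).mkQ (Ideal.span {c})) ''
      {c | c ∈ Subring.center (SkewLaurent D τ) ∧ c ≠ 0}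
  obtain ⟨_, ⟨c, ⟨hc, hc0⟩, rfl⟩, hmin⟩ := IsArtinian.set_has_minimal T
    ⟨_, 1, ⟨Subring.one_mem _, one_ne_zero⟩, rfl⟩
  refine ⟨c, hc, hc0, fun c' hc' hc'0 => ?_⟩
  have h1 := hmin _ ⟨c * c', ⟨Subring.mul_mem _ hc hc', mul_ne_zero hc0 hc'0⟩, rfl⟩
  have hle : Submodule.map (Ideal.span {e}).mkQ (Ideal.span {c * c'}) ≤
      Submodule.map (Ideal.span {e}).mkQ (Ideal.span {c}) := by
    refine Submodule.map_mono ?_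
    rw [Ideal.span_le, Set.singleton_subset_iff]
    exact Ideal.mem_span_singleton'.2 ⟨c', (Subring.mem_center_iff.1 hc c')⟩
  have heq := hle.eq_of_not_lt h1
  have hm : (Ideal.span {e}).mkQ c ∈ Submodule.map (Ideal.span {e}).mkQ (Ideal.span {c}) :=
    Submodule.mem_map_of_mem (Ideal.mem_span_singleton_self c)
  rw [← heq] at hm
  obtain ⟨z, hz, hzc⟩ := hm
  obtain ⟨y, rfl⟩ := Ideal.mem_span_singleton'.1 hz
  rw [← sub_eq_zero, ← map_sub, Submodule.mkQ_apply, Submodule.Quotient.mk_eq_zero] at hzc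
  obtain ⟨x, hx⟩ := Ideal.mem_span_singleton'.1 hzc
  exact ⟨-x, y, by rw [neg_mul, hx]; abel⟩

end SkewLaurent

/-! ### Rank functions on the skew Laurent ring are determined by their central values -/

namespace SkewLaurent

open Matrix

variable {D : Type u} [DivisionRing D] {τ : D ≃+* D}

/-- If `R / R q` is simple and faithful, all its powers are cyclic. -/
theorem exists_cyclic_generator {q : SkewLaurent D τ} (hq0 : q ≠ 0)
    (hmax : ∀ x, x ∉ Ideal.span {q} → ∃ y z, 1 = y * x + z * q)
    (hfaith : ∀ c ∈ Subring.center (SkewLaurent D τ), c ≠ 0 → c ∉ Ideal.span {q}) (n : ℕ) :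
    ∃ v : Fin n → SkewLaurent D τ, (∃ r, r ≠ 0 ∧ ∀ i, r * v i ∈ Ideal.span {q}) ∧
      ∀ w : Fin n → SkewLaurent D τ, ∃ r, ∀ i, w i - r * v i ∈ Ideal.span {q} := by
  induction n with
  | zero => exact ⟨Fin.elim0, ⟨1, one_ne_zero, fun i => i.elim0⟩, fun w => ⟨0, fun i => i.elim0⟩⟩
  | succ n ih =>
    obtain ⟨v, ⟨r, hr0, hr⟩, hv⟩ := ih
    -- Some `j` kills the generator `v` but not the module `R / R q`. Otherwise the non-zero `r`,
    -- which kills `v`, would lie in the annihilator of `R / R q`, a two-sided ideal, and its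
    -- central generator would contradict faithfulness.
    obtain ⟨j, hj, x, hjx⟩ : ∃ j, (∀ i, j * v i ∈ Ideal.span {q}) ∧ ∃ x, j * x ∉ Ideal.span {q} := by
      by_contra! hcon
      let K : Ideal (SkewLaurent D τ) :=
        { carrier := {a | ∀ x, a * x ∈ Ideal.span {q}}
          add_mem' := fun {a b} ha hb x => by
            rw [add_mul]; exact Ideal.add_mem _ (ha x) (hb x)
          zero_mem' := fun x => by rw [zero_mul]; exact Ideal.zero_mem _
          smul_mem' := fun c a ha x => by
            rw [smul_eq_mul, mul_assoc]; exact Ideal.mul_mem_left _ _ (ha x) }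
      have hK : K.IsTwoSided := ⟨fun b ha x => by rw [mul_assoc]; exact ha _⟩
      obtain ⟨p, hp, hKp⟩ := exists_central_generator K hK
      have hrK : r ∈ K := hcon r hr
      have hpK : p ∈ K := hKp ▸ Ideal.mem_span_singleton_self p
      have hp1 := hpK 1
      rw [mul_one] at hp1
      refine hfaith p hp (fun h0 => hr0 ?_) hp1
      rw [hKp, h0] at hrK
      simpa using hrK
    obtain ⟨y, z, hyz⟩ := hmax _ hjx
    -- The Ore condition keeps the annihilator of the enlarged generator non-zero: `u r` kills `v`,
    -- and it kills the new coordinate because `u (r x) = a q`.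
    obtain ⟨a, u, hu⟩ := ore_condition τ (r * x) ⟨q, mem_nonZeroDivisors_of_ne_zero hq0⟩
    refine ⟨Fin.snoc v x, ⟨u * r, mul_ne_zero (nonZeroDivisors.coe_ne_zero u) hr0, fun i => ?_⟩,
      fun w => ?_⟩
    · refine Fin.lastCases ?_ (fun i => ?_) i
      · rw [Fin.snoc_last, mul_assoc, hu]
        exact Ideal.mem_span_singleton'.2 ⟨a, rfl⟩
      · rw [Fin.snoc_castSucc, mul_assoc]
        exact Ideal.mul_mem_left _ _ (hr i)
    · obtain ⟨s, hs⟩ := hv fun i => w i.castSucc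
      -- `s` is right in the first `n` coordinates, `j` does not disturb them, and `y j x ≡ 1`
      -- modulo `R q` corrects the last one.
      refine ⟨s + (w (Fin.last n) - s * x) * y * j, fun i => ?_⟩
      refine Fin.lastCases ?_ (fun i => ?_) i
      · rw [Fin.snoc_last]
        refine Ideal.mem_span_singleton'.2 ⟨(w (Fin.last n) - s * x) * z, ?_⟩
        have h1 : z * q = 1 - y * (j * x) := by rw [hyz]; abel
        rw [mul_assoc, h1]
        simp only [mul_sub, add_mul, sub_mul, mul_one, mul_assoc]
        abel
      · rw [Fin.snoc_castSucc, add_mul, ← sub_sub]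
        refine Ideal.sub_mem _ (hs i) ?_
        rw [mul_assoc]
        exact Ideal.mul_mem_left _ _ (hj i)

/-- Every power of `R / R q` is cyclic, so `n (1 - rk q) ≤ 1` for every `n`. -/
theorem elemRank_eq_one_of_simple_faithful {rk : MatFun (SkewLaurent D τ)}
    (h : IsSylvesterRank rk) {q : SkewLaurent D τ} (hq0 : q ≠ 0)
    (hmax : ∀ x, x ∉ Ideal.span {q} → ∃ y z, 1 = y * x + z * q)
    (hfaith : ∀ c ∈ Subring.center (SkewLaurent D τ), c ≠ 0 → c ∉ Ideal.span {q}) :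
    elemRank rk q = 1 := by
  have key : ∀ n : ℕ, (n : ℝ) ≤ 1 + n * elemRank rk q := by
    intro n
    obtain ⟨v, -, hv⟩ := exists_cyclic_generator hq0 hmax hfaith n
    choose r hr using fun k : Fin n => hv (Pi.single k 1)
    choose z hz using fun k i => Ideal.mem_span_singleton'.1 (hr k i)
    let V : Matrix (Fin 1) (Fin n) (SkewLaurent D τ) := Matrix.of fun _ i => v i
    let Q : Matrix (Fin n) (Fin n) (SkewLaurent D τ) := Matrix.diagonal fun _ => q
    let W : Matrix (Fin n) (Fin 1 ⊕ Fin n) (SkewLaurent D τ) :=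
      fromCols (Matrix.of fun k _ => r k) (Matrix.of z)
    have hW : W * fromRows V Q = 1 := by
      simp only [W]
      rw [Matrix.fromCols_mul_fromRows]
      ext k i
      simp only [V, Q, Matrix.add_apply, Matrix.mul_diagonal, Matrix.of_apply, hz]
      simp [Matrix.mul_apply, Matrix.one_apply, Pi.single_apply, eq_comm]
    have h1 := h.gen_mul_le_right W (fromRows V Q)
    rw [hW, h.gen_one] at h1
    have h2 := h.gen_fromRows_le V Q
    have h3 := h.gen_le_card_left V
    have h4 := h.gen_smul_one (ι := Fin n) q
    simp only [Fintype.card_fin, Nat.cast_one] at h1 h2 h3 h4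
    simp only [Q] at h1 h2
    linarith
  refine le_antisymm (h.elem_le_one q) ?_
  by_contra! hlt
  obtain ⟨n, hn⟩ := exists_nat_gt (1 / (1 - elemRank rk q))
  rw [div_lt_iff₀ (by linarith)] at hn
  linarith [key n]

/-- If no non-zero central element acts as a non-surjection on `R / R e`, then `e` has rank one. -/
theorem elemRank_eq_one_of_divisible {rk : MatFun (SkewLaurent D τ)} (h : IsSylvesterRank rk)
    {e : SkewLaurent D τ} (he : e ≠ 0)
    (hdiv : ∀ c ∈ Subring.center (SkewLaurent D τ), c ≠ 0 → ∃ x y, 1 = x * e + y * c) :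
    elemRank rk e = 1 := by
  suffices key : ∀ (I : Ideal (SkewLaurent D τ)) (e : SkewLaurent D τ), I = Ideal.span {e} →
      e ≠ 0 → (∀ c ∈ Subring.center (SkewLaurent D τ), c ≠ 0 → ∃ x y, 1 = x * e + y * c) →
      elemRank rk e = 1 from key _ e rfl he hdiv
  intro I
  induction I using WellFoundedGT.induction with
  | ind I ih =>
  rintro e rfl he hdiv
  by_cases htop : Ideal.span {e} = ⊤
  · obtain ⟨x, hx⟩ := Ideal.mem_span_singleton'.1 (htop ▸ Submodule.mem_top (x := 1))
    refine le_antisymm (h.elem_le_one e) ?_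
    rw [← h.elem_one, ← hx]
    exact h.elem_mul_le_right _ _
  obtain ⟨hart, hnoe⟩ := isArtinian_isNoetherian_quotient he
  have : Nontrivial (SkewLaurent D τ ⧸ Ideal.span {e}) := Submodule.Quotient.nontrivial_iff.2 htop
  -- A simple submodule of `R / R e` has the form `R e' / R e`. Writing `e = q e'`, it is isomorphic
  -- to `R / R q`, and the induction continues with the quotient `R / R e'`.
  obtain ⟨S, hS⟩ := IsAtomic.exists_atom
    (Submodule (SkewLaurent D τ) (SkewLaurent D τ ⧸ Ideal.span {e}))
  obtain ⟨e', he'⟩ := exists_left_generator (S.comap (Ideal.span {e}).mkQ)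
  have hle : Ideal.span {e} ≤ Ideal.span {e'} := by
    rw [← he']
    intro x hx
    rw [Submodule.mem_comap, Submodule.mkQ_apply, (Submodule.Quotient.mk_eq_zero _).2 hx]
    exact S.zero_mem
  have hmem : ∀ x, x ∈ Ideal.span {e'} ↔ (Ideal.span {e}).mkQ x ∈ S := fun x => by
    rw [← he', Submodule.mem_comap]
  have hSe : ∀ x, x ∈ Ideal.span {e} ↔ (Ideal.span {e}).mkQ x = 0 := fun x => by
    rw [Submodule.mkQ_apply, Submodule.Quotient.mk_eq_zero]
  have he'0 : (Ideal.span {e}).mkQ e' ≠ 0 := by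
    intro h0
    refine hS.1 (eq_bot_iff.2 fun s hs => ?_)
    obtain ⟨a, rfl⟩ := Submodule.mkQ_surjective _ s
    obtain ⟨y, rfl⟩ := Ideal.mem_span_singleton'.1 ((hmem a).2 hs)
    rw [← smul_eq_mul, map_smul, h0, smul_zero]
    exact Submodule.zero_mem _
  have hlt : Ideal.span {e} < Ideal.span {e'} := by
    refine hle.lt_of_ne fun h0 => he'0 ?_
    rw [← hSe, h0]
    exact Ideal.mem_span_singleton_self e'
  obtain ⟨q, hq⟩ := Ideal.mem_span_singleton'.1 (hle (Ideal.mem_span_singleton_self e))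
  have hq0 : q ≠ 0 := by rintro rfl; rw [zero_mul] at hq; exact he hq.symm
  have he'ne : e' ≠ 0 := by rintro rfl; rw [mul_zero] at hq; exact he hq.symm
  have hqe : ∀ x, x ∈ Ideal.span {q} ↔ (Ideal.span {e}).mkQ (x * e') = 0 := by
    intro x
    rw [← hSe, Ideal.mem_span_singleton', Ideal.mem_span_singleton']
    constructor
    · rintro ⟨a, rfl⟩; exact ⟨a, by rw [mul_assoc, hq]⟩
    · rintro ⟨a, ha⟩
      exact ⟨a, mul_right_cancel₀ he'ne (by rw [mul_assoc, hq, ha])⟩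
  have hqmax : ∀ x, x ∉ Ideal.span {q} → ∃ y z, 1 = y * x + z * q := by
    intro x hx
    rw [hqe] at hx
    have hxS : (Ideal.span {e}).mkQ (x * e') ∈ S :=
      (hmem _).1 (Ideal.mem_span_singleton'.2 ⟨x, rfl⟩)
    have hspan : Submodule.span (SkewLaurent D τ) {(Ideal.span {e}).mkQ (x * e')} = S := by
      refine (hS.le_iff.1 ((Submodule.span_singleton_le_iff_mem _ _).2 hxS)).resolve_left ?_
      rwa [Submodule.span_singleton_eq_bot]
    have h1 : (Ideal.span {e}).mkQ e' ∈ S := (hmem _).1 (Ideal.mem_span_singleton_self e')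
    rw [← hspan] at h1
    obtain ⟨y, hy⟩ := Submodule.mem_span_singleton.1 h1
    rw [← map_smul, ← sub_eq_zero, ← map_sub, ← hSe] at hy
    obtain ⟨z, hz⟩ := Ideal.mem_span_singleton'.1 hy
    refine ⟨y, -z, mul_right_cancel₀ he'ne ?_⟩
    rw [add_mul, mul_assoc (-z), hq, neg_mul, hz, smul_eq_mul, one_mul, mul_assoc]
    abel
  have hfaith : ∀ c ∈ Subring.center (SkewLaurent D τ), c ≠ 0 → c ∉ Ideal.span {q} := by
    intro c hc hc0 hcq
    rw [hqe] at hcq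
    let μ : (SkewLaurent D τ ⧸ Ideal.span {e}) →ₗ[SkewLaurent D τ]
        (SkewLaurent D τ ⧸ Ideal.span {e}) :=
      { toFun := fun v => c • v
        map_add' := smul_add c
        map_smul' := fun r v => by
          rw [RingHom.id_apply, smul_smul, smul_smul, Subring.mem_center_iff.1 hc] }
    have hsurj : Function.Surjective μ := by
      intro v
      obtain ⟨a, rfl⟩ := Submodule.mkQ_surjective _ v
      obtain ⟨x, y, hxy⟩ := hdiv c hc hc0
      refine ⟨(Ideal.span {e}).mkQ (a * y), ?_⟩
      change c • (Ideal.span {e}).mkQ (a * y) = _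
      rw [← map_smul, ← sub_eq_zero, ← map_sub, ← hSe]
      refine Ideal.mem_span_singleton'.2 ⟨-(a * x), ?_⟩
      have h1 : x * e = 1 - y * c := by rw [hxy]; abel
      rw [smul_eq_mul, ← Subring.mem_center_iff.1 hc, neg_mul, mul_assoc, h1, mul_sub, mul_one,
        ← mul_assoc]
      abel
    -- A surjective endomorphism of a noetherian module is injective, so a non-zero central element
    -- cannot kill the simple submodule.
    have hinj := IsNoetherian.injective_of_surjective_endomorphism μ hsurj
    refine he'0 (hinj ?_)
    rw [map_zero, ← hcq]
    change c • (Ideal.span {e}).mkQ e' = _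
    rw [← map_smul, smul_eq_mul]
  have h1 : elemRank rk q = 1 := elemRank_eq_one_of_simple_faithful h hq0 hqmax hfaith
  have h2 : elemRank rk e' = 1 := ih _ hlt e' rfl he'ne fun c hc hc0 => by
    obtain ⟨x, y, hxy⟩ := hdiv c hc hc0
    exact ⟨x * q, y, by rw [mul_assoc, hq, hxy]⟩
  have h3 := h.elem_add_le_mul q e'
  rw [hq, h1, h2] at h3
  exact le_antisymm (h.elem_le_one _) (by linarith)

/-- The rank of `e` is the rank of the column `(c, e)` for a suitable central `c ≠ 0`. -/
theorem exists_elemRank_eq_stack {e : SkewLaurent D τ} (he : e ≠ 0) :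
    ∃ c : Subring.center (SkewLaurent D τ), c ≠ 0 ∧ ∀ rk : MatFun (SkewLaurent D τ),
      IsSylvesterRank rk → elemRank rk e =
        genRank rk (stackScalar (Subring.center (SkewLaurent D τ)).subtype e
          (Matrix.of fun _ _ : Fin 1 => c)) := by
  obtain ⟨c, hc, hc0, hst⟩ := exists_stable_central he
  refine ⟨⟨c, hc⟩, fun h0 => hc0 (congrArg Subtype.val h0), fun rk h => ?_⟩
  -- With `R g = R e + R c` and `e = e' g`, the module `R / R e'` is isomorphic to `R g / R e`, on
  -- which non-zero central elements act surjectively by the choice of `c`. Hence `rk e' = 1` and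
  -- `rk e = rk g`; and `g` has the rank of the column `(c, e)`, which generates the same left
  -- ideal. The choice of `c` does not involve `rk`.
  obtain ⟨g, hg⟩ := exists_left_generator (Ideal.span {e} ⊔ Ideal.span {c})
  obtain ⟨e', he'⟩ := Ideal.mem_span_singleton'.1
    (hg ▸ Ideal.mem_sup_left (Ideal.mem_span_singleton_self e) : e ∈ Ideal.span {g})
  obtain ⟨k, hk⟩ := Ideal.mem_span_singleton'.1
    (hg ▸ Ideal.mem_sup_right (Ideal.mem_span_singleton_self c) : c ∈ Ideal.span {g})
  obtain ⟨α, β, hαβ⟩ : ∃ α β, g = α * e + β * c := by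
    have : g ∈ Ideal.span {e} ⊔ Ideal.span {c} := hg ▸ Ideal.mem_span_singleton_self g
    obtain ⟨a, ha, b, hb, hab⟩ := Submodule.mem_sup.1 this
    obtain ⟨α, rfl⟩ := Ideal.mem_span_singleton'.1 ha
    obtain ⟨β, rfl⟩ := Ideal.mem_span_singleton'.1 hb
    exact ⟨α, β, hab.symm⟩
  have hg0 : g ≠ 0 := by rintro rfl; rw [mul_zero] at he'; exact he he'.symm
  have he'0 : e' ≠ 0 := by rintro rfl; rw [zero_mul] at he'; exact he he'.symm
  have hrk : elemRank rk e' = 1 := elemRank_eq_one_of_divisible h he'0 fun c' hc' hc'0 => by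
    obtain ⟨x, y, hxy⟩ := hst c' hc' hc'0
    refine ⟨α + β * x, β * y * k, mul_right_cancel₀ hg0 ?_⟩
    have h1 : c * c' = k * c' * g := by
      rw [Subring.mem_center_iff.1 hc', ← hk, ← mul_assoc, Subring.mem_center_iff.1 hc']
    rw [one_mul, add_mul, mul_assoc (α + β * x), he', mul_assoc _ c' g, mul_assoc _ k,
      ← mul_assoc k, ← h1, add_mul, mul_assoc β y, mul_assoc β x, add_assoc, ← mul_add, ← hxy]
    exact hαβ
  have h1 : elemRank rk e = elemRank rk g := by
    refine le_antisymm (he' ▸ h.elem_mul_le_right _ _) ?_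
    have := h.elem_add_le_mul e' g
    rw [he', hrk] at this
    linarith
  rw [h1, show elemRank rk g = genRank rk (Matrix.of fun _ _ : Fin 1 => g) from
    (h.gen_unique (Matrix.of fun _ _ : Fin 1 => g)).symm]
  refine le_antisymm ?_ ?_
  · have : (Matrix.of fun _ _ : Fin 1 => g) =
        (fromCols (Matrix.of fun _ _ : Fin 1 => β) (Matrix.of fun _ _ : Fin 1 => α) :
          Matrix (Fin 1) (Fin 1 ⊕ Fin 1) (SkewLaurent D τ)) *
        stackScalar (Subring.center (SkewLaurent D τ)).subtype e
          (Matrix.of fun _ _ : Fin 1 => (⟨c, hc⟩ : Subring.center (SkewLaurent D τ))) := by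
      unfold stackScalar
      rw [Matrix.fromCols_mul_fromRows]
      ext i j
      fin_cases i; fin_cases j
      simp [Matrix.mul_apply, hαβ, add_comm]
    rw [this]
    exact h.gen_mul_le_right _ _
  · have : stackScalar (Subring.center (SkewLaurent D τ)).subtype e
          (Matrix.of fun _ _ : Fin 1 => (⟨c, hc⟩ : Subring.center (SkewLaurent D τ))) =
        (fromRows (Matrix.of fun _ _ : Fin 1 => k) (Matrix.of fun _ _ : Fin 1 => e') :
          Matrix (Fin 1 ⊕ Fin 1) (Fin 1) (SkewLaurent D τ)) *
        (Matrix.of fun _ _ : Fin 1 => g) := by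
      unfold stackScalar
      rw [Matrix.fromRows_mul]
      ext i j
      fin_cases j
      rcases i with i | i <;> fin_cases i <;> simp [Matrix.mul_apply, hk, he']
    rw [this]
    exact h.gen_mul_le_right _ _

end SkewLaurent

/-! ### Ranks of columns with two entries. -/

namespace IsSylvesterRank

open Matrix

variable {R : Type u} [Ring R] {rk : MatFun R} (h : IsSylvesterRank rk)

include h in
theorem gen_fromRows_comm {ι κ μ : Type} [Fintype ι] [Fintype κ] [Fintype μ] (A : Matrix ι κ R)
    (B : Matrix μ κ R) : genRank rk (fromRows A B) = genRank rk (fromRows B A) := by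
  rw [← h.gen_submatrix (fromRows B A) (Equiv.sumComm ι μ) (Equiv.refl κ)]
  congr 1
  ext i j
  rcases i with i | i <;> rfl

include h in
theorem gen_fromRows_mul {ι κ μ : Type} [Fintype ι] [Fintype κ] [Fintype μ] (A : Matrix ι κ R)
    (B : Matrix μ ι R) : genRank rk (fromRows A (B * A)) = genRank rk A := by
  classical
  refine le_antisymm ?_ (h.le_gen_fromRows_left _ _)
  have : fromRows A (B * A) = fromRows (1 : Matrix ι ι R) B * A := by
    rw [Matrix.fromRows_mul, Matrix.one_mul]
  rw [this]
  exact h.gen_mul_le_right _ _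

include h in
-- Either entry of the column may play the part of the scalar. This permits passing between the
-- relative rank on the centre, with `e` as scalar, and that on `R`, with a central scalar.
theorem stack_comm {S : Type u} [Ring S] (φ : S →+* R) (e : R) (s : S) :
    genRank rk (stackScalar φ e (Matrix.of fun _ _ : Fin 1 => s)) =
      genRank rk (stackScalar (RingHom.id R) (φ s) (Matrix.of fun _ _ : Fin 1 => e)) := by
  unfold stackScalar
  rw [h.gen_fromRows_comm]
  congr 1
  ext i j
  fin_cases j
  rcases i with i | i <;> fin_cases i <;> simp

theorem stack_eq {S : Type u} [Ring S] (φ : S →+* R) {c : R} (hc1 : elemRank rk c < 1) (s : S) :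
    genRank rk (stackScalar φ c (Matrix.of fun _ _ : Fin 1 => s)) =
      elemRank rk c + (1 - elemRank rk c) * elemRank (relRank rk φ c) s := by
  have h1 : 1 - elemRank rk c ≠ 0 := by linarith
  have h2 : elemRank (relRank rk φ c) s =
      (genRank rk (stackScalar φ c (Matrix.of fun _ _ : Fin 1 => s)) - (1 : ℕ) * elemRank rk c) /
        (1 - elemRank rk c) := rfl
  rw [h2, mul_div_cancel₀ _ h1]
  simp

include h in
/-- The column `(p ^ i, p ^ N)` has the rank of `p ^ min i N`. -/
theorem stack_pow (p : R) (i N : ℕ) :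
    genRank rk (stackScalar (RingHom.id R) (p ^ N) (Matrix.of fun _ _ : Fin 1 => p ^ i)) =
      elemRank rk (p ^ min i N) := by
  have hd (c : R) : (Matrix.diagonal fun _ : Fin 1 => c) = Matrix.of fun _ _ : Fin 1 => c := by
    ext a b
    fin_cases a; fin_cases b; simp
  have hid (c : R) : (Matrix.of fun _ _ : Fin 1 => c).map (RingHom.id R) =
      Matrix.of fun _ _ : Fin 1 => c := rfl
  have key : ∀ i j : ℕ, i ≤ j → genRank rk (fromRows (Matrix.of fun _ _ : Fin 1 => p ^ i)
      (Matrix.of fun _ _ : Fin 1 => p ^ j)) = elemRank rk (p ^ i) := by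
    intro i j hij
    have : (Matrix.of fun _ _ : Fin 1 => p ^ j) = (Matrix.of fun _ _ : Fin 1 => p ^ (j - i)) *
        (Matrix.of fun _ _ : Fin 1 => p ^ i) := by
      ext a b
      simp [Matrix.mul_apply, ← pow_add, hij]
    rw [this, h.gen_fromRows_mul]
    exact h.gen_unique (Matrix.of fun _ _ : Fin 1 => p ^ i)
  unfold stackScalar
  rw [hd, hid]
  rcases le_total i N with hi | hi
  · rw [min_eq_left hi, key i N hi]
  · rw [min_eq_right hi, h.gen_fromRows_comm, key N i hi]

include h in
-- The degenerate case `rk c = 1`, in which the normalization of `relRank` is unavailable.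
theorem stack_eq_one {S : Type u} [Ring S] (φ : S →+* R) {c : R} (hc1 : elemRank rk c = 1) (s : S) :
    genRank rk (stackScalar φ c (Matrix.of fun _ _ : Fin 1 => s)) = 1 := by
  have h1 := h.gen_le_card_right (stackScalar φ c (Matrix.of fun _ _ : Fin 1 => s))
  refine le_antisymm (by simpa using h1) ?_
  have := h.le_gen_fromRows_right (κ := Fin 1) ((Matrix.of fun (_ _ : Fin 1) => s).map φ)
    (Matrix.diagonal fun _ : Fin 1 => c)
  rw [h.gen_smul_one, hc1, Fintype.card_fin, Nat.cast_one, one_mul] at this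
  exact this

end IsSylvesterRank

/-! ### Reduction to prime powers of the centre. -/

namespace SkewLaurent

variable {D : Type u} [DivisionRing D] {τ : D ≃+* D} {rk rk' : MatFun (SkewLaurent D τ)}

theorem exists_mul_of_mem_span {p : Subring.center (SkewLaurent D τ)} {x : SkewLaurent D τ}
    (hx : x ∈ Ideal.span {(p : SkewLaurent D τ)}) : ∃ y, x = p * y := by
  obtain ⟨y, rfl⟩ := Ideal.mem_span_singleton'.1 hx
  exact ⟨y, Subring.mem_center_iff.1 p.2 y⟩

theorem exists_eq_pullback_quotient (h : IsSylvesterRank rk) {q : Subring.center (SkewLaurent D τ)}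
    (h0 : elemRank rk q = 0) [(Ideal.span {(q : SkewLaurent D τ)}).IsTwoSided] :
    ∃ σ, IsSylvesterRank σ ∧
      rk = pullbackRank (Ideal.Quotient.mk (Ideal.span {(q : SkewLaurent D τ)})) σ := by
  refine h.exists_eq_pullback Ideal.Quotient.mk_surjective fun m n M hM => ?_
  choose B hB using fun i j => exists_mul_of_mem_span
    (Ideal.Quotient.eq_zero_iff_mem.1 (congrFun (congrFun hM i) j))
  have : M = (q : SkewLaurent D τ) • Matrix.of B := Matrix.ext hB
  have h1 := h.gen_smul_le (q : SkewLaurent D τ) (Matrix.of B)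
  rw [h0, mul_zero, ← this, h.gen_fin] at h1
  exact le_antisymm h1 (h.nonneg _ _ _)

/-- Both functions descend to `R / R p ^ N`, where `p` is central and nilpotent. Its quotient `R / R
p` is simple and artinian, hence a matrix ring over a division ring by Wedderburn–Artin, so
`eq_of_elemRank_pow_eq` applies. -/
theorem eq_of_elemRank_pow_eq_zero (h : IsSylvesterRank rk) (h' : IsSylvesterRank rk')
    {p : Subring.center (SkewLaurent D τ)} (hp : Irreducible p) {N : ℕ}
    (h0 : elemRank rk ((p : SkewLaurent D τ) ^ N) = 0)
    (heq : ∀ i : ℕ, elemRank rk ((p : SkewLaurent D τ) ^ i) =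
      elemRank rk' ((p : SkewLaurent D τ) ^ i)) : rk = rk' := by
  have hN : N ≠ 0 := by
    rintro rfl
    rw [pow_zero, h.elem_one] at h0
    exact one_ne_zero h0
  have hmax := (isMaximalTwoSided_span_iff hp.ne_zero).2 hp
  have h1 : elemRank rk ((p ^ N : Subring.center (SkewLaurent D τ)) : SkewLaurent D τ) = 0 := h0
  have h1' : elemRank rk' ((p ^ N : Subring.center (SkewLaurent D τ)) : SkewLaurent D τ) = 0 :=
    (heq N).symm.trans h0
  have : (Ideal.span {((p ^ N : Subring.center (SkewLaurent D τ)) : SkewLaurent D τ)}).IsTwoSided :=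
    isTwoSided_span_of_mem_center (p ^ N).2
  have := hmax.isTwoSided
  obtain ⟨σ, hσ, rfl⟩ := exists_eq_pullback_quotient h h1
  obtain ⟨σ', hσ', rfl⟩ := exists_eq_pullback_quotient h' h1'
  have hp0 : (p : SkewLaurent D τ) ≠ 0 := fun h => hp.ne_zero (Subtype.ext h)
  have := isSimpleRing_quotient hmax
  have := isArtinianRing_quotient hp0 (Ideal.mem_span_singleton_self (p : SkewLaurent D τ))
  obtain ⟨s, _, Δ, _, ⟨ε⟩⟩ := IsSimpleRing.exists_ringEquiv_matrix_divisionRing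
    (SkewLaurent D τ ⧸ Ideal.span {(p : SkewLaurent D τ)})
  have hle : Ideal.span {((p ^ N : Subring.center (SkewLaurent D τ)) : SkewLaurent D τ)} ≤
      Ideal.span {(p : SkewLaurent D τ)} := by
    rw [Ideal.span_singleton_le_iff_mem]
    exact Ideal.mem_span_singleton'.2 ⟨(p : SkewLaurent D τ) ^ (N - 1), by
      rw [← pow_succ, Nat.sub_one_add_one hN]; rfl⟩
  congr 1
  refine eq_of_elemRank_pow_eq (p := Ideal.Quotient.mk _ (p : SkewLaurent D τ))
    (Subring.mem_center_iff.2 fun a => ?_) ⟨N, ?_⟩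
    (φ := (ε : SkewLaurent D τ ⧸ Ideal.span {(p : SkewLaurent D τ)} →+*
      Matrix (Fin s) (Fin s) Δ).comp (Ideal.Quotient.factor hle))
    (ε.surjective.comp (Ideal.Quotient.factor_surjective hle)) (fun a ha => ?_) hσ hσ' fun i => ?_
  · obtain ⟨a, rfl⟩ := Ideal.Quotient.mk_surjective a
    rw [← map_mul, ← map_mul, Subring.mem_center_iff.1 p.2]
  · rw [← map_pow]
    exact Ideal.Quotient.eq_zero_iff_mem.2 (Ideal.mem_span_singleton_self _)
  · obtain ⟨a, rfl⟩ := Ideal.Quotient.mk_surjective a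
    have h2 := (map_eq_zero_iff ε ε.injective).1 ha
    rw [Ideal.Quotient.factor_mk] at h2
    obtain ⟨y, rfl⟩ := exists_mul_of_mem_span (Ideal.Quotient.eq_zero_iff_mem.1 h2)
    exact ⟨Ideal.Quotient.mk _ y, map_mul _ _ _⟩
  · rw [← map_pow]
    exact heq i

/-- Rank functions on the skew Laurent ring are determined by their values at the powers of the
irreducible elements of the centre. -/
theorem eq_of_elemRank_pow_eq_of_irreducible (h : IsSylvesterRank rk) (h' : IsSylvesterRank rk')
    (heq : ∀ p : Subring.center (SkewLaurent D τ), Irreducible p → ∀ i : ℕ,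
      elemRank rk ((p : SkewLaurent D τ) ^ i) = elemRank rk' ((p : SkewLaurent D τ) ^ i)) :
    rk = rk' := by
  refine eq_of_elemRank_eq (N := width) (fun a b hb => exists_width_sub_mul_lt _ _ hb)
    (fun a b hb => exists_width_sub_mul_lt' _ _ hb) h h' fun e => ?_
  by_cases he : e = 0
  · rw [he, h.elem_zero, h'.elem_zero]
  obtain ⟨c, hc0, hc⟩ := exists_elemRank_eq_stack he
  rw [hc rk h, hc rk' h']
  have hcomm : ∀ s, e * (Subring.center (SkewLaurent D τ)).subtype s =
      (Subring.center (SkewLaurent D τ)).subtype s * e :=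
    fun s => Subring.mem_center_iff.1 s.2 e
  -- As a function of the central entry, the rank of the column is an affine transform of a rank
  -- function on the centre, so it inherits additivity over coprime factors.
  have hcop : ∀ {rk : MatFun (SkewLaurent D τ)}, IsSylvesterRank rk → ∀ a b, IsCoprime a b →
      genRank rk (stackScalar (Subring.center (SkewLaurent D τ)).subtype e
        (Matrix.of fun _ _ : Fin 1 => a)) +
      genRank rk (stackScalar (Subring.center (SkewLaurent D τ)).subtype e
        (Matrix.of fun _ _ : Fin 1 => b)) =
      genRank rk (stackScalar (Subring.center (SkewLaurent D τ)).subtype e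
        (Matrix.of fun _ _ : Fin 1 => a * b)) + 1 := by
    intro rk h a b hab
    rcases (h.elem_le_one e).lt_or_eq with h1 | h1
    · have := (h.isSylvesterRank_relRank _ hcomm h1).elem_add_of_isCoprime hab
      rw [IsSylvesterRank.stack_eq _ h1, IsSylvesterRank.stack_eq _ h1, IsSylvesterRank.stack_eq _ h1]
      linear_combination (1 - elemRank rk e) * this
    · rw [h.stack_eq_one _ h1, h.stack_eq_one _ h1, h.stack_eq_one _ h1]
  have hunit : ∀ {rk : MatFun (SkewLaurent D τ)}, IsSylvesterRank rk → ∀ u, IsUnit u →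
      genRank rk (stackScalar (Subring.center (SkewLaurent D τ)).subtype e
        (Matrix.of fun _ _ : Fin 1 => u)) = 1 := by
    intro rk h u hu
    rw [h.stack_comm, h.stack_eq_one]
    exact h.elem_isUnit (hu.map (Subring.center (SkewLaurent D τ)).subtype)
  refine elemRank_eq_of_prime_pow
    (f := fun c => genRank rk (stackScalar (Subring.center (SkewLaurent D τ)).subtype e
      (Matrix.of fun _ _ : Fin 1 => c)))
    (g := fun c => genRank rk' (stackScalar (Subring.center (SkewLaurent D τ)).subtype e
      (Matrix.of fun _ _ : Fin 1 => c)))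
    (fun u hu => (hunit h u hu).trans (hunit h' u hu).symm) (hcop h) (hcop h') (fun p hp N => ?_) hc0
  -- The roles are exchanged: now `p ^ N` is the scalar and `e` the argument. The resulting relative
  -- rank is a rank function on `R` that kills `p ^ N`, and its values at `p ^ i` come from those of
  -- `rk` at `p ^ min i N`.
  rw [h.stack_comm, h'.stack_comm, map_pow]
  change genRank rk (stackScalar _ ((p : SkewLaurent D τ) ^ N) _) =
    genRank rk' (stackScalar _ ((p : SkewLaurent D τ) ^ N) _)
  have heqN := heq p hp N
  rcases (h.elem_le_one ((p : SkewLaurent D τ) ^ N)).lt_or_eq with h1 | h1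
  · have h1' : elemRank rk' ((p : SkewLaurent D τ) ^ N) < 1 := heqN ▸ h1
    have hpc : ∀ s, (p : SkewLaurent D τ) ^ N * RingHom.id _ s =
        RingHom.id _ s * (p : SkewLaurent D τ) ^ N := fun s =>
      (Subring.mem_center_iff.1 (p ^ N).2 s).symm
    have hval : ∀ {rk : MatFun (SkewLaurent D τ)}, IsSylvesterRank rk →
        elemRank rk ((p : SkewLaurent D τ) ^ N) < 1 → ∀ i,
        elemRank (relRank rk (RingHom.id _) ((p : SkewLaurent D τ) ^ N))
          ((p : SkewLaurent D τ) ^ i) =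
          (elemRank rk ((p : SkewLaurent D τ) ^ min i N) - elemRank rk ((p : SkewLaurent D τ) ^ N)) /
            (1 - elemRank rk ((p : SkewLaurent D τ) ^ N)) := by
      intro rk h h1 i
      have h2 := IsSylvesterRank.stack_eq (RingHom.id _) h1 ((p : SkewLaurent D τ) ^ i)
      rw [h.stack_pow] at h2
      rw [h2, add_sub_cancel_left, mul_div_cancel_left₀]
      linarith
    rw [IsSylvesterRank.stack_eq _ h1, IsSylvesterRank.stack_eq _ h1', eq_of_elemRank_pow_eq_zero (N := N)
      (h.isSylvesterRank_relRank _ hpc h1) (h'.isSylvesterRank_relRank _ hpc h1') hp ?_ ?_, heqN]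
    · rw [hval h h1, min_self, sub_self, zero_div]
    · intro i
      rw [hval h h1, hval h' h1', heq p hp, heqN]
  · rw [h.stack_eq_one _ h1, h'.stack_eq_one _ (heqN ▸ h1)]

end SkewLaurent

/-! ### The rank function of a finite-dimensional right action -/

section LinearMap

variable {K : Type*} [DivisionRing K] {X Y Z X₁ X₂ Y₁ Y₂ : Type*}
  [AddCommGroup X] [AddCommGroup Y] [AddCommGroup Z] [AddCommGroup X₁] [AddCommGroup X₂]
  [AddCommGroup Y₁] [AddCommGroup Y₂] [Module K X] [Module K Y] [Module K Z] [Module K X₁]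
  [Module K X₂] [Module K Y₁] [Module K Y₂]

theorem LinearMap.finrank_range_comp_le_left [Module.Finite K Z] (g : Y →ₗ[K] Z) (f : X →ₗ[K] Y) :
    Module.finrank K (range (g ∘ₗ f)) ≤ Module.finrank K (range g) :=
  Submodule.finrank_mono (range_comp_le_range f g)

theorem LinearMap.finrank_range_comp_le_right [Module.Finite K Y] (g : Y →ₗ[K] Z) (f : X →ₗ[K] Y) :
    Module.finrank K (range (g ∘ₗ f)) ≤ Module.finrank K (range f) := by
  rw [range_comp]
  exact Submodule.finrank_map_le g _

theorem LinearMap.finrank_range_add_le [Module.Finite K Y] (f g : X →ₗ[K] Y) :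
    Module.finrank K (range (f + g)) ≤ Module.finrank K (range f) + Module.finrank K (range g) := by
  have h : range (f + g) ≤ range f ⊔ range g := by
    rintro _ ⟨x, rfl⟩
    exact Submodule.add_mem_sup ⟨x, rfl⟩ ⟨x, rfl⟩
  exact (Submodule.finrank_mono h).trans (Submodule.finrank_add_le_finrank_add_finrank _ _)

/-- `p` maps the range of `T` onto the range of `A`, and the kernel of this map contains the
embedded range of `B`. -/
theorem LinearMap.finrank_range_add_le_of_triangular [Module.Finite K X] [Module.Finite K Y]
    {T : X →ₗ[K] Y}
    {A : X₁ →ₗ[K] Y₁} {B : X₂ →ₗ[K] Y₂} {s : X →ₗ[K] X₁} {p : Y →ₗ[K] Y₁} {i : X₂ →ₗ[K] X}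
    {j : Y₂ →ₗ[K] Y} (hs : Function.Surjective s) (hj : Function.Injective j)
    (hA : p ∘ₗ T = A ∘ₗ s) (hB : T ∘ₗ i = j ∘ₗ B) (hpj : p ∘ₗ j = 0) :
    Module.finrank K (range A) + Module.finrank K (range B) ≤ Module.finrank K (range T) := by
  rw [← finrank_range_add_finrank_ker (p.domRestrict (range T))]
  have h1 : range (p.domRestrict (range T)) = range A := by
    rw [range_domRestrict, ← range_comp, hA, range_comp_of_range_eq_top _ (range_eq_top.2 hs)]
  rw [h1]
  refine Nat.add_le_add_left ?_ _
  let φ : range B →ₗ[K] ker (p.domRestrict (range T)) :=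
    LinearMap.codRestrict _ (LinearMap.codRestrict _ (j ∘ₗ (range B).subtype) (by
      rintro ⟨_, x, rfl⟩
      exact ⟨i x, congr($hB x)⟩)) (by
      rintro ⟨_, x, rfl⟩
      exact congr($hpj (B x)))
  refine LinearMap.finrank_le_finrank_of_injective (f := φ) fun a b hab => ?_
  exact Subtype.ext (hj (congrArg (fun z : ker (p.domRestrict (range T)) => (z : Y)) hab))

/-- Ranks of powers of an endomorphism whose kernel lies in the range of its `(k-1)`-st power. -/
theorem LinearMap.finrank_range_pow_add [Module.Finite K X] (f : Module.End K X) {k : ℕ}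
    (hk : ∀ i < k, ker f ≤ range (f ^ i)) {i : ℕ} (hi : i ≤ k) :
    Module.finrank K (range (f ^ i)) + i * Module.finrank K (ker f) = Module.finrank K X := by
  induction i with
  | zero =>
    rw [pow_zero, zero_mul, add_zero, Module.End.one_eq_id, range_id, finrank_top]
  | succ i ih =>
    rw [← ih (by omega), ← finrank_range_add_finrank_ker (f.domRestrict (range (f ^ i)))]
    have h1 : range (f.domRestrict (range (f ^ i))) = range (f ^ (i + 1)) := by
      rw [range_domRestrict, ← range_comp, pow_succ']
      rfl
    have h2 : Module.finrank K (ker (f.domRestrict (range (f ^ i)))) = Module.finrank K (ker f) :=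
      (Submodule.comapSubtypeEquivOfLe (hk i (by omega))).finrank_eq
    rw [h1, h2]
    ring

end LinearMap

section actionRank

open MulOpposite

variable {K : Type*} [DivisionRing K] {V : Type u} [AddCommGroup V] [Module K V]

/-- Row vectors over `V`, multiplied by a matrix of endomorphisms acting on the right. -/
def rowAct {m n : ℕ} (A : Matrix (Fin m) (Fin n) (Module.End K V)ᵐᵒᵖ) :
    (Fin m → V) →ₗ[K] (Fin n → V) :=
  LinearMap.pi fun j => ∑ i, (A i j).unop ∘ₗ LinearMap.proj i

theorem rowAct_apply {m n : ℕ} (A : Matrix (Fin m) (Fin n) (Module.End K V)ᵐᵒᵖ) (v : Fin m → V)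
    (j : Fin n) : rowAct A v j = ∑ i, (A i j).unop (v i) := by
  simp [rowAct]

variable (K V) in
/-- The normalized rank of matrices over the ring of endomorphisms of `V` acting on the right. -/
noncomputable def actionRank : MatFun (Module.End K V)ᵐᵒᵖ := fun _ _ A =>
  (Module.finrank K (LinearMap.range (rowAct A)) : ℝ) / (Module.finrank K V : ℝ)

theorem rowAct_mul {m n p : ℕ} (A : Matrix (Fin m) (Fin n) (Module.End K V)ᵐᵒᵖ)
    (B : Matrix (Fin n) (Fin p) (Module.End K V)ᵐᵒᵖ) : rowAct (A * B) = rowAct B ∘ₗ rowAct A := by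
  refine LinearMap.ext fun v => ?_
  funext k
  simp only [LinearMap.comp_apply, rowAct_apply, Matrix.mul_apply, map_sum, Finset.unop_sum,
    unop_mul, LinearMap.sum_apply]
  rw [Finset.sum_comm]
  rfl

/-- The inclusion of the last coordinates. -/
def rowInr (K V : Type*) [DivisionRing K] [AddCommGroup V] [Module K V] (m p : ℕ) :
    (Fin p → V) →ₗ[K] (Fin (m + p) → V) where
  toFun w := Fin.addCases (fun _ => 0) w
  map_add' v w := by
    funext x
    refine Fin.addCases (fun i => ?_) (fun i => ?_) x <;> simp
  map_smul' c w := by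
    funext x
    refine Fin.addCases (fun i => ?_) (fun i => ?_) x <;> simp

/-- The inclusion of the first coordinates. -/
def rowInl (K V : Type*) [DivisionRing K] [AddCommGroup V] [Module K V] (m p : ℕ) :
    (Fin m → V) →ₗ[K] (Fin (m + p) → V) where
  toFun w := Fin.addCases w (fun _ => 0)
  map_add' v w := by
    funext x
    refine Fin.addCases (fun i => ?_) (fun i => ?_) x <;> simp
  map_smul' c w := by
    funext x
    refine Fin.addCases (fun i => ?_) (fun i => ?_) x <;> simp

theorem blockUpper_apply {R : Type*} [Zero R] {m n p q : ℕ} (A : Matrix (Fin m) (Fin n) R)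
    (C : Matrix (Fin m) (Fin q) R) (B : Matrix (Fin p) (Fin q) R) :
    (∀ i j, blockUpper A C B (Fin.castAdd p i) (Fin.castAdd q j) = A i j) ∧
    (∀ i j, blockUpper A C B (Fin.castAdd p i) (Fin.natAdd n j) = C i j) ∧
    (∀ i j, blockUpper A C B (Fin.natAdd m i) (Fin.castAdd q j) = 0) ∧
    (∀ i j, blockUpper A C B (Fin.natAdd m i) (Fin.natAdd n j) = B i j) := by
  simp [blockUpper]

theorem isSylvesterRank_actionRank [Module.Finite K V] [Nontrivial V] :
    IsSylvesterRank (actionRank K V) := by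
  have hd : (0 : ℝ) < Module.finrank K V := by exact_mod_cast Module.finrank_pos
  have hupper : ∀ (m n p q : ℕ) (A : Matrix (Fin m) (Fin n) (Module.End K V)ᵐᵒᵖ)
      (C : Matrix (Fin m) (Fin q) (Module.End K V)ᵐᵒᵖ)
      (B : Matrix (Fin p) (Fin q) (Module.End K V)ᵐᵒᵖ), actionRank K V m n A + actionRank K V p q B ≤
        actionRank K V (m + p) (n + q) (blockUpper A C B) := by
    intro m n p q A C B
    obtain ⟨hb1, hb2, hb3, hb4⟩ := blockUpper_apply A C B
    unfold actionRank
    rw [← add_div]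
    refine div_le_div_of_nonneg_right ?_ hd.le
    norm_cast
    refine LinearMap.finrank_range_add_le_of_triangular
      (s := LinearMap.funLeft K V (Fin.castAdd p)) (p := LinearMap.funLeft K V (Fin.castAdd q))
      (i := rowInr K V m p) (j := rowInr K V n q) ?_ ?_ ?_ ?_ ?_
    · exact LinearMap.funLeft_surjective_of_injective _ _ _ (Fin.castAdd_injective m p)
    · intro v w hvw
      funext i
      simpa [rowInr] using congrFun hvw (Fin.natAdd n i)
    · refine LinearMap.ext fun v => ?_
      funext j
      simp [LinearMap.funLeft_apply, rowAct_apply, Fin.sum_univ_add, hb1, hb3]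
    · refine LinearMap.ext fun v => ?_
      funext x
      refine Fin.addCases (fun j => ?_) (fun j => ?_) x <;>
        simp [rowAct_apply, Fin.sum_univ_add, hb1, hb2, hb3, hb4, rowInr]
    · refine LinearMap.ext fun v => ?_
      funext j
      simp [LinearMap.funLeft_apply, rowInr]
  refine ⟨fun m n A => by unfold actionRank; positivity, fun m n => ?_, ?_, fun m n p A B => ?_,
    fun m n p q A B => le_antisymm ?_ (hupper _ _ _ _ _ _ _), hupper⟩
  · have : rowAct (0 : Matrix (Fin m) (Fin n) (Module.End K V)ᵐᵒᵖ) = 0 := by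
      refine LinearMap.ext fun v => ?_; funext j; simp [rowAct_apply]
    unfold actionRank
    rw [this, LinearMap.range_zero, finrank_bot, Nat.cast_zero, zero_div]
  · have : rowAct (1 : Matrix (Fin 1) (Fin 1) (Module.End K V)ᵐᵒᵖ) = LinearMap.id := by
      refine LinearMap.ext fun v => ?_; funext j; fin_cases j; simp [rowAct_apply]
    unfold actionRank
    rw [this, LinearMap.range_id, finrank_top, Module.finrank_pi_fintype]
    simp [hd.ne']
  · unfold actionRank
    refine le_min (div_le_div_of_nonneg_right ?_ hd.le) (div_le_div_of_nonneg_right ?_ hd.le) <;>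
      norm_cast <;> rw [rowAct_mul]
    · exact LinearMap.finrank_range_comp_le_right _ _
    · exact LinearMap.finrank_range_comp_le_left _ _
  · obtain ⟨hb1, hb2, hb3, hb4⟩ := blockUpper_apply A 0 B
    have : rowAct (blockUpper A 0 B) =
        rowInl K V n q ∘ₗ (rowAct A ∘ₗ LinearMap.funLeft K V (Fin.castAdd p)) +
        rowInr K V n q ∘ₗ (rowAct B ∘ₗ LinearMap.funLeft K V (Fin.natAdd m)) := by
      refine LinearMap.ext fun v => ?_
      funext x
      refine Fin.addCases (fun j => ?_) (fun j => ?_) x <;>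
        simp [rowAct_apply, Fin.sum_univ_add, hb1, hb2, hb3, hb4, rowInr, rowInl,
          LinearMap.funLeft_apply]
    unfold actionRank
    rw [← add_div]
    refine div_le_div_of_nonneg_right ?_ hd.le
    norm_cast
    rw [this]
    refine (LinearMap.finrank_range_add_le _ _).trans (Nat.add_le_add ?_ ?_) <;>
    exact (LinearMap.finrank_range_comp_le_right _ _).trans
      (LinearMap.finrank_range_comp_le_left _ _)

theorem elemRank_actionRank (a : (Module.End K V)ᵐᵒᵖ) : elemRank (actionRank K V) a =
    (Module.finrank K (LinearMap.range a.unop) : ℝ) / (Module.finrank K V : ℝ) := by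
  unfold elemRank actionRank
  congr 2
  let ε := LinearEquiv.funUnique (Fin 1) K V
  have : rowAct (Matrix.of fun _ _ : Fin 1 => a) =
      (ε.symm : V →ₗ[K] (Fin 1 → V)) ∘ₗ a.unop ∘ₗ (ε : (Fin 1 → V) →ₗ[K] V) := by
    refine LinearMap.ext fun v => ?_
    funext j
    simp [rowAct_apply, ε]
  rw [this, LinearMap.range_comp, LinearEquiv.finrank_map_eq, LinearMap.range_comp,
    LinearEquiv.range, Submodule.map_top]

/-- A section of `x` over its range, extended to the whole space, is a quasi-inverse of `x`. -/
theorem isVonNeumannRegularRing_end : IsVonNeumannRegularRing (Module.End K V)ᵐᵒᵖ := by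
  intro x
  obtain ⟨g, hg⟩ := x.unop.rangeRestrict.exists_rightInverse_of_surjective
    (LinearMap.range_rangeRestrict _)
  obtain ⟨g', hg'⟩ := LinearMap.exists_extend g
  refine ⟨op g', unop_injective (LinearMap.ext fun v => ?_)⟩
  have h1 : g' (x.unop v) = g (x.unop.rangeRestrict v) := congr($hg' (x.unop.rangeRestrict v))
  have h2 := congrArg Subtype.val (congr($hg (x.unop.rangeRestrict v)))
  change x.unop (g' (x.unop v)) = x.unop v
  rw [h1]
  exact h2

end actionRank

section dimRank

open MulOpposite

variable {K S : Type u} [DivisionRing K] [Ring S] (f : K →+* S)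

/-- A ring acting on itself by right multiplication. -/
def rightMul [Module K S] [IsScalarTower K S S] : S →+* (Module.End K S)ᵐᵒᵖ where
  toFun s := op
    { toFun := fun x => x * s
      map_add' := fun x y => add_mul x y s
      map_smul' := fun c x => smul_mul_assoc c x s }
  map_one' := unop_injective (LinearMap.ext fun x => mul_one x)
  map_mul' a b := unop_injective (LinearMap.ext fun x => (mul_assoc x a b).symm)
  map_zero' := unop_injective (LinearMap.ext fun x => mul_zero x)
  map_add' a b := unop_injective (LinearMap.ext fun x => mul_add x a b)

theorem isScalarTower_compHom : letI := Module.compHom S f; IsScalarTower K S S :=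
  letI := Module.compHom S f
  ⟨fun c x y => mul_assoc (f c) x y⟩

/-- Through this identity `dimRank` inherits both the Sylvester axioms and regularity from the
endomorphism ring. -/
theorem dimRank_eq_pullback : letI := Module.compHom S f
    letI := isScalarTower_compHom f
    dimRank f = pullbackRank (rightMul (K := K) (S := S)) (actionRank K S) := by
  let _ := Module.compHom S f
  let _ := isScalarTower_compHom f
  funext m n A
  have : rowMul f A = rowAct (A.map (rightMul (K := K) (S := S))) := by
    refine LinearMap.ext fun v => ?_
    funext j
    rw [rowAct_apply]
    rfl
  unfold dimRank pullbackRank actionRank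
  rw [this]

theorem divisionRank_eq_dimRank (E : Type u) [DivisionRing E] :
    divisionRank E = dimRank (RingHom.id E) := by
  funext m n A
  have h1 : dimRank (RingHom.id E) m n A =
    (Module.finrank E (LinearMap.range A.vecMulLinear) : ℝ) / (Module.finrank E E : ℝ) := rfl
  rw [h1, Module.finrank_self, Nat.cast_one, div_one]
  rfl

end dimRank

/-! ### The rank functions of the skew Laurent ring -/

section

variable {K S : Type u} [DivisionRing K] [Ring S] (f : K →+* S)

theorem isSylvesterRank_dimRank [Nontrivial S]
    (hfin : letI := Module.compHom S f; Module.Finite K S) : IsSylvesterRank (dimRank f) := by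
  let _ := Module.compHom S f
  let _ := isScalarTower_compHom f
  rw [dimRank_eq_pullback]
  exact isSylvesterRank_actionRank.pullback _

theorem dimRank_mem_regularSylvesterSpace [Nontrivial S]
    (hfin : letI := Module.compHom S f; Module.Finite K S) :
    dimRank f ∈ regularSylvesterSpace S := by
  let _ := Module.compHom S f
  let _ := isScalarTower_compHom f
  exact ⟨_, _, rightMul (K := K), actionRank K S, isVonNeumannRegularRing_end,
    isSylvesterRank_actionRank, dimRank_eq_pullback f⟩

theorem isSylvesterRank_divisionRank (E : Type u) [DivisionRing E] :
    IsSylvesterRank (divisionRank E) := by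
  rw [divisionRank_eq_dimRank]
  exact isSylvesterRank_dimRank _ (inferInstanceAs (Module.Finite E E))

theorem pullbackRank_mem_regularSylvesterSpace {R S : Type u} [Ring R] [Ring S] (φ : R →+* S)
    {rk : MatFun S} (h : rk ∈ regularSylvesterSpace S) :
    pullbackRank φ rk ∈ regularSylvesterSpace R := by
  obtain ⟨U, _, ψ, rk', hU, hrk', rfl⟩ := h
  exact ⟨U, _, ψ.comp φ, rk', hU, hrk', rfl⟩

/-- The kernel of right multiplication by `p` lies in the ranges of its powers below the `k`-th, so
each of the first `k` multiplications loses the same dimension, that of the kernel. After `k` of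
them nothing is left, so each loses a `k`-th part. -/
theorem elemRank_dimRank_pow [Nontrivial S] (hfin : letI := Module.compHom S f; Module.Finite K S)
    {p : S} {k : ℕ} (hk : k ≠ 0) (hp : p ^ k = 0)
    (hker : ∀ x, x * p = 0 → ∃ y, x = y * p ^ (k - 1)) {i : ℕ} (hi : i ≤ k) :
    elemRank (dimRank f) (p ^ i) = ((k : ℝ) - i) / k := by
  let _ := Module.compHom S f
  let _ := isScalarTower_compHom f
  let μ : Module.End K S := (rightMul (K := K) p).unop
  have hμ (i : ℕ) : (rightMul (K := K) (p ^ i)).unop = μ ^ i := by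
    rw [map_pow, MulOpposite.unop_pow]
  have hμ' (i : ℕ) (x : S) : (μ ^ i) x = x * p ^ i := by rw [← hμ]; rfl
  have h1 : ∀ i < k, LinearMap.ker μ ≤ LinearMap.range (μ ^ i) := by
    intro i hi x hx
    obtain ⟨y, rfl⟩ := hker x hx
    refine ⟨y * p ^ (k - 1 - i), ?_⟩
    rw [hμ', mul_assoc, ← pow_add, Nat.sub_add_cancel (by omega)]
  have h2 := LinearMap.finrank_range_pow_add μ h1 hi
  have h3 := LinearMap.finrank_range_pow_add μ h1 le_rfl
  have h4 : μ ^ k = 0 := LinearMap.ext fun x => by rw [hμ', hp, mul_zero]; rfl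
  rw [h4, LinearMap.range_zero, finrank_bot, zero_add] at h3
  have h5 : elemRank (dimRank f) (p ^ i) =
      (Module.finrank K (LinearMap.range (μ ^ i)) : ℝ) / (Module.finrank K S : ℝ) := by
    rw [dimRank_eq_pullback, ← hμ, ← elemRank_actionRank]
    rfl
  have hd : (Module.finrank K S : ℝ) ≠ 0 := by exact_mod_cast Module.finrank_pos.ne'
  rw [← h3] at h2
  have h6 : (Module.finrank K (LinearMap.range (μ ^ i)) : ℝ) =
      (k - i) * Module.finrank K (LinearMap.ker μ) := by
    have : ((Module.finrank K (LinearMap.range (μ ^ i)) +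
      i * Module.finrank K (LinearMap.ker μ) : ℕ) : ℝ) = (k * Module.finrank K (LinearMap.ker μ) : ℕ) :=
      by rw [h2]
    push_cast at this
    linear_combination this
  have hk' : (k : ℝ) ≠ 0 := by exact_mod_cast hk
  rw [← h3, Nat.cast_mul] at hd
  rw [h5, h6, ← h3, Nat.cast_mul, mul_div_mul_right _ _ (right_ne_zero_of_mul hd)]

end

namespace SkewLaurent

variable {D : Type u} [DivisionRing D] {τ : D ≃+* D}

theorem elemRank_pullbackRank {R S : Type u} [Ring R] [Ring S] (φ : R →+* S) (rk : MatFun S)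
    (a : R) : elemRank (pullbackRank φ rk) a = elemRank rk (φ a) := rfl

theorem isSylvesterRank_rankZero : IsSylvesterRank (rankZero τ) :=
  (isSylvesterRank_divisionRank _).pullback _

theorem rankZero_mem_regularSylvesterSpace : rankZero τ ∈ regularSylvesterSpace (SkewLaurent D τ) :=
  ⟨_, _, _, _, fun x => by
    by_cases hx : x = 0
    · exact ⟨0, by rw [hx, mul_zero]⟩
    · exact ⟨x⁻¹, by rw [mul_inv_cancel₀ hx, one_mul]⟩, isSylvesterRank_divisionRank _, rfl⟩

theorem elemRank_rankZero {a : SkewLaurent D τ} (ha : a ≠ 0) : elemRank (rankZero τ) a = 1 := by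
  have hu : IsUnit (OreLocalization.numeratorRingHom a :
      OreLocalization (SkewLaurent D τ)⁰ (SkewLaurent D τ)) :=
    OreLocalization.numerator_isUnit (⟨a, mem_nonZeroDivisors_of_ne_zero ha⟩ : (SkewLaurent D τ)⁰)
  unfold rankZero
  rw [elemRank_pullbackRank]
  exact (isSylvesterRank_divisionRank _).elem_isUnit hu

theorem finite_quotient {I : Ideal (SkewLaurent D τ)} [I.IsTwoSided] {e : SkewLaurent D τ}
    (he : e ≠ 0) (hI : e ∈ I) :
    letI := Module.compHom (SkewLaurent D τ ⧸ I) ((Ideal.Quotient.mk I).comp (C τ))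
    Module.Finite D (SkewLaurent D τ ⧸ I) := by
  let _ := Module.compHom (SkewLaurent D τ ⧸ I) ((Ideal.Quotient.mk I).comp (C τ))
  obtain ⟨w, hw⟩ := exists_finite_spanning he
  refine Module.Finite.of_surjective (Fintype.linearCombination D
    fun i : Fin w => Ideal.Quotient.mk I (mon τ i 1)) fun x => ?_
  obtain ⟨a, rfl⟩ := Ideal.Quotient.mk_surjective x
  obtain ⟨d, q, h⟩ := hw a
  refine ⟨d, ?_⟩
  conv_rhs => rw [h]
  rw [map_add, map_sum, Ideal.Quotient.eq_zero_iff_mem.2 (I.mul_mem_left q hI), add_zero,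
    Fintype.linearCombination_apply]
  simp only [map_mul]
  rfl

section

variable {𝔪 : MaxTwoSided (SkewLaurent D τ)} {p : Subring.center (SkewLaurent D τ)}
  (hp : Irreducible p) (h𝔪 : 𝔪.1 = Ideal.span {(p : SkewLaurent D τ)})

include h𝔪 in
theorem pow_eq_span (k : ℕ) : 𝔪.1 ^ k = Ideal.span {(p : SkewLaurent D τ) ^ k} := by
  have := isTwoSided_span_of_mem_center p.2
  rw [h𝔪, Ideal.span_singleton_pow]

theorem nontrivial_quotient_pow (𝔪 : MaxTwoSided (SkewLaurent D τ)) (k : ℕ+) :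
    Nontrivial (SkewLaurent D τ ⧸ 𝔪.1 ^ (k : ℕ)) :=
  Ideal.Quotient.nontrivial_iff.2 fun h => 𝔪.2.ne_top
    (top_le_iff.1 (h ▸ Ideal.pow_le_self k.ne_zero))

include hp h𝔪 in
theorem finite_quotient_pow (k : ℕ+) :
    letI := Module.compHom (SkewLaurent D τ ⧸ 𝔪.1 ^ (k : ℕ))
      ((Ideal.Quotient.mk (𝔪.1 ^ (k : ℕ))).comp (C τ))
    Module.Finite D (SkewLaurent D τ ⧸ 𝔪.1 ^ (k : ℕ)) :=
  finite_quotient (e := (p : SkewLaurent D τ) ^ (k : ℕ))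
    (pow_ne_zero _ fun h => hp.ne_zero (Subtype.ext h))
    (pow_eq_span h𝔪 k ▸ Ideal.mem_span_singleton_self _)

include hp h𝔪 in
theorem elemRank_rankMax_pow (k : ℕ+) {i : ℕ} (hi : i ≤ k) :
    elemRank (rankMax τ 𝔪 k) ((p : SkewLaurent D τ) ^ i) = ((k : ℝ) - i) / k := by
  have := nontrivial_quotient_pow 𝔪 k
  unfold rankMax
  rw [elemRank_pullbackRank, map_pow]
  refine elemRank_dimRank_pow _ (finite_quotient_pow hp h𝔪 k) k.ne_zero ?_ (fun x hx => ?_) hi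
  · rw [← map_pow, Ideal.Quotient.eq_zero_iff_mem, pow_eq_span h𝔪]
    exact Ideal.mem_span_singleton_self _
  -- As `R` is a domain, `x p ∈ R p ^ k` gives `x ∈ R p ^ (k - 1)` by cancelling `p`.
  · obtain ⟨x, rfl⟩ := Ideal.Quotient.mk_surjective x
    rw [← map_mul, Ideal.Quotient.eq_zero_iff_mem, pow_eq_span h𝔪,
      Ideal.mem_span_singleton'] at hx
    obtain ⟨y, hy⟩ := hx
    refine ⟨Ideal.Quotient.mk _ y, ?_⟩
    rw [← map_pow, ← map_mul]
    congr 1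
    refine mul_right_cancel₀ (fun h => hp.ne_zero (Subtype.ext h) : (p : SkewLaurent D τ) ≠ 0) ?_
    rw [← hy, mul_assoc, ← pow_succ, Nat.sub_add_cancel k.pos]

end

theorem isSylvesterRank_rankMax (hτ : HasFiniteInnerOrder τ) (𝔪 : MaxTwoSided (SkewLaurent D τ))
    (k : ℕ+) : IsSylvesterRank (rankMax τ 𝔪 k) := by
  obtain ⟨p, hp, h𝔪⟩ := exists_center_irreducible hτ 𝔪
  have := nontrivial_quotient_pow 𝔪 k
  exact (isSylvesterRank_dimRank _ (finite_quotient_pow hp h𝔪 k)).pullback _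

theorem rankMax_mem_regularSylvesterSpace (hτ : HasFiniteInnerOrder τ)
    (𝔪 : MaxTwoSided (SkewLaurent D τ)) (k : ℕ+) :
    rankMax τ 𝔪 k ∈ regularSylvesterSpace (SkewLaurent D τ) := by
  obtain ⟨p, hp, h𝔪⟩ := exists_center_irreducible hτ 𝔪
  have := nontrivial_quotient_pow 𝔪 k
  exact pullbackRank_mem_regularSylvesterSpace _
    (dimRank_mem_regularSylvesterSpace _ (finite_quotient_pow hp h𝔪 k))

theorem isSylvesterRank_rankFamily (hτ : HasFiniteInnerOrder τ) :
    ∀ j, IsSylvesterRank (rankFamily τ j)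
  | none => isSylvesterRank_rankZero
  | some (𝔪, k) => isSylvesterRank_rankMax hτ 𝔪 k

theorem rankFamily_mem_regularSylvesterSpace (hτ : HasFiniteInnerOrder τ) :
    ∀ j, rankFamily τ j ∈ regularSylvesterSpace (SkewLaurent D τ)
  | none => rankZero_mem_regularSylvesterSpace
  | some (𝔪, k) => rankMax_mem_regularSylvesterSpace hτ 𝔪 k

end SkewLaurent

/-! ### Second differences of bounded concave sequences -/

section secondDiff

open Finset Filter Topology

/-- The negative of the second difference of a sequence. -/
def secondDiff (f : ℕ → ℝ) (n : ℕ) : ℝ := 2 * f (n + 1) - f (n + 2) - f n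

variable {f : ℕ → ℝ}

/-- Summation by parts: as a function of `n + 1`, `min i (n + 1)` is the Green's function of the
second difference with zero boundary value at `0`. The last term is the boundary contribution at
`N`. -/
theorem sum_secondDiff_mul_min (h0 : f 0 = 0) (i N : ℕ) :
    ∑ n ∈ range N, secondDiff f n * (min i (n + 1) : ℕ) =
      f (min i N) - (min i N : ℕ) * (f (N + 1) - f N) := by
  induction N with
  | zero => simp [h0]
  | succ N ih =>
    rw [sum_range_succ, ih, secondDiff]
    rcases le_or_gt i N with hi | hi
    · rw [min_eq_left hi, min_eq_left (by omega)]
      ring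
    · rw [min_eq_right hi.le, min_eq_right (by omega)]
      push_cast
      ring

/-- A bounded monotone sequence has increments tending to zero, so the boundary contribution
disappears in the limit. -/
theorem hasSum_secondDiff_mul_min (h0 : f 0 = 0) (hmono : Monotone f) (hle : ∀ n, f n ≤ 1)
    (hconc : ∀ n, 0 ≤ secondDiff f n) (i : ℕ) :
    HasSum (fun n => secondDiff f n * (min i (n + 1) : ℕ)) (f i) := by
  rw [hasSum_iff_tendsto_nat_of_nonneg fun n => mul_nonneg (hconc n) (Nat.cast_nonneg _)]
  have h1 : Tendsto f atTop (𝓝 (⨆ n, f n)) :=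
    tendsto_atTop_ciSup hmono ⟨1, by rintro _ ⟨n, rfl⟩; exact hle n⟩
  have h2 : Tendsto (fun N => f i - (i : ℝ) * (f (N + 1) - f N)) atTop (𝓝 (f i)) := by
    have := ((h1.comp (tendsto_add_atTop_nat 1)).sub h1).const_mul (i : ℝ)
    simpa using this.const_sub (f i)
  refine h2.congr' ?_
  filter_upwards [eventually_ge_atTop i] with N hN
  rw [sum_secondDiff_mul_min h0, min_eq_left hN]

/-- Bounds the total coefficient attached to one prime by its defects: the case `i = N` of summation
by parts, with a boundary term of favourable sign. -/
theorem sum_mul_secondDiff_le (h0 : f 0 = 0) (hmono : Monotone f) (N : ℕ) :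
    ∑ n ∈ range N, ((n : ℝ) + 1) * secondDiff f n ≤ f N := by
  have h1 := sum_secondDiff_mul_min h0 N N
  rw [min_self] at h1
  have h2 : ∑ n ∈ range N, ((n : ℝ) + 1) * secondDiff f n =
      ∑ n ∈ range N, secondDiff f n * (min N (n + 1) : ℕ) := by
    refine sum_congr rfl fun n hn => ?_
    rw [min_eq_right (by have := mem_range.1 hn; omega)]
    push_cast
    ring
  rw [h2, h1]
  have : 0 ≤ (N : ℝ) * (f (N + 1) - f N) :=
    mul_nonneg (Nat.cast_nonneg _) (sub_nonneg.2 (hmono (Nat.le_succ N)))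
  linarith

/-- As a function of `i`, `min i (m + 1)` is linear except for a corner at `i = m + 1`, so the
second difference at `n` isolates the coefficient with index `n`. -/
theorem eq_mul_secondDiff_of_hasSum {c : ℕ → ℝ}
    (h : ∀ i, HasSum (fun n => c n * ((min i (n + 1) : ℕ) / ((n : ℝ) + 1))) (f i)) (n : ℕ) :
    c n = ((n : ℝ) + 1) * secondDiff f n := by
  have h1 := (((h (n + 1)).mul_left 2).sub (h (n + 2))).sub (h n)
  have h2 : HasSum (fun m => if m = n then c n / ((n : ℝ) + 1) else 0) (secondDiff f n) := by
    refine (iff_of_eq (congrArg (fun g => HasSum g _) (funext fun m => ?_))).1 h1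
    rcases lt_trichotomy m n with hm | rfl | hm
    · rw [if_neg hm.ne, min_eq_right (by omega), min_eq_right (by omega), min_eq_right (by omega)]
      ring
    · rw [if_pos rfl, min_self, min_eq_right (by omega), min_eq_left (by omega)]
      push_cast
      field_simp
      ring
    · rw [if_neg hm.ne', min_eq_left (by omega), min_eq_left (by omega), min_eq_left (by omega)]
      push_cast
      ring
  have h3 := h2.unique (hasSum_ite_eq n _)
  rw [h3]
  field_simp

end secondDiff

/-! ### Defects of rank functions on commutative rings. -/

namespace IsSylvesterRank

variable {A : Type u} [CommRing A] {rk : MatFun A} (h : IsSylvesterRank rk)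

include h in
theorem elem_le_of_dvd {a b : A} (hab : a ∣ b) : elemRank rk b ≤ elemRank rk a := by
  obtain ⟨c, rfl⟩ := hab
  exact h.elem_mul_le_left a c

include h in
theorem elem_eq_of_associated {a b : A} (hab : Associated a b) : elemRank rk a = elemRank rk b :=
  le_antisymm (h.elem_le_of_dvd hab.dvd') (h.elem_le_of_dvd hab.dvd)

include h in
theorem elem_eq_one_of_isCoprime {a b : A} (hab : IsCoprime a b) (ha : elemRank rk a = 0) :
    elemRank rk b = 1 := by
  have h1 := h.elem_add_of_isCoprime hab
  have h2 := h.elem_nonneg (a * b)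
  exact le_antisymm (h.elem_le_one b) (by linarith)

include h in
-- Being the defect of a single element, such a sum is at most `1`; this is what bounds the total
-- mass of the coefficients over all primes.
theorem sum_one_sub_elem {ι : Type*} [DecidableEq ι] (s : Finset ι) (a : ι → A)
    (ha : ∀ i ∈ s, ∀ j ∈ s, i ≠ j → IsCoprime (a i) (a j)) :
    ∑ i ∈ s, (1 - elemRank rk (a i)) = 1 - elemRank rk (∏ i ∈ s, a i) := by
  induction s using Finset.induction_on with
  | empty => simp [h.elem_one]
  | insert i s hi ih =>
    rw [Finset.sum_insert hi, Finset.prod_insert hi, ih fun x hx y hy => ha x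
      (Finset.mem_insert_of_mem hx) y (Finset.mem_insert_of_mem hy)]
    have := h.elem_add_of_isCoprime (IsCoprime.prod_right (t := s) (s := a) (x := a i) fun j hj =>
      ha i (Finset.mem_insert_self i s) j (Finset.mem_insert_of_mem hj) (by rintro rfl; exact hi hj))
    linarith

include h in
theorem monotone_one_sub_elem_pow (p : A) : Monotone fun i : ℕ => 1 - elemRank rk (p ^ i) :=
  fun _ _ hij => sub_le_sub_left (h.elem_le_of_dvd (pow_dvd_pow p hij)) 1

include h in
theorem secondDiff_one_sub_elem_pow (p : A) (n : ℕ) :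
    0 ≤ secondDiff (fun i : ℕ => 1 - elemRank rk (p ^ i)) n := by
  have := h.elem_mul_add_le p p (p ^ n)
  rw [mul_assoc, ← pow_succ', ← pow_succ'] at this
  unfold secondDiff
  linarith

end IsSylvesterRank

/-! ### Central primes and the values of the family on them. -/

namespace SkewLaurent

variable {D : Type u} [DivisionRing D] {τ : D ≃+* D} {p q : Subring.center (SkewLaurent D τ)}

theorem span_eq_of_associated (h : Associated p q) :
    Ideal.span {(p : SkewLaurent D τ)} = Ideal.span {(q : SkewLaurent D τ)} := by
  have key : ∀ {p q : Subring.center (SkewLaurent D τ)}, p ∣ q →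
      Ideal.span {(q : SkewLaurent D τ)} ≤ Ideal.span {(p : SkewLaurent D τ)} := by
    rintro p _ ⟨c, rfl⟩
    rw [Ideal.span_singleton_le_iff_mem, mul_comm]
    exact Ideal.mem_span_singleton'.2 ⟨c, rfl⟩
  exact le_antisymm (key h.dvd') (key h.dvd)

theorem associated_of_span_eq (hp : p ≠ 0) (hq : q ≠ 0)
    (h : Ideal.span {(p : SkewLaurent D τ)} = Ideal.span {(q : SkewLaurent D τ)}) :
    Associated p q := by
  have key : ∀ {p q : Subring.center (SkewLaurent D τ)}, p ≠ 0 →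
      (q : SkewLaurent D τ) ∈ Ideal.span {(p : SkewLaurent D τ)} → p ∣ q := by
    intro p q hp hq
    obtain ⟨x, hx⟩ := Ideal.mem_span_singleton'.1 hq
    have hxc : x ∈ Subring.center (SkewLaurent D τ) :=
      mem_center_of_mul p.2 (fun h => hp (Subtype.ext h)) (hx ▸ q.2)
    exact ⟨⟨x, hxc⟩, by rw [mul_comm]; exact Subtype.ext hx.symm⟩
  exact associated_of_dvd_dvd (key hp (h ▸ Ideal.mem_span_singleton_self _))
    (key hq (h ▸ Ideal.mem_span_singleton_self _))

theorem isCoprime_of_span_ne (hp : Irreducible p) (hq : Irreducible q)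
    (h : Ideal.span {(p : SkewLaurent D τ)} ≠ Ideal.span {(q : SkewLaurent D τ)}) :
    IsCoprime p q :=
  hp.coprime_iff_not_dvd.2 fun hd => h (span_eq_of_associated (hp.associated_of_dvd hq hd))

theorem elemRank_eq_zero_of_le {rk : MatFun (SkewLaurent D τ)} (h : IsSylvesterRank rk)
    {a : SkewLaurent D τ} {k i : ℕ} (h0 : elemRank rk (a ^ k) = 0) (hi : k ≤ i) :
    elemRank rk (a ^ i) = 0 := by
  refine le_antisymm ?_ (h.elem_nonneg _)
  rw [← h0, ← Nat.sub_add_cancel hi, pow_add]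
  exact h.elem_mul_le_right _ _

/-- A rank function killing a power of `p` takes the value one on powers of the other primes. -/
theorem elemRank_pow_eq_one_of_ne {rk : MatFun (SkewLaurent D τ)} (h : IsSylvesterRank rk)
    (hp : Irreducible p) (hq : Irreducible q)
    (hpq : Ideal.span {(p : SkewLaurent D τ)} ≠ Ideal.span {(q : SkewLaurent D τ)}) {k : ℕ}
    (h0 : elemRank rk ((p : SkewLaurent D τ) ^ k) = 0) (i : ℕ) :
    elemRank rk ((q : SkewLaurent D τ) ^ i) = 1 :=
  (h.pullback (Subring.center (SkewLaurent D τ)).subtype).elem_eq_one_of_isCoprime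
    (a := p ^ k) (b := q ^ i) (isCoprime_of_span_ne hp hq hpq).pow h0

section

variable (hτ : HasFiniteInnerOrder τ)

/-- A central generator of a maximal two-sided ideal. -/
noncomputable def centerGen (𝔪 : MaxTwoSided (SkewLaurent D τ)) :
    Subring.center (SkewLaurent D τ) :=
  (exists_center_irreducible hτ 𝔪).choose

theorem irreducible_centerGen (𝔪 : MaxTwoSided (SkewLaurent D τ)) :
    Irreducible (centerGen hτ 𝔪) :=
  (exists_center_irreducible hτ 𝔪).choose_spec.1

theorem eq_span_centerGen (𝔪 : MaxTwoSided (SkewLaurent D τ)) :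
    𝔪.1 = Ideal.span {(centerGen hτ 𝔪 : SkewLaurent D τ)} :=
  (exists_center_irreducible hτ 𝔪).choose_spec.2

theorem one_sub_elemRank_rankMax (𝔪 : MaxTwoSided (SkewLaurent D τ)) (k : ℕ+) (i : ℕ) :
    1 - elemRank (rankMax τ 𝔪 k) ((centerGen hτ 𝔪 : SkewLaurent D τ) ^ i) =
      (min i k : ℕ) / (k : ℝ) := by
  have hp := irreducible_centerGen hτ 𝔪
  have h𝔪 := eq_span_centerGen hτ 𝔪
  have hk : (k : ℝ) ≠ 0 := by exact_mod_cast k.ne_zero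
  rcases le_total i k with hi | hi
  · rw [elemRank_rankMax_pow hp h𝔪 k hi, min_eq_left hi]
    field_simp
    ring
  · rw [elemRank_eq_zero_of_le (isSylvesterRank_rankMax hτ 𝔪 k) (k := k) ?_ hi, min_eq_right hi]
    · field_simp
      ring
    · rw [elemRank_rankMax_pow hp h𝔪 k le_rfl, sub_self, zero_div]

theorem one_sub_elemRank_rankMax_of_ne {𝔪 𝔪' : MaxTwoSided (SkewLaurent D τ)} (h : 𝔪 ≠ 𝔪') (k : ℕ+)
    (i : ℕ) : 1 - elemRank (rankMax τ 𝔪 k) ((centerGen hτ 𝔪' : SkewLaurent D τ) ^ i) = 0 := by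
  rw [elemRank_pow_eq_one_of_ne (isSylvesterRank_rankMax hτ 𝔪 k) (irreducible_centerGen hτ 𝔪)
    (irreducible_centerGen hτ 𝔪') (k := k) ?_, sub_self]
  · rw [elemRank_rankMax_pow (irreducible_centerGen hτ 𝔪) (eq_span_centerGen hτ 𝔪) k le_rfl,
      sub_self, zero_div]
  · rw [← eq_span_centerGen, ← eq_span_centerGen]
    exact fun h0 => h (Subtype.ext h0)

/-- The values of an infinite convex combination at the powers of a central prime. -/
theorem hasSum_mul_one_sub_elemRank_iff (c : Option (MaxTwoSided (SkewLaurent D τ) × ℕ+) → ℝ)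
    (𝔪 : MaxTwoSided (SkewLaurent D τ)) (i : ℕ) (x : ℝ) :
    HasSum (fun j => c j * (1 - elemRank (rankFamily τ j)
      ((centerGen hτ 𝔪 : SkewLaurent D τ) ^ i))) x ↔
    HasSum (fun n : ℕ => c (some (𝔪, n.succPNat)) * ((min i (n + 1) : ℕ) / ((n : ℝ) + 1))) x := by
  -- Only the indices `(𝔪, n + 1)` contribute: `rk₀` and the functions of the other maximal ideals
  -- take the value `1` at powers of the generator of `𝔪`.
  have hinj : Function.Injective fun n : ℕ => some (𝔪, n.succPNat) := fun a b hab => by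
    simpa using hab
  rw [← hinj.hasSum_iff]
  · refine iff_of_eq (congrArg (fun g => HasSum g x) (funext fun n => ?_))
    change c (some (𝔪, n.succPNat)) * (1 - elemRank (rankMax τ 𝔪 n.succPNat) _) = _
    rw [one_sub_elemRank_rankMax]
    simp
  · rintro (_ | ⟨𝔪', k⟩) hj
    · change c none * (1 - elemRank (rankZero τ) _) = 0
      rw [elemRank_rankZero, sub_self, mul_zero]
      exact pow_ne_zero _ fun h => (irreducible_centerGen hτ 𝔪).ne_zero (Subtype.ext h)
    · change c (some (𝔪', k)) * (1 - elemRank (rankMax τ 𝔪' k) _) = 0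
      rw [one_sub_elemRank_rankMax_of_ne, mul_zero]
      rintro rfl
      exact hj ⟨k.natPred, by simp⟩

end

end SkewLaurent

/-! ### Convex combinations -/

theorem HasSum.option_elim {α : Type*} {b : α → ℝ} {s : ℝ} (hb : HasSum b s) (a : ℝ) :
    HasSum (fun j : Option α => j.elim a b) (a + s) := by
  classical
  have h1 : HasSum (fun j : Option α => j.elim 0 b) s := by
    rw [← (Option.some_injective _).hasSum_iff]
    · exact hb
    · rintro (_ | x) hx
      · rfl
      · exact absurd ⟨x, rfl⟩ hx
  refine (iff_of_eq (congrArg (fun g => HasSum g _) (funext fun j => ?_))).1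
    ((hasSum_ite_eq (none : Option α) a).add h1)
  rcases j with _ | x
  · simp
  · simp

/-! ### Existence and uniqueness of the coefficients, and the restriction to the centre. -/

namespace SkewLaurent

variable {D : Type u} [DivisionRing D] {τ : D ≃+* D}

theorem irreducible_of_eq_span (hτ : HasFiniteInnerOrder τ) {𝔪 : MaxTwoSided (SkewLaurent D τ)}
    {p : Subring.center (SkewLaurent D τ)} (h𝔪 : 𝔪.1 = Ideal.span {(p : SkewLaurent D τ)}) :
    Irreducible p := by
  refine (isMaximalTwoSided_span_iff fun h0 => MaxTwoSided.ne_bot hτ 𝔪 ?_).1 (h𝔪 ▸ 𝔪.2)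
  rw [h𝔪, h0, Ideal.span_singleton_eq_bot]
  rfl

/-- The prescribed values include `rk(p ^ k) = 0`, and then coprimality forces the value `1` at
powers of all other central primes. So all values at prime powers are known. -/
theorem eq_rankMax (hτ : HasFiniteInnerOrder τ) {𝔪 : MaxTwoSided (SkewLaurent D τ)}
    {p : Subring.center (SkewLaurent D τ)} (h𝔪 : 𝔪.1 = Ideal.span {(p : SkewLaurent D τ)}) {k : ℕ+}
    {rk : MatFun (SkewLaurent D τ)} (h : IsSylvesterRank rk)
    (hval : ∀ i : ℕ, i ≤ k → elemRank rk ((p : SkewLaurent D τ) ^ i) = ((k : ℝ) - i) / k) :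
    rk = rankMax τ 𝔪 k := by
  have hp := irreducible_of_eq_span hτ h𝔪
  have h' := isSylvesterRank_rankMax hτ 𝔪 k
  have hval' := fun i : ℕ => elemRank_rankMax_pow hp h𝔪 k (i := i)
  have h0 : elemRank rk ((p : SkewLaurent D τ) ^ (k : ℕ)) = 0 := by
    rw [hval k le_rfl, sub_self, zero_div]
  have h0' : elemRank (rankMax τ 𝔪 k) ((p : SkewLaurent D τ) ^ (k : ℕ)) = 0 := by
    rw [hval' k le_rfl, sub_self, zero_div]
  have hp_eq (i : ℕ) : elemRank rk ((p : SkewLaurent D τ) ^ i) =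
      elemRank (rankMax τ 𝔪 k) ((p : SkewLaurent D τ) ^ i) := by
    rcases le_total i k with hi | hi
    · rw [hval i hi, hval' i hi]
    · rw [elemRank_eq_zero_of_le h h0 hi, elemRank_eq_zero_of_le h' h0' hi]
  refine eq_of_elemRank_pow_eq_of_irreducible h h' fun q hq i => ?_
  by_cases hpq : Ideal.span {(p : SkewLaurent D τ)} = Ideal.span {(q : SkewLaurent D τ)}
  · have hass : Associated (q ^ i) (p ^ i) :=
      (associated_of_span_eq hq.ne_zero hp.ne_zero hpq.symm).pow_pow
    exact ((h.pullback (Subring.center (SkewLaurent D τ)).subtype).elem_eq_of_associated hass).trans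
      ((hp_eq i).trans ((h'.pullback
        (Subring.center (SkewLaurent D τ)).subtype).elem_eq_of_associated hass).symm)
  · rw [elemRank_pow_eq_one_of_ne h hp hq hpq h0, elemRank_pow_eq_one_of_ne h' hp hq hpq h0']

theorem sum_defect_le (hτ : HasFiniteInnerOrder τ) {rk : MatFun (Subring.center (SkewLaurent D τ))}
    (h : IsSylvesterRank rk) (s : Finset (MaxTwoSided (SkewLaurent D τ))) (N : ℕ) :
    ∑ 𝔪 ∈ s, (1 - elemRank rk (centerGen hτ 𝔪 ^ N)) ≤ 1 := by
  classical
  rw [h.sum_one_sub_elem s _ fun 𝔪 _ 𝔪' _ hne => (isCoprime_of_span_ne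
    (irreducible_centerGen hτ 𝔪) (irreducible_centerGen hτ 𝔪') fun h0 => hne (Subtype.ext ?_)).pow]
  · linarith [h.elem_nonneg (∏ 𝔪 ∈ s, centerGen hτ 𝔪 ^ N)]
  · rw [eq_span_centerGen hτ 𝔪, h0, ← eq_span_centerGen]

theorem exists_coeff (hτ : HasFiniteInnerOrder τ)
    {rk : MatFun (Subring.center (SkewLaurent D τ))} (h : IsSylvesterRank rk) :
    ∃ c : Option (MaxTwoSided (SkewLaurent D τ) × ℕ+) → ℝ, (∀ j, 0 ≤ c j) ∧ HasSum c 1 ∧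
      ∀ 𝔪 (i : ℕ), HasSum (fun j => c j * (1 - elemRank (rankFamily τ j)
        ((centerGen hτ 𝔪 : SkewLaurent D τ) ^ i))) (1 - elemRank rk (centerGen hτ 𝔪 ^ i)) := by
  classical
  let f (𝔪 : MaxTwoSided (SkewLaurent D τ)) (i : ℕ) : ℝ := 1 - elemRank rk (centerGen hτ 𝔪 ^ i)
  have f0 𝔪 : f 𝔪 0 = 0 := by simp only [f, pow_zero, h.elem_one, sub_self]
  have fmono 𝔪 : Monotone (f 𝔪) := h.monotone_one_sub_elem_pow _
  have fconc 𝔪 n : 0 ≤ secondDiff (f 𝔪) n := h.secondDiff_one_sub_elem_pow _ n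
  have fle 𝔪 n : f 𝔪 n ≤ 1 := sub_le_self _ (h.elem_nonneg _)
  -- The coefficient of `rk_{𝔪,n+1}` is `n + 1` times the negative second difference at `n`: the
  -- factor undoes the denominator in `min(i, n + 1) / (n + 1)`.
  let b : MaxTwoSided (SkewLaurent D τ) × ℕ → ℝ := fun x => ((x.2 : ℝ) + 1) * secondDiff (f x.1) x.2
  have b0 x : 0 ≤ b x := mul_nonneg (by positivity) (fconc _ _)
  have bsum : ∀ s : Finset (MaxTwoSided (SkewLaurent D τ) × ℕ), ∑ x ∈ s, b x ≤ 1 := by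
    intro s
    let N := s.sup fun x => x.2 + 1
    have hs : s ⊆ s.image Prod.fst ×ˢ Finset.range N := fun x hx =>
      Finset.mem_product.2 ⟨Finset.mem_image_of_mem _ hx, Finset.mem_range.2
        (Nat.lt_of_succ_le (Finset.le_sup (f := fun x => x.2 + 1) hx))⟩
    refine (Finset.sum_le_sum_of_subset_of_nonneg hs fun x _ _ => b0 x).trans ?_
    rw [Finset.sum_product]
    exact (Finset.sum_le_sum fun 𝔪 _ => sum_mul_secondDiff_le (f0 𝔪) (fmono 𝔪) N).trans
      (sum_defect_le hτ h _ N)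
  have hb : Summable b := summable_of_sum_le b0 bsum
  have hb1 : ∑' x, b x ≤ 1 := Real.tsum_le_of_sum_le b0 bsum
  let ε : MaxTwoSided (SkewLaurent D τ) × ℕ+ ≃ MaxTwoSided (SkewLaurent D τ) × ℕ :=
    Equiv.prodCongr (Equiv.refl _) Equiv.pnatEquivNat
  -- The missing mass goes to `rk₀`, which has no defect at any prime and so leaves the required
  -- values unchanged.
  let c : Option (MaxTwoSided (SkewLaurent D τ) × ℕ+) → ℝ := fun j => j.elim (1 - ∑' x, b x) (b ∘ ε)
  refine ⟨c, fun j => ?_, ?_, fun 𝔪 i => ?_⟩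
  · rcases j with _ | x
    · exact sub_nonneg.2 hb1
    · exact b0 _
  · have := (ε.hasSum_iff.2 hb.hasSum).option_elim (1 - ∑' x, b x)
    rwa [sub_add_cancel] at this
  · rw [hasSum_mul_one_sub_elemRank_iff]
    refine (iff_of_eq (congrArg (fun g => HasSum g _) (funext fun n => ?_))).1
      (hasSum_secondDiff_mul_min (f0 𝔪) (fmono 𝔪) (fle 𝔪) (fconc 𝔪) i)
    have hn : (n : ℝ) + 1 ≠ 0 := by positivity
    have hcn : c (some (𝔪, n.succPNat)) = ((n : ℝ) + 1) * secondDiff (f 𝔪) n := by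
      change (((n.succPNat.natPred : ℕ) : ℝ) + 1) * secondDiff (f 𝔪) n.succPNat.natPred = _
      rw [Nat.natPred_succPNat]
    rw [hcn]
    field_simp

theorem hasSum_one_sub_elemRank {J : Type*} {R : Type u} [Ring R] {rk : J → MatFun R}
    {rk' : MatFun R} {c : J → ℝ} (hc : HasSum c 1)
    (h : ∀ (m n : ℕ) (A : Matrix (Fin m) (Fin n) R), HasSum (fun j => c j * rk j m n A) (rk' m n A))
    (a : R) : HasSum (fun j => c j * (1 - elemRank (rk j) a)) (1 - elemRank rk' a) := by
  simp only [mul_sub, mul_one]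
  exact hc.sub (h 1 1 _)

/-- Every rank function on the centre is the restriction of a convex combination. -/
theorem exists_pullback_tsum_eq (hτ : HasFiniteInnerOrder τ)
    {rk : MatFun (Subring.center (SkewLaurent D τ))} (h : IsSylvesterRank rk) :
    ∃ c : Option (MaxTwoSided (SkewLaurent D τ) × ℕ+) → ℝ, (∀ j, 0 ≤ c j) ∧ HasSum c 1 ∧
      pullbackRank (Subring.center (SkewLaurent D τ)).subtype
        (fun m n A => ∑' j, c j * rankFamily τ j m n A) = rk := by
  obtain ⟨c, hc0, hc1, hc⟩ := exists_coeff hτ h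
  have hF := isSylvesterRank_rankFamily hτ
  have hS := IsSylvesterRank.tsum hF hc0 hc1
  refine ⟨c, hc0, hc1, eq_of_elemRank_pow_eq_center (hS.pullback _) h fun p hp i => ?_⟩
  let 𝔪 : MaxTwoSided (SkewLaurent D τ) := ⟨_, (isMaximalTwoSided_span_iff hp.ne_zero).2 hp⟩
  have hass : Associated (p ^ i) (centerGen hτ 𝔪 ^ i) :=
    (associated_of_span_eq hp.ne_zero (irreducible_centerGen hτ 𝔪).ne_zero
      (eq_span_centerGen hτ 𝔪)).pow_pow
  rw [(hS.pullback _).elem_eq_of_associated hass, h.elem_eq_of_associated hass]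
  have h1 := (hasSum_one_sub_elemRank hc1 (fun m n A => (IsSylvesterRank.summable_mul hF hc0
    hc1.summable A).hasSum) ((centerGen hτ 𝔪 : SkewLaurent D τ) ^ i)).unique (hc 𝔪 i)
  exact sub_right_injective h1

theorem eq_of_pullback_center_eq {rk rk' : MatFun (SkewLaurent D τ)} (h : IsSylvesterRank rk)
    (h' : IsSylvesterRank rk')
    (heq : pullbackRank (Subring.center (SkewLaurent D τ)).subtype rk =
      pullbackRank (Subring.center (SkewLaurent D τ)).subtype rk') : rk = rk' :=
  eq_of_elemRank_pow_eq_of_irreducible h h' fun p _ i => congrArg (elemRank · (p ^ i)) heq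

theorem bijOn_pullback_center (hτ : HasFiniteInnerOrder τ) :
    Set.BijOn (pullbackRank (Subring.center (SkewLaurent D τ)).subtype)
      (sylvesterSpace (SkewLaurent D τ))
      (sylvesterSpace (Subring.center (SkewLaurent D τ))) := by
  refine ⟨fun rk h => IsSylvesterRank.pullback _ h, fun rk h rk' h' => eq_of_pullback_center_eq h h',
    fun rk h => ?_⟩
  obtain ⟨c, hc0, hc1, hc⟩ := exists_pullback_tsum_eq hτ h
  exact ⟨_, IsSylvesterRank.tsum (isSylvesterRank_rankFamily hτ) hc0 hc1, hc⟩

theorem exists_hasSum_rankFamily (hτ : HasFiniteInnerOrder τ) {rk : MatFun (SkewLaurent D τ)}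
    (h : IsSylvesterRank rk) : ∃ c : Option (MaxTwoSided (SkewLaurent D τ) × ℕ+) → ℝ,
      (∀ j, 0 ≤ c j) ∧ HasSum c 1 ∧
      ∀ (m n : ℕ) (A : Matrix (Fin m) (Fin n) (SkewLaurent D τ)),
        HasSum (fun j => c j * rankFamily τ j m n A) (rk m n A) := by
  obtain ⟨c, hc0, hc1, hc⟩ := exists_pullback_tsum_eq hτ
    (h.pullback (Subring.center (SkewLaurent D τ)).subtype)
  have hF := isSylvesterRank_rankFamily hτ
  have heq := eq_of_pullback_center_eq (IsSylvesterRank.tsum hF hc0 hc1) h hc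
  refine ⟨c, hc0, hc1, fun m n A => ?_⟩
  rw [← heq]
  exact (IsSylvesterRank.summable_mul hF hc0 hc1.summable A).hasSum

/-- Second differences of the defects of `rk` recover the coefficients of the `rk_{𝔪,k}`; that of
`rk₀` then follows because the total is `1`. -/
theorem coeff_unique (hτ : HasFiniteInnerOrder τ) {rk : MatFun (SkewLaurent D τ)}
    {c c' : Option (MaxTwoSided (SkewLaurent D τ) × ℕ+) → ℝ} (hc1 : HasSum c 1) (hc1' : HasSum c' 1)
    (hc : ∀ (m n : ℕ) (A : Matrix (Fin m) (Fin n) (SkewLaurent D τ)),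
      HasSum (fun j => c j * rankFamily τ j m n A) (rk m n A))
    (hc' : ∀ (m n : ℕ) (A : Matrix (Fin m) (Fin n) (SkewLaurent D τ)),
      HasSum (fun j => c' j * rankFamily τ j m n A) (rk m n A)) : c = c' := by
  have key : ∀ {c : Option (MaxTwoSided (SkewLaurent D τ) × ℕ+) → ℝ}, HasSum c 1 →
      (∀ (m n : ℕ) (A : Matrix (Fin m) (Fin n) (SkewLaurent D τ)),
        HasSum (fun j => c j * rankFamily τ j m n A) (rk m n A)) → ∀ 𝔪 (n : ℕ),
      c (some (𝔪, n.succPNat)) = ((n : ℝ) + 1) * secondDiff (fun i : ℕ =>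
        1 - elemRank rk ((centerGen hτ 𝔪 : SkewLaurent D τ) ^ i)) n := fun hc1 hc 𝔪 =>
    eq_mul_secondDiff_of_hasSum (c := fun n => _) fun i => (hasSum_mul_one_sub_elemRank_iff hτ _ 𝔪 i _).1
      (hasSum_one_sub_elemRank hc1 hc _)
  have hsome : ∀ x, c (some x) = c' (some x) := by
    rintro ⟨𝔪, k⟩
    have h1 := key hc1 hc 𝔪 k.natPred
    have h2 := key hc1' hc' 𝔪 k.natPred
    rw [PNat.succPNat_natPred] at h1 h2
    rw [h1, h2]
  have hnone : c none - c' none = 0 := by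
    have h1 := hc1.sub hc1'
    rw [sub_self] at h1
    exact (hasSum_single none fun j hj => by
      rcases j with _ | x
      · exact absurd rfl hj
      · rw [hsome, sub_self]).unique h1
  funext j
  rcases j with _ | x
  · exact sub_eq_zero.1 hnone
  · exact hsome x

end SkewLaurent

/-! ### Extreme points of families of infinite convex combinations -/

/-- Pure convexity. An extreme `rk` whose expansion has `c j > 0` is a mixture of `F j` and the
renormalized rest, so it equals `F j`. Conversely, if `F j` is a proper mixture of `x₁` and `x₂`,
mixing their expansions must give the indicator of `j`; non-negativity then makes both expansions
the indicator of `j`. -/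
theorem extremePoints_eq_range_of_unique_combination {R : Type u} [Ring R] {J : Type*}
    {F : J → MatFun R} (hF : ∀ j, IsSylvesterRank (F j))
    (hex : ∀ rk ∈ sylvesterSpace R, ∃ c : J → ℝ, (∀ j, 0 ≤ c j) ∧ HasSum c 1 ∧
      ∀ (m n : ℕ) (A : Matrix (Fin m) (Fin n) R), HasSum (fun j => c j * F j m n A) (rk m n A))
    (huniq : ∀ (rk : MatFun R) (c c' : J → ℝ), HasSum c 1 → HasSum c' 1 →
      (∀ (m n : ℕ) (A : Matrix (Fin m) (Fin n) R), HasSum (fun j => c j * F j m n A) (rk m n A)) →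
      (∀ (m n : ℕ) (A : Matrix (Fin m) (Fin n) R), HasSum (fun j => c' j * F j m n A) (rk m n A)) →
      c = c') :
    (sylvesterSpace R).extremePoints ℝ = Set.range F := by
  classical
  have hsingle : ∀ (j : J) (x : J → ℝ), HasSum (fun i => (if i = j then (1 : ℝ) else 0) * x i) (x j) :=
    fun j x => by
      have := hasSum_single (f := fun i => (if i = j then (1 : ℝ) else 0) * x i) j fun i hi => by
        rw [if_neg hi, zero_mul]
      simpa using this
  refine Set.Subset.antisymm (fun rk hrk => ?_) ?_
  · rw [mem_extremePoints_iff_left] at hrk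
    obtain ⟨hS, hext⟩ := hrk
    obtain ⟨c, hc0, hc1, hc⟩ := hex rk hS
    obtain ⟨j, hj⟩ : ∃ j, c j ≠ 0 := by
      by_contra! hcon
      rw [show c = 0 from funext hcon] at hc1
      exact zero_ne_one (hasSum_zero.unique hc1)
    have hjpos : 0 < c j := (hc0 j).lt_of_ne' hj
    have hupd : ∀ (x : J → ℝ) (s : ℝ), HasSum (fun i => c i * x i) s →
        HasSum (fun i => (if i = j then 0 else c i) * x i) (s - c j * x j) := by
      intro x s hs
      have := hs.sub (hasSum_ite_eq j (c j * x j))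
      refine (iff_of_eq (congrArg (fun g => HasSum g _) (funext fun i => ?_))).1 this
      by_cases hi : i = j
      · subst hi; simp
      · simp [hi]
    have hupd1 : HasSum (fun i => if i = j then 0 else c i) (1 - c j) := by
      simpa using hupd 1 1 (by simpa using hc1)
    have hle : c j ≤ 1 := le_hasSum hc1 j fun i _ => hc0 i
    refine ⟨j, ?_⟩
    rcases hle.lt_or_eq with hlt | heq
    · have hpos : 0 < 1 - c j := sub_pos.2 hlt
      let c' : J → ℝ := fun i => (1 - c j)⁻¹ * if i = j then 0 else c i
      have hc'0 : ∀ i, 0 ≤ c' i := fun i => mul_nonneg (inv_nonneg.2 hpos.le) (by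
        by_cases hi : i = j
        · simp [hi]
        · simpa [hi] using hc0 i)
      have hc'1 : HasSum c' 1 := by
        have := hupd1.mul_left (1 - c j)⁻¹
        rwa [inv_mul_cancel₀ hpos.ne'] at this
      refine hext (F j) (hF j) _ (IsSylvesterRank.tsum hF hc'0 hc'1)
        ⟨c j, 1 - c j, hjpos, hpos, by ring, ?_⟩
      funext m n A
      have h1 : HasSum (fun i => c' i * F i m n A) ((1 - c j)⁻¹ * (rk m n A - c j * F j m n A)) := by
        simp only [c', mul_assoc]
        exact (hupd _ _ (hc m n A)).mul_left _
      change c j * F j m n A + (1 - c j) * ∑' i, c' i * F i m n A = rk m n A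
      rw [h1.tsum_eq, mul_inv_cancel_left₀ hpos.ne']
      ring
    · have hz : ∀ i, i ≠ j → c i = 0 := by
        rw [heq, sub_self, hasSum_zero_iff_of_nonneg] at hupd1
        · intro i hi
          simpa [hi] using congrFun hupd1 i
        · intro i
          by_cases hi : i = j
          · simp [hi]
          · simpa [hi] using hc0 i
      funext m n A
      have h1 := hasSum_single (f := fun i => c i * F i m n A) j fun i hi => by
        rw [hz i hi, zero_mul]
      rw [heq, one_mul] at h1
      exact h1.unique (hc m n A)
  · rintro _ ⟨j, rfl⟩
    rw [mem_extremePoints_iff_left]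
    refine ⟨hF j, fun x₁ h₁ x₂ h₂ hx => ?_⟩
    obtain ⟨a, b, ha, hb, hab, hx⟩ := hx
    obtain ⟨c₁, hc₁0, hc₁1, hc₁⟩ := hex x₁ h₁
    obtain ⟨c₂, hc₂0, hc₂1, hc₂⟩ := hex x₂ h₂
    have h1 := huniq (F j) (fun i => a * c₁ i + b * c₂ i) (fun i => if i = j then 1 else 0)
      (by simpa [hab] using (hc₁1.mul_left a).add (hc₂1.mul_left b)) (by simpa using hsingle j 1)
      (fun m n A => by
        have h2 := ((hc₁ m n A).mul_left a).add ((hc₂ m n A).mul_left b)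
        have h3 : F j m n A = a * x₁ m n A + b * x₂ m n A := by rw [← hx]; rfl
        rw [h3]
        simpa only [add_mul, mul_assoc] using h2) (fun m n A => hsingle j _)
    have hz : ∀ i, i ≠ j → c₁ i = 0 := fun i hi => by
      have h2 := congrFun h1 i
      simp only [if_neg hi] at h2
      have h3 := mul_nonneg ha.le (hc₁0 i)
      have h4 := mul_nonneg hb.le (hc₂0 i)
      exact (mul_eq_zero.1 (by linarith : a * c₁ i = 0)).resolve_left ha.ne'
    have hj : c₁ j = 1 := (hasSum_single j hz).unique hc₁1
    funext m n A
    have h2 := hasSum_single (f := fun i => c₁ i * F i m n A) j fun i hi => by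
      rw [hz i hi, zero_mul]
    rw [hj, one_mul] at h2
    exact (hc₁ m n A).unique h2

/-- Infinite convex combinations of regular rank functions are regular. -/
theorem mem_regularSylvesterSpace_of_hasSum {R : Type u} [Ring R] {J : Type u} {F : J → MatFun R}
    (hF : ∀ j, F j ∈ regularSylvesterSpace R) {c : J → ℝ} (hc0 : ∀ j, 0 ≤ c j) (hc1 : HasSum c 1)
    {rk : MatFun R} (h : ∀ (m n : ℕ) (A : Matrix (Fin m) (Fin n) R),
      HasSum (fun j => c j * F j m n A) (rk m n A)) : rk ∈ regularSylvesterSpace R := by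
  choose U hU φ rk' hreg hrk' hF using hF
  -- The product of the regular rings is regular and carries the weighted sum of the ranks of its
  -- factors. Since `J` lives in `Type u`, so does the product, as `regularSylvesterSpace` requires.
  refine ⟨∀ j, U j, inferInstance, RingHom.pi φ,
    fun m n A => ∑' j, c j * pullbackRank (Pi.evalRingHom U j) (rk' j) m n A, fun x => ?_,
    IsSylvesterRank.tsum (fun j => IsSylvesterRank.pullback _ (hrk' j)) hc0 hc1, ?_⟩
  · choose y hy using fun j => hreg j (x j)
    exact ⟨y, funext hy⟩
  · funext m n A
    rw [← (h m n A).tsum_eq]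
    refine tsum_congr fun j => ?_
    rw [hF j]
    rfl

/-! ### The main theorem. -/

theorem mainTheorem1 {D : Type u} [DivisionRing D] (τ : D ≃+* D) (hτ : HasFiniteInnerOrder τ) :
    -- each maximal two-sided ideal is generated by a central element `p`, and for every such `p`
    -- the function `rk_{𝔪,k}` is the only rank function taking the values `(k - i) / k` on `p ^ i`
    (∀ 𝔪 : MaxTwoSided (SkewLaurent D τ),
      (∃ p ∈ Subring.center (SkewLaurent D τ), 𝔪.1 = Ideal.span {p}) ∧
      ∀ p ∈ Subring.center (SkewLaurent D τ), 𝔪.1 = Ideal.span {p} →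
        ∀ k : ℕ+, ∀ rk ∈ sylvesterSpace (SkewLaurent D τ),
          rk = SkewLaurent.rankMax τ 𝔪 k ↔
            ∀ i : ℕ, i ≤ k → rk 1 1 (Matrix.of fun _ _ => p ^ i) = ((k : ℝ) - i) / k) ∧
    -- the extreme points
    (sylvesterSpace (SkewLaurent D τ)).extremePoints ℝ = Set.range (SkewLaurent.rankFamily τ) ∧
    -- unique expression as a possibly infinite convex combination
    (∀ rk ∈ sylvesterSpace (SkewLaurent D τ),
      ∃! c : Option (MaxTwoSided (SkewLaurent D τ) × ℕ+) → ℝ,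
        (∀ j, 0 ≤ c j) ∧ HasSum c 1 ∧
        ∀ (m n : ℕ) (A : Matrix (Fin m) (Fin n) (SkewLaurent D τ)),
          HasSum (fun j => c j * SkewLaurent.rankFamily τ j m n A) (rk m n A)) ∧
    -- every rank function is regular
    sylvesterSpace (SkewLaurent D τ) = regularSylvesterSpace (SkewLaurent D τ) ∧
    -- restriction to the centre
    Set.BijOn (pullbackRank (Subring.center (SkewLaurent D τ)).subtype)
      (sylvesterSpace (SkewLaurent D τ))
      (sylvesterSpace (Subring.center (SkewLaurent D τ))) := by
  refine ⟨fun 𝔪 => ⟨⟨_, (SkewLaurent.centerGen hτ 𝔪).2, SkewLaurent.eq_span_centerGen hτ 𝔪⟩,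
    fun p hp h𝔪 k rk hrk => ⟨?_, fun h => ?_⟩⟩,
    extremePoints_eq_range_of_unique_combination (SkewLaurent.isSylvesterRank_rankFamily hτ)
      (fun rk hrk => SkewLaurent.exists_hasSum_rankFamily hτ hrk)
      fun rk c c' => SkewLaurent.coeff_unique hτ, fun rk hrk => ?_,
    Set.Subset.antisymm (fun rk hrk => ?_) ?_, SkewLaurent.bijOn_pullback_center hτ⟩
  · rintro rfl i hi
    exact SkewLaurent.elemRank_rankMax_pow (p := ⟨p, hp⟩)
      (SkewLaurent.irreducible_of_eq_span hτ h𝔪) h𝔪 k hi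
  · exact SkewLaurent.eq_rankMax hτ (p := ⟨p, hp⟩) h𝔪 hrk h
  · obtain ⟨c, hc0, hc1, hc⟩ := SkewLaurent.exists_hasSum_rankFamily hτ hrk
    exact ⟨c, ⟨hc0, hc1, hc⟩, fun c' ⟨_, hc1', hc'⟩ => SkewLaurent.coeff_unique hτ hc1' hc1 hc' hc⟩
  · obtain ⟨c, hc0, hc1, hc⟩ := SkewLaurent.exists_hasSum_rankFamily hτ hrk
    exact mem_regularSylvesterSpace_of_hasSum (SkewLaurent.rankFamily_mem_regularSylvesterSpace hτ)
      hc0 hc1 hc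
  · rintro _ ⟨U, _, φ, rk', -, hrk', rfl⟩
    exact IsSylvesterRank.pullback φ hrk'
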